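/- Let $\Sigma$ be a finite alphabet. A $\Sigma$-DAG $G=(V,E,s,t)$ is a finite directed acyclic graph with labelled edges $E\subseteq V\times\Sigma\times V$, in which every vertex lies on a path from the source $s$ to the sink $t$; $L(G)$ is the set of strings spelled out by the $(s,t)$-paths of $G$. For a set $\mathcal X=\{X_1,\dots,X_K\}$ of $K$ strings of equal length put $\mathrm{Div}(\mathcal X)=\sum_{i<j}d_H(X_i,X_j)$, where $d_H$ is the Hamming distance. *Max-Sum Diverse String Set* is the problem of finding, given an integer $K\ge1$ and a $\Sigma$-DAG $G$ with $L(G)\subseteq\Sigma^r$ for some $r\ge 0$, a set $\mathcal X\subseteq L(G)$ with $|\mathcal X|=K$ that maximizes $\mathrm{Div}(\mathcal X)$. *Max-Sum Diverse LCSs* for $m$ strings is the same problem with $L(G)$ replaced by the set $\mathrm{LCS}(S_1,\dots,S_m)$ of all longest common subsequences of $m$ given strings $S_1,\dots,S_m\in\Sigma^*$. **Theorem (PTAS for unbounded $K$).** When $K$ is part of the input, Max-Sum Diverse String Set on $\Sigma$-DAGs admits a PTAS, and for every constant $m\ge1$ so does Max-Sum Diverse LCSs for $m$ strings. That is, for each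 of these problems there is one word RAM program that, given a rational $\varepsilon>0$ and an instance, outputs a feasible set $\mathcal X$ (of $K$ distinct strings) with $\mathrm{Div}(\mathcal X)\ge(1-\varepsilon)\,\mathrm{Div}(\mathcal Y)$ for every feasible set $\mathcal Y$, or reports that there is no feasible set. For every fixed $\varepsilon$ its number of steps is bounded by a polynomial in $|E|+K$ (respectively in $|S_1|+\dots+|S_m|+K$), on words of $O(\log N)$ bits, where $N$ is the size $|E|+K$ (respectively $|S_1|+\dots+|S_m|+K$) plus the largest number in the presentation of the instance (vertices and symbols being numbers below $|V|$ and $|\Sigma|$). -/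

import Mathlib

namespace DiverseStrings

/-! ## Word RAM

A program works on scalar registers and on arrays of machine words. Register and array names are
part of the program text, so a program uses finitely many of them; indices into arrays are computed
(indirect addressing). Words have `w` bits. Finitely many arrays are, up to a constant factor
in the running time, one memory addressed with a stride. -/

/-- Expressions: constants, registers, array cells with a computed index, the word operations, and
comparisons with value `0` or `1`. -/
inductive Arith : Type
  | const (n : ℕ)
  | reg (x : ℕ)
  | read (a : ℕ) (i : Arith)
  | add (e f : Arith)
  | sub (e f : Arith)
  | mul (e f : Arith)
  | div (e f : Arith)
  | mod (e f : Arith)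
  | lt (e f : Arith)
  | eq (e f : Arith)

/-- Programs: no-operation, register assignment, array write `a[i] := e`, sequencing, branching and
`while` loops. A test succeeds when its value is not `0`. -/
inductive Com : Type
  | nop
  | assign (x : ℕ) (e : Arith)
  | write (a : ℕ) (i e : Arith)
  | seq (c d : Com)
  | ite (b : Arith) (c d : Com)
  | loop (b : Arith) (c : Com)

/-- A memory configuration: the contents of the registers and of the array cells. -/
structure State where
  reg : ℕ → ℕ
  arr : ℕ → ℕ → ℕ

/-- The initial configuration: the input is in array `0`, everything else is `0`. -/
def State.start (l : List ℕ) : State where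
  reg := fun _ => 0
  arr := fun a i => if a = 0 then l.getD i 0 else 0

/-- The configuration holds the list `l` as a prefix of the output array, which is array `1`. -/
def State.Outputs (st : State) (l : List ℕ) : Prop :=
  ∀ (i : ℕ) (h : i < l.length), st.arr 1 i = l[i]

/-- Value of an expression on a machine with `w`-bit words: addition and multiplication are modulo
`2 ^ w`, subtraction is truncated at `0`, division is integer division. -/
def Arith.eval (w : ℕ) (st : State) : Arith → ℕ
  | .const n => n % 2 ^ w
  | .reg x => st.reg x
  | .read a i => st.arr a (i.eval w st)
  | .add e f => (e.eval w st + f.eval w st) % 2 ^ w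
  | .sub e f => e.eval w st - f.eval w st
  | .mul e f => (e.eval w st * f.eval w st) % 2 ^ w
  | .div e f => e.eval w st / f.eval w st
  | .mod e f => e.eval w st % f.eval w st
  | .lt e f => if e.eval w st < f.eval w st then 1 else 0
  | .eq e f => if e.eval w st = f.eval w st then 1 else 0

/-- Time to evaluate an expression: one step for each operation, constant and register access. -/
def Arith.cost : Arith → ℕ
  | .const _ => 1
  | .reg _ => 1
  | .read _ i => i.cost + 1
  | .add e f => e.cost + f.cost + 1
  | .sub e f => e.cost + f.cost + 1
  | .mul e f => e.cost + f.cost + 1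
  | .div e f => e.cost + f.cost + 1
  | .mod e f => e.cost + f.cost + 1
  | .lt e f => e.cost + f.cost + 1
  | .eq e f => e.cost + f.cost + 1

/-- `Exec w c st st' t`: on a machine with `w`-bit words, the program `c` started in the
configuration `st` halts in the configuration `st'` after `t` steps. -/
inductive Exec (w : ℕ) : Com → State → State → ℕ → Prop
  | nop (st : State) : Exec w .nop st st 1
  | assign (st : State) (x : ℕ) (e : Arith) :
      Exec w (.assign x e) st
        { reg := Function.update st.reg x (e.eval w st), arr := st.arr } (e.cost + 1)
  | write (st : State) (a : ℕ) (i e : Arith) :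
      Exec w (.write a i e) st
        { reg := st.reg,
          arr := Function.update st.arr a
            (Function.update (st.arr a) (i.eval w st) (e.eval w st)) } (i.cost + e.cost + 1)
  | seq {c d : Com} {st₁ st₂ st₃ : State} {t₁ t₂ : ℕ} :
      Exec w c st₁ st₂ t₁ → Exec w d st₂ st₃ t₂ → Exec w (.seq c d) st₁ st₃ (t₁ + t₂)
  | ite_true {b : Arith} {c d : Com} {st st' : State} {t : ℕ} :
      b.eval w st ≠ 0 → Exec w c st st' t → Exec w (.ite b c d) st st' (b.cost + t + 1)
  | ite_false {b : Arith} {c d : Com} {st st' : State} {t : ℕ} :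
      b.eval w st = 0 → Exec w d st st' t → Exec w (.ite b c d) st st' (b.cost + t + 1)
  | loop_true {b : Arith} {c : Com} {st₁ st₂ st₃ : State} {t₁ t₂ : ℕ} :
      b.eval w st₁ ≠ 0 → Exec w c st₁ st₂ t₁ → Exec w (.loop b c) st₂ st₃ t₂ →
        Exec w (.loop b c) st₁ st₃ (b.cost + t₁ + t₂ + 1)
  | loop_false {b : Arith} {c : Com} {st : State} :
      b.eval w st = 0 → Exec w (.loop b c) st st (b.cost + 1)

/-! ## Maximization problems and approximation schemes -/

/-- A maximization problem: instances with their size and the list of words that presents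
them to a machine; candidate solutions, the feasible ones among them, their values, and the list of
words by which a machine writes them down. -/
structure MaxProblem where
  Inst : Type
  size : Inst → ℕ
  input : Inst → List ℕ
  Sol : Inst → Type
  Feasible : ∀ x, Sol x → Prop
  value : ∀ x, Sol x → ℕ
  output : ∀ x, Sol x → List ℕ

/-- A polynomial-time approximation scheme: one word RAM program that, given `ε` (numerator and
denominator) and an instance, halts within a number of steps that for each fixed `ε` is
polynomial in the size of the instance, on words whose number of bits is any number above a constant
multiple of the logarithm of the size and of the numbers in the instance. It outputs
`1` and a feasible solution whose value is at least `(1 - ε)` times that of every feasible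
solution, or `0` if there is no feasible solution. -/
def AdmitsPTAS (P : MaxProblem) : Prop :=
  ∃ prog : Com, ∀ ε : ℚ, 0 < ε → ∃ (p : Polynomial ℕ) (c : ℕ), ∀ (x : P.Inst) (w : ℕ),
    c * (Nat.log 2 (P.size x + (P.input x).foldr max 0) + 1) ≤ w →
    ∃ (st : State) (t : ℕ),
      Exec w prog (State.start (ε.num.natAbs :: ε.den :: P.input x)) st t ∧
      t ≤ p.eval (P.size x) ∧
      ((∃ Y, P.Feasible x Y) → ∃ X, P.Feasible x X ∧
        (∀ Y, P.Feasible x Y → (1 - ε) * (P.value x Y : ℚ) ≤ (P.value x X : ℚ)) ∧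
        st.Outputs (1 :: P.output x X)) ∧
      ((¬ ∃ Y, P.Feasible x Y) → st.Outputs [0])

/-! ## Diverse sets of strings -/

/-- Sum diversity of the strings `X 0, …, X (K - 1)` of length `r` under the Hamming distance. -/
def sumDiversity {K r : ℕ} {A : Type} [DecidableEq A] (X : Fin K → Fin r → A) : ℕ :=
  ∑ i : Fin K, ∑ j ∈ Finset.Ioi i, hammingDist (X i) (X j)

/-- `X` enumerates a set of `K` distinct strings of the language `L`. -/
def IsSubsetOfCard {K r : ℕ} {A : Type} (L : Set (List A)) (X : Fin K → Fin r → A) : Prop :=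
  Function.Injective X ∧ ∀ i, List.ofFn (X i) ∈ L

/-- The symbols of the strings `X 0, …, X (K - 1)`, written one after the other. -/
def concatStrings {K r σ : ℕ} (X : Fin K → Fin r → Fin σ) : List ℕ :=
  (List.ofFn fun i => List.ofFn fun j => (X i j : ℕ)).flatten

/-! ## Edge-labelled acyclic graphs -/

/-- A `Σ`-DAG with vertices `V` and alphabet `A`: labelled edges `(u, a, v)` without directed
cycles, a source `s` and a sink `t` such that every vertex lies on a path from `s` to `t` (so that
`s` is the only vertex without incoming edge and `t` the only one without outgoing edge). -/
structure SigmaDAG (V A : Type) where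
  E : Finset (V × A × V)
  s : V
  t : V
  acyclic : ∀ v, ¬ Relation.TransGen (fun u u' => ∃ a, (u, a, u') ∈ E) v v
  from_source : ∀ v, Relation.ReflTransGen (fun u u' => ∃ a, (u, a, u') ∈ E) s v
  to_sink : ∀ v, Relation.ReflTransGen (fun u u' => ∃ a, (u, a, u') ∈ E) v t

/-- Some path from the first to the second vertex spells out the string. -/
inductive SigmaDAG.Spells {V A : Type} (G : SigmaDAG V A) : V → List A → V → Prop
  | nil (v : V) : G.Spells v [] v
  | cons {u v v' : V} {a : A} {y : List A} :
      (u, a, v) ∈ G.E → G.Spells v y v' → G.Spells u (a :: y) v'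

/-- The language of a `Σ`-DAG: the strings spelled out by its paths from the source to the sink. -/
def SigmaDAG.language {V A : Type} (G : SigmaDAG V A) : Set (List A) :=
  {y | G.Spells G.s y G.t}

/-- An instance of diverse string set: a `Σ`-DAG with `n` vertices over `σ` symbols whose language
consists of strings of length `r`, presented by an enumeration of its edges, and
the number `K` of strings to select. -/
structure DagInstance where
  n : ℕ
  σ : ℕ
  K : ℕ
  r : ℕ
  one_le_K : 1 ≤ K
  G : SigmaDAG (Fin n) (Fin σ)
  edges : List (Fin n × Fin σ × Fin n)
  edges_nodup : edges.Nodup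
  mem_edges : ∀ e, e ∈ edges ↔ e ∈ G.E
  equiLength : ∀ y ∈ G.language, y.length = r

/-- Max-Sum Diverse String Set on `Σ`-DAGs, with `K` in the input. The size of an
instance is the number of edges plus `K`. -/
def maxSumDiverseStringSet : MaxProblem where
  Inst := DagInstance
  size x := x.G.E.card + x.K
  input x := x.K :: x.r :: x.n :: x.σ :: (x.G.s : ℕ) :: (x.G.t : ℕ) :: x.edges.length ::
    x.edges.flatMap fun e => [(e.1 : ℕ), (e.2.1 : ℕ), (e.2.2 : ℕ)]
  Sol x := Fin x.K → Fin x.r → Fin x.σ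
  Feasible x X := IsSubsetOfCard x.G.language X
  value _ X := sumDiversity X
  output _ X := concatStrings X

/-! ## Longest common subsequences -/

/-- `y` is a common subsequence of the strings `S i`. -/
def IsCS {m : ℕ} {A : Type} (S : Fin m → List A) (y : List A) : Prop :=
  ∀ i, y.Sublist (S i)

/-- The set of all longest common subsequences. -/
def LCS {m : ℕ} {A : Type} (S : Fin m → List A) : Set (List A) :=
  {y | IsCS S y ∧ ∀ z, IsCS S z → z.length ≤ y.length}

/-- The common length of the longest common subsequences (for `m ≥ 1`). -/
noncomputable def lcsLength {m : ℕ} {A : Type} (S : Fin m → List A) : ℕ :=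
  sSup {k | ∃ y, IsCS S y ∧ y.length = k}

/-- An instance of diverse LCSs: `m` strings over `σ` symbols, and the number `K` of
longest common subsequences to select. -/
structure LcsInstance (m : ℕ) where
  σ : ℕ
  K : ℕ
  one_le_K : 1 ≤ K
  S : Fin m → List (Fin σ)

/-- Max-Sum Diverse LCSs for `m` strings, with `K` in the input. The size of an
instance is the total length of the strings plus `K`. -/
noncomputable def maxSumDiverseLCS (m : ℕ) : MaxProblem where
  Inst := LcsInstance m
  size x := (∑ i, (x.S i).length) + x.K
  input x := x.K :: x.σ :: ((List.ofFn fun i => (x.S i).length) ++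
    (List.ofFn fun i => (x.S i).map fun a => (a : ℕ)).flatten)
  Sol x := Fin x.K → Fin (lcsLength x.S) → Fin x.σ
  Feasible x X := IsSubsetOfCard (LCS x.S) X
  value _ X := sumDiversity X
  output _ X := concatStrings X

end DiverseStrings

/-!
Both problems ask for `K` distinct strings of greatest total distance among the strings of length
`r` that a small acyclic automaton accepts. For a graph the automaton is the graph itself. For
longest common subsequences its states are the tuples of suffixes of the given strings, an edge
jumps behind an occurrence of its label in each suffix, and the strings of length `r` are those
sought if `r` is the length of a longest path (`LcsInstance.IsTable.isGreatest`). In both cases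
`Core.Recognizes` links the strings accepted to the language of the problem.

**The search.** Suppose that `kk` strings are given. The search finds `p` new ones, distinct from
each other and from the strings that are kept, such that the total distance after they are added, or
exchanged for one old string, is as great as possible (`Core.search_spec`). It is a reachability problem in a
graph of configurations: the `p` strings are read in parallel, and a configuration consists of the
number of symbols still to be read, the index of the string to be exchanged, the `p` states of the
automaton, the part still to be found of the distances announced at the start (their sum over the
old strings, and each distance of two new ones), and for each new string one old string that agrees
with it so far. The last item suffices to tell in the end whether the new string differs from all the
old ones. For constant `p` the number of configurations
is polynomial, and as the first item decreases, a single pass through the table of configurations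
decides reachability.

**The approximation.** Let `ε = a / b`. If `K < 4 / ε`, all `K` strings are searched for at once,
with `p = K` and no old strings, and the result is optimal. Otherwise the search is run with
`p = 1`: first the strings are chosen greedily, then single strings are exchanged as long as the
total distance grows, which happens at most `K ^ 2 * r` times. A local optimum `X` has at least
`(K - 1) / (K + 3)` times the total distance of any other choice `Y` (`local_optimum_bound`). Indeed,
let `d X Y` be the sum of the distances of all pairs, match the strings of `Y` with those of `X`,
common ones with themselves, and sum up over all matched pairs the inequalities that say that their
exchange does not pay. This gives `d X Y ≤ d X X + P`, where `P` is the sum of the distances of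
matched strings, and `K * P ≤ d X Y + d X X` by the triangle inequality. Since the Hamming distance
is of negative type, also `d X X + d Y Y ≤ 2 * d X Y`. The three inequalities imply the bound.

**The machine.** The word RAM program is not written down as such. Every table in the algorithm is
filled by a bounded expression, built from the word operations, array access and sums over all
numbers below `C`; bounded programs (`BProg`) tabulate such expressions, in sequence and repeatedly.
All loops make exactly `C` rounds, and numbers that are not below `D` are stored as `0`. So the
running time is a polynomial in `C`, and on words that can hold a fixed power of `D` nothing
overflows, whatever the program computes (`BProg.exec_comp`). Here `C` is the power of a number
linear in the size with the exponent `expo e b`, which depends on `ε` only, and it exceeds the codes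
of all configurations (`admitsPTAS_of`, `Mem.solve_spec`). That a function defined by a formula is
given by a bounded expression is left to the instances of `Ev` and `EvP`.
-/

namespace DiverseStrings

open Finset

/-! ### Bounded expressions -/

/-- Binary word operations. -/
inductive Op : Type
  | add | sub | mul | div | mod | lt | eq

/-- The machine expression of a binary operation. -/
def Op.arith : Op → Arith → Arith → Arith
  | .add => .add
  | .sub => .sub
  | .mul => .mul
  | .div => .div
  | .mod => .mod
  | .lt => .lt
  | .eq => .eq

/-- The binary operation on natural numbers, without overflow. -/
def Op.eval : Op → ℕ → ℕ → ℕ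
  | .add, a, b => a + b
  | .sub, a, b => a - b
  | .mul, a, b => a * b
  | .div, a, b => a / b
  | .mod, a, b => a % b
  | .lt, a, b => if a < b then 1 else 0
  | .eq, a, b => if a = b then 1 else 0

theorem Op.arith_cost (o : Op) (e f : Arith) : (o.arith e f).cost = e.cost + f.cost + 1 := by
  cases o <;> rfl

theorem Op.arith_eval (o : Op) {e f : Arith} {w : ℕ} {st : State}
    (h : o.eval (e.eval w st) (f.eval w st) < 2 ^ w) :
    (o.arith e f).eval w st = o.eval (e.eval w st) (f.eval w st) := by
  cases o <;> simp_all [Op.arith, Op.eval, Arith.eval, Nat.mod_eq_of_lt]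

theorem Op.eval_le (o : Op) (a b : ℕ) : o.eval a b ≤ (a + 1) * (b + 1) := by
  cases o <;> simp only [Op.eval]
  · nlinarith
  · exact (Nat.sub_le _ _).trans (by nlinarith)
  · nlinarith
  · exact (Nat.div_le_self _ _).trans (by nlinarith)
  · exact (Nat.mod_le _ _).trans (by nlinarith)
  · split <;> nlinarith
  · split <;> nlinarith

/-- The memory seen by a bounded program: the arrays, the number `C` of rounds of every loop, and
the strict upper bound `D` on the numbers that may be stored. -/
structure Mem where
  C : ℕ
  D : ℕ
  arr : ℕ → ℕ → ℕ

/-- No number in the memory exceeds `D`. -/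
def Mem.Bounded (m : Mem) : Prop := m.C ≤ m.D ∧ ∀ a i, m.arr a i ≤ m.D

/-- Bounded expressions: the only binder is summation over all indices below `C`. Variables are
de Bruijn levels. -/
inductive BTerm : Type
  | const (n : ℕ)
  | var (x : ℕ)
  | read (a : ℕ) (e : BTerm)
  | op (o : Op) (e f : BTerm)
  | sum (e : BTerm)

/-- The value of a bounded expression whose free variables are those below `d`. -/
def BTerm.eval (m : Mem) : BTerm → ℕ → (ℕ → ℕ) → ℕ
  | .const n, _, _ => n
  | .var x, d, ρ => if x < d then ρ x else 0
  | .read a e, d, ρ => m.arr a (e.eval m d ρ)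
  | .op o e f, d, ρ => o.eval (e.eval m d ρ) (f.eval m d ρ)
  | .sum e, d, ρ => ∑ i ∈ range m.C, e.eval m (d + 1) (Function.update ρ d i)

/-- An exponent `g` such that the value of the expression is at most `(D + 2) ^ g`. -/
def BTerm.deg : BTerm → ℕ
  | .const n => n
  | .var _ => 1
  | .read _ e => e.deg + 1
  | .op _ e f => e.deg + f.deg + 2
  | .sum e => e.deg + 1

theorem BTerm.eval_le {m : Mem} (hm : m.Bounded) (e : BTerm) : ∀ (d : ℕ) (ρ : ℕ → ℕ),
    (∀ x < d, ρ x ≤ m.D) → e.eval m d ρ ≤ (m.D + 2) ^ e.deg := by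
  have h1 : ∀ k, 1 ≤ (m.D + 2) ^ k := fun k => Nat.one_le_pow _ _ (by omega)
  induction e with
  | const n =>
    intro d ρ _
    exact (Nat.lt_two_pow_self (n := n)).le.trans (Nat.pow_le_pow_left (by omega) n)
  | var x =>
    intro d ρ h
    simp only [BTerm.eval, BTerm.deg, pow_one]
    split
    · exact (h x ‹_›).trans (by omega)
    · omega
  | read a e ih =>
    intro d ρ h
    simp only [BTerm.eval, BTerm.deg]
    refine (hm.2 _ _).trans ?_
    rw [pow_succ]
    nlinarith [h1 e.deg]
  | op o e f ihe ihf =>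
    intro d ρ h
    simp only [BTerm.eval, BTerm.deg]
    refine (Op.eval_le _ _ _).trans ?_
    have he := ihe d ρ h
    have hf := ihf d ρ h
    have : (m.D + 2) ^ (e.deg + f.deg + 2)
        = ((m.D + 2) ^ e.deg * (m.D + 2)) * ((m.D + 2) ^ f.deg * (m.D + 2)) := by ring
    rw [this]
    exact Nat.mul_le_mul (by nlinarith [h1 e.deg]) (by nlinarith [h1 f.deg])
  | sum e ih =>
    intro d ρ h
    simp only [BTerm.eval, BTerm.deg]
    calc ∑ i ∈ range m.C, e.eval m (d + 1) (Function.update ρ d i)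
        ≤ ∑ i ∈ range m.C, (m.D + 2) ^ e.deg := by
          refine sum_le_sum fun i hi => ih _ _ fun x hx => ?_
          rw [mem_range] at hi
          rcases eq_or_ne x d with rfl | hne
          · simpa using hi.le.trans hm.1
          · rw [Function.update_of_ne hne]
            exact h x (by omega)
      _ = m.C * (m.D + 2) ^ e.deg := by simp
      _ ≤ (m.D + 2) ^ e.deg * (m.D + 2) := by
          rw [mul_comm]
          exact Nat.mul_le_mul_left _ (hm.1.trans (by omega))
      _ = _ := (pow_succ _ _).symm

/-! ### Counting loops -/

/-- The loop that runs `c` with the register `y` counting from `0` up to the content of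
register `0`. -/
def forLoop (y : ℕ) (c : Com) : Com :=
  .seq (.assign y (.const 0))
    (.loop (.lt (.reg y) (.reg 0)) (.seq c (.assign y (.add (.reg y) (.const 1)))))

/-- The configuration after storing `v` in register `y`. -/
def State.setReg (st : State) (y v : ℕ) : State where
  reg := Function.update st.reg y v
  arr := st.arr

theorem Exec.of_time_eq {w t t' : ℕ} {c : Com} {st st' : State} (h : Exec w c st st' t)
    (ht : t = t') : Exec w c st st' t' := ht ▸ h

/-- A loop whose body runs in the same time `τ` in every round; the invariant speaks of the
configuration in which the counter has its value for the next round. -/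
theorem exec_forLoop {w C τ y : ℕ} {c : Com} (hy : y ≠ 0) (hC : C < 2 ^ w)
    (Inv : ℕ → State → Prop)
    (body : ∀ i < C, ∀ st, st.reg 0 = C → st.reg y = i → Inv i st →
      ∃ st', Exec w c st st' τ ∧ st'.reg 0 = C ∧ st'.reg y = i ∧ Inv (i + 1) (st'.setReg y (i + 1)))
    (st : State) (h0 : st.reg 0 = C) (hInv : Inv 0 (st.setReg y 0)) :
    ∃ st', Exec w (forLoop y c) st st' (C * (τ + 8) + 6) ∧ Inv C st' := by
  have hloop : ∀ k i, i + k = C → ∀ st, st.reg 0 = C → st.reg y = i → Inv i st →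
      ∃ st', Exec w (.loop (.lt (.reg y) (.reg 0))
        (.seq c (.assign y (.add (.reg y) (.const 1))))) st st' (k * (τ + 8) + 4) ∧
        Inv C st' := by
    intro k
    induction k with
    | zero =>
      intro i hi st h0 hyi hI
      obtain rfl : i = C := by omega
      refine ⟨st, ?_, hI⟩
      have := Exec.loop_false (w := w) (b := .lt (.reg y) (.reg 0))
        (c := .seq c (.assign y (.add (.reg y) (.const 1)))) (st := st)
        (by simp [Arith.eval, h0, hyi])
      simpa [Arith.cost] using this
    | succ k ih =>
      intro i hi st h0 hyi hI
      obtain ⟨st₁, he, h0₁, hy₁, hI₁⟩ := body i (by omega) st h0 hyi hI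
      have hlt : i + 1 < 2 ^ w := by omega
      have h1lt : 1 < 2 ^ w := by omega
      have hassign := Exec.assign (w := w) st₁ y (.add (.reg y) (.const 1))
      have hval : (Arith.add (.reg y) (.const 1)).eval w st₁ = i + 1 := by
        simp [Arith.eval, hy₁, Nat.mod_eq_of_lt hlt]
      rw [hval] at hassign
      obtain ⟨st₂, hl, hI₂⟩ := ih (i + 1) (by omega) (st₁.setReg y (i + 1))
        (by simp [State.setReg, Function.update_of_ne hy.symm, h0₁])
        (by simp [State.setReg]) hI₁
      refine ⟨st₂, ?_, hI₂⟩
      have := Exec.loop_true (w := w) (b := .lt (.reg y) (.reg 0))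
        (by simp [Arith.eval, h0, hyi]; omega) (Exec.seq he hassign) hl
      refine this.of_time_eq ?_
      simp only [Arith.cost]
      ring
  have hassign := Exec.assign (w := w) st y (.const 0)
  have hval : (Arith.const 0).eval w st = 0 := by simp [Arith.eval]
  rw [hval] at hassign
  obtain ⟨st', hl, hI⟩ := hloop C 0 (by omega) (st.setReg y 0)
    (by simp [State.setReg, Function.update_of_ne hy.symm, h0]) (by simp [State.setReg]) hInv
  refine ⟨st', ?_, hI⟩
  refine (Exec.seq hassign hl).of_time_eq ?_
  simp only [Arith.cost]
  ring

/-! ### Compilation of bounded expressions -/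

/-- Machine code that puts the value of the expression into the temporary register `3 * b + 3`.
Variable `x` lives in register `3 * x + 2`; registers `0` and `1` hold `C` and `D`. -/
def BTerm.comp : BTerm → ℕ → ℕ → Com
  | .const n, _, b => .assign (3 * b + 3) (.const n)
  | .var x, d, b => .assign (3 * b + 3) (if x < d then .reg (3 * x + 2) else .const 0)
  | .read a e, d, b => .seq (e.comp d b) (.assign (3 * b + 3) (.read a (.reg (3 * b + 3))))
  | .op o e f, d, b => .seq (.seq (e.comp d b) (f.comp d (b + 1)))
      (.assign (3 * b + 3) (o.arith (.reg (3 * b + 3)) (.reg (3 * (b + 1) + 3))))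
  | .sum e, d, b => .seq (.assign (3 * b + 3) (.const 0)) (forLoop (3 * d + 2)
      (.seq (e.comp (d + 1) (b + 1))
        (.assign (3 * b + 3) (.add (.reg (3 * b + 3)) (.reg (3 * (b + 1) + 3))))))

/-- The running time of the code of an expression, as a polynomial in `C`. -/
noncomputable def BTerm.time : BTerm → Polynomial ℕ
  | .const _ => 2
  | .var _ => 2
  | .read _ e => e.time + 3
  | .op _ e f => e.time + f.time + 4
  | .sum e => 2 + (Polynomial.X * (e.time + 4 + 8) + 6)

/-- The registers that the code of an expression with free variables below `d` leaves alone
when it may use the temporaries from `b` on. -/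
def Protected (d b y : ℕ) : Prop :=
  (y % 3 = 0 ∧ y < 3 * b + 3) ∨ y % 3 = 1 ∨ (y % 3 = 2 ∧ y < 3 * d + 2)

/-- The machine configuration `st` represents the memory `m`. -/
structure State.Rep (st : State) (m : Mem) : Prop where
  reg_zero : st.reg 0 = m.C
  reg_one : st.reg 1 = m.D
  arr : st.arr = m.arr

/-- The code of an expression computes its value, since by `BTerm.eval_le` no intermediate result
overflows. -/
theorem BTerm.exec_comp {w : ℕ} {m : Mem} (hm : m.Bounded) (e : BTerm) :
    ∀ (d b : ℕ) (ρ : ℕ → ℕ), (∀ x < d, ρ x ≤ m.D) → (m.D + 2) ^ (e.deg + 1) < 2 ^ w →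
    ∀ st : State, st.Rep m → (∀ x < d, st.reg (3 * x + 2) = ρ x) →
    ∃ st' : State, Exec w (e.comp d b) st st' (e.time.eval m.C) ∧ st'.arr = st.arr ∧
      st'.reg (3 * b + 3) = e.eval m d ρ ∧ ∀ y, Protected d b y → st'.reg y = st.reg y := by
  have hmono : ∀ {k l : ℕ}, k ≤ l → (m.D + 2) ^ l < 2 ^ w → (m.D + 2) ^ k < 2 ^ w :=
    fun h h' => (Nat.pow_le_pow_right (by omega) h).trans_lt h'
  induction e with
  | const n =>
    intro d b ρ hρ hw st hst hv
    have hn := (BTerm.eval_le hm (.const n) d ρ hρ).trans_lt (hmono (Nat.le_succ _) hw)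
    refine ⟨_, (Exec.assign st (3 * b + 3) (.const n)).of_time_eq
      (by simp [BTerm.time, Arith.cost]), rfl, ?_, ?_⟩
    · simp only [BTerm.eval] at hn
      simp [BTerm.eval, Arith.eval, Nat.mod_eq_of_lt hn]
    · intro y hy
      exact Function.update_of_ne (by unfold Protected at hy; omega) _ _
  | var x =>
    intro d b ρ hρ hw st hst hv
    refine ⟨_, (Exec.assign st (3 * b + 3)
      (if x < d then Arith.reg (3 * x + 2) else .const 0)).of_time_eq ?_, rfl, ?_, ?_⟩
    · split <;> simp [BTerm.time, Arith.cost]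
    · simp only [BTerm.eval, Function.update_self]
      split
      · exact hv x ‹_›
      · simp [Arith.eval]
    · intro y hy
      exact Function.update_of_ne (by unfold Protected at hy; omega) _ _
  | read a e ih =>
    intro d b ρ hρ hw st hst hv
    obtain ⟨st₁, h₁, ha₁, hr₁, hp₁⟩ :=
      ih d b ρ hρ (hmono (by simp only [BTerm.deg]; omega) hw) st hst hv
    refine ⟨_, (Exec.seq h₁ (Exec.assign st₁ (3 * b + 3)
      (.read a (.reg (3 * b + 3))))).of_time_eq ?_, ?_, ?_, ?_⟩
    · simp [BTerm.time, Arith.cost]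
    · exact ha₁
    · simp [Arith.eval, BTerm.eval, hr₁, ha₁, hst.arr]
    · intro y hy
      rw [← hp₁ y hy]
      exact Function.update_of_ne (by unfold Protected at hy; omega) _ _
  | op o e f ihe ihf =>
    intro d b ρ hρ hw st hst hv
    obtain ⟨st₁, h₁, ha₁, hr₁, hp₁⟩ :=
      ihe d b ρ hρ (hmono (by simp only [BTerm.deg]; omega) hw) st hst hv
    obtain ⟨st₂, h₂, ha₂, hr₂, hp₂⟩ :=
      ihf d (b + 1) ρ hρ (hmono (by simp only [BTerm.deg]; omega) hw) st₁
        ⟨(hp₁ 0 (by unfold Protected; omega)).trans hst.reg_zero,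
          (hp₁ 1 (by unfold Protected; omega)).trans hst.reg_one, ha₁.trans hst.arr⟩
        (fun x hx => (hp₁ _ (by unfold Protected; omega)).trans (hv x hx))
    have hr₁' : st₂.reg (3 * b + 3) = e.eval m d ρ :=
      (hp₂ _ (by unfold Protected; omega)).trans hr₁
    have hlt := (BTerm.eval_le hm (.op o e f) d ρ hρ).trans_lt (hmono (Nat.le_succ _) hw)
    have hval : (o.arith (.reg (3 * b + 3)) (.reg (3 * (b + 1) + 3))).eval w st₂
        = (BTerm.op o e f).eval m d ρ := by
      rw [Op.arith_eval] <;> simp only [Arith.eval, hr₁', hr₂, BTerm.eval]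
      exact hlt
    refine ⟨_, (Exec.seq (Exec.seq h₁ h₂) (Exec.assign st₂ (3 * b + 3)
      (o.arith (.reg (3 * b + 3)) (.reg (3 * (b + 1) + 3))))).of_time_eq ?_, ?_, ?_, ?_⟩
    · simp [BTerm.time, Arith.cost, Op.arith_cost]
    · exact ha₂.trans ha₁
    · simp [hval]
    · intro y hy
      have hy' : Protected d (b + 1) y := by unfold Protected at hy ⊢; omega
      rw [← hp₁ y hy, ← hp₂ y hy']
      exact Function.update_of_ne (by unfold Protected at hy; omega) _ _
  | sum e ih =>
    intro d b ρ hρ hw st hst hv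
    have hw' := hmono (k := e.deg + 1) (by simp only [BTerm.deg]; omega) hw
    have hlt := (BTerm.eval_le hm (.sum e) d ρ hρ).trans_lt (hmono (Nat.le_succ _) hw)
    have hC : m.C < 2 ^ w := by
      have h2 : m.D + 2 ≤ (m.D + 2) ^ (e.deg + 1) := Nat.le_self_pow (by omega) _
      have := hm.1
      omega
    let psum : ℕ → ℕ := fun i => ∑ j ∈ range i, e.eval m (d + 1) (Function.update ρ d j)
    have hpsum : ∀ i ≤ m.C, psum i < 2 ^ w := fun i hi =>
      (sum_le_sum_of_subset (range_subset_range.2 hi)).trans_lt hlt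
    let Inv : ℕ → State → Prop := fun i s => s.arr = st.arr ∧ s.reg (3 * b + 3) = psum i ∧
      ∀ y, Protected d b y → s.reg y = st.reg y
    have hbody : ∀ i < m.C, ∀ s : State, s.reg 0 = m.C → s.reg (3 * d + 2) = i → Inv i s →
        ∃ s', Exec w (.seq (e.comp (d + 1) (b + 1))
          (.assign (3 * b + 3) (.add (.reg (3 * b + 3)) (.reg (3 * (b + 1) + 3))))) s s'
          (e.time.eval m.C + 4) ∧ s'.reg 0 = m.C ∧ s'.reg (3 * d + 2) = i ∧
          Inv (i + 1) (s'.setReg (3 * d + 2) (i + 1)) := by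
      intro i hi s h0 hdi ⟨ha, hs, hp⟩
      obtain ⟨s₁, h₁, ha₁, hr₁, hp₁⟩ := ih (d + 1) (b + 1) (Function.update ρ d i)
        (by
          intro x hx
          rcases eq_or_ne x d with rfl | hne
          · simpa using hi.le.trans hm.1
          · rw [Function.update_of_ne hne]; exact hρ x (by omega))
        hw' s ⟨h0, (hp 1 (by unfold Protected; omega)).trans hst.reg_one, ha.trans hst.arr⟩
        (by
          intro x hx
          rcases eq_or_ne x d with rfl | hne
          · simpa using hdi
          · rw [Function.update_of_ne hne, ← hv x (by omega)]
            exact hp _ (by unfold Protected; omega))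
      have hs₁ : s₁.reg (3 * b + 3) = psum i := (hp₁ _ (by unfold Protected; omega)).trans hs
      have hval : (Arith.add (.reg (3 * b + 3)) (.reg (3 * (b + 1) + 3))).eval w s₁
          = psum (i + 1) := by
        have h := hpsum (i + 1) hi
        have h' : psum (i + 1) = psum i + e.eval m (d + 1) (Function.update ρ d i) :=
          sum_range_succ _ _
        simp only [Arith.eval, hs₁, hr₁]
        rw [← h', Nat.mod_eq_of_lt h]
      refine ⟨s₁.setReg (3 * b + 3) (psum (i + 1)), ?_, ?_, ?_, ?_, ?_, ?_⟩
      · have := Exec.seq h₁ (Exec.assign (w := w) s₁ (3 * b + 3)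
          (.add (.reg (3 * b + 3)) (.reg (3 * (b + 1) + 3))))
        rw [hval] at this
        exact this.of_time_eq (by simp [Arith.cost])
      · simp only [State.setReg]
        rw [Function.update_of_ne (by omega), hp₁ _ (by unfold Protected; omega), h0]
      · simp only [State.setReg]
        rw [Function.update_of_ne (by omega), hp₁ _ (by unfold Protected; omega), hdi]
      · exact ha₁.trans ha
      · simp only [State.setReg]
        rw [Function.update_of_ne (by omega), Function.update_self]
      · intro y hy
        simp only [State.setReg]
        rw [Function.update_of_ne (by unfold Protected at hy; omega),
          Function.update_of_ne (by unfold Protected at hy; omega),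
          hp₁ _ (by unfold Protected at hy ⊢; omega), hp y hy]
    obtain ⟨s', he, hI⟩ := exec_forLoop (by omega) hC Inv hbody (st.setReg (3 * b + 3) 0)
      (by simp only [State.setReg]; rw [Function.update_of_ne (by omega), hst.reg_zero])
      ⟨rfl, by
          simp only [State.setReg]
          rw [Function.update_of_ne (by omega), Function.update_self]
          simp [psum],
        by
          intro y hy
          simp only [State.setReg]
          rw [Function.update_of_ne (by unfold Protected at hy; omega),
            Function.update_of_ne (by unfold Protected at hy; omega)]⟩
    refine ⟨s', ?_, hI.1, hI.2.1, hI.2.2⟩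
    have h0 := Exec.assign (w := w) st (3 * b + 3) (.const 0)
    have hval : (Arith.const 0).eval w st = 0 := by simp [Arith.eval]
    rw [hval] at h0
    exact (Exec.seq h0 he).of_time_eq (by simp [BTerm.time, Arith.cost])

/-! ### Bounded programs -/

/-- The number `v` is stored as it is if it is below `D`, and as `0` otherwise. -/
def cap (D v : ℕ) : ℕ := if v < D then v else 0

/-- The memory after storing (the capped) `v` in cell `i` of array `a`. -/
def Mem.store (m : Mem) (a i v : ℕ) : Mem where
  C := m.C
  D := m.D
  arr := Function.update m.arr a (Function.update (m.arr a) i (cap m.D v))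

/-- The memory after the first `k` rounds of tabulating `f` into array `a`. -/
def Mem.tabUpTo (a : ℕ) (f : Mem → ℕ → ℕ) (m : Mem) : ℕ → Mem
  | 0 => m
  | i + 1 => (m.tabUpTo a f i).store a i (f (m.tabUpTo a f i) i)

/-- The memory after tabulating `f` into the first `C` cells of array `a`, one after the other;
`f` may read the cells already written. -/
def Mem.tab (m : Mem) (a : ℕ) (f : Mem → ℕ → ℕ) : Mem := m.tabUpTo a f m.C

/-- Bounded programs: tabulation of an expression with one free variable, sequencing, and
repeating a program `C` times. -/
inductive BProg : Type
  | tab (a : ℕ) (e : BTerm)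
  | seq (s u : BProg)
  | rep (s : BProg)

/-- The effect of a bounded program on the memory. -/
def BProg.den : BProg → Mem → Mem
  | .tab a e, m => m.tab a fun m i => e.eval m 1 (Function.update (fun _ => 0) 0 i)
  | .seq s u, m => u.den (s.den m)
  | .rep s, m => s.den^[m.C] m

theorem Mem.tabUpTo_C (a : ℕ) (f : Mem → ℕ → ℕ) (m : Mem) (k : ℕ) :
    (m.tabUpTo a f k).C = m.C ∧ (m.tabUpTo a f k).D = m.D := by
  induction k with
  | zero => exact ⟨rfl, rfl⟩
  | succ k ih => exact ih

theorem cap_le (D v : ℕ) : cap D v ≤ D := by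
  unfold cap; split <;> omega

theorem cap_of_lt {D v : ℕ} (h : v < D) : cap D v = v := if_pos h

theorem Mem.Bounded.store {m : Mem} (hm : m.Bounded) (a i v : ℕ) : (m.store a i v).Bounded := by
  refine ⟨hm.1, fun a' i' => ?_⟩
  simp only [Mem.store]
  rcases eq_or_ne a' a with rfl | ha
  · rw [Function.update_self]
    rcases eq_or_ne i' i with rfl | hi
    · rw [Function.update_self]; exact cap_le _ _
    · rw [Function.update_of_ne hi]; exact hm.2 _ _
  · rw [Function.update_of_ne ha]; exact hm.2 _ _

theorem Mem.Bounded.tabUpTo {m : Mem} (hm : m.Bounded) (a : ℕ) (f : Mem → ℕ → ℕ) (k : ℕ) :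
    (m.tabUpTo a f k).Bounded := by
  induction k with
  | zero => exact hm
  | succ k ih => exact ih.store _ _ _

theorem BProg.den_bounded (s : BProg) : ∀ {m : Mem}, m.Bounded →
    (s.den m).Bounded ∧ (s.den m).C = m.C ∧ (s.den m).D = m.D := by
  induction s with
  | tab a e => intro m hm; exact ⟨hm.tabUpTo _ _ _, m.tabUpTo_C _ _ _⟩
  | seq s u ihs ihu =>
    intro m hm
    obtain ⟨h1, h2, h3⟩ := ihs hm
    obtain ⟨h1', h2', h3'⟩ := ihu h1
    exact ⟨h1', h2'.trans h2, h3'.trans h3⟩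
  | rep s ih =>
    intro m hm
    have : ∀ k, (s.den^[k] m).Bounded ∧ (s.den^[k] m).C = m.C ∧ (s.den^[k] m).D = m.D := by
      intro k
      induction k with
      | zero => exact ⟨hm, rfl, rfl⟩
      | succ k ihk =>
        rw [Function.iterate_succ_apply']
        obtain ⟨h1, h2, h3⟩ := ih ihk.1
        exact ⟨h1, h2.trans ihk.2.1, h3.trans ihk.2.2⟩
    exact this m.C

/-- Machine code of a bounded program nested in `k` repetitions, whose counters are in the registers
`3 * x + 4` with `x < k`. The product in a tabulation is the capped value. -/
def BProg.comp : BProg → ℕ → Com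
  | .tab a e, _ => forLoop 2 (.seq (e.comp 1 0)
      (.write a (.reg 2) (.mul (.lt (.reg 3) (.reg 1)) (.reg 3))))
  | .seq s u, k => .seq (s.comp k) (u.comp k)
  | .rep s, k => forLoop (3 * k + 4) (s.comp (k + 1))

/-- The running time of a bounded program, as a polynomial in `C`. -/
noncomputable def BProg.time : BProg → Polynomial ℕ
  | .tab _ e => Polynomial.X * (e.time + 7 + 8) + 6
  | .seq s u => s.time + u.time
  | .rep s => Polynomial.X * (s.time + 8) + 6

/-- An exponent `g` such that no overflow occurs on words that can hold `(D + 2) ^ g`. -/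
def BProg.deg : BProg → ℕ
  | .tab _ e => e.deg + 1
  | .seq s u => s.deg + u.deg
  | .rep s => s.deg + 1

/-- The machine code of a bounded program computes its effect on the memory. -/
theorem BProg.exec_comp {w : ℕ} (s : BProg) : ∀ (k : ℕ) {m : Mem}, m.Bounded →
    (m.D + 2) ^ s.deg < 2 ^ w → ∀ st : State, st.Rep m →
    ∃ st' : State, Exec w (s.comp k) st st' (s.time.eval m.C) ∧ st'.Rep (s.den m) ∧
      ∀ x < k, st'.reg (3 * x + 4) = st.reg (3 * x + 4) := by
  have hmono : ∀ {D k l : ℕ}, k ≤ l → (D + 2) ^ l < 2 ^ w → (D + 2) ^ k < 2 ^ w :=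
    fun h h' => (Nat.pow_le_pow_right (by omega) h).trans_lt h'
  induction s with
  | tab a e =>
    intro k m hm hw st hst
    have hlt : m.D + 2 < 2 ^ w := by
      have := hmono (D := m.D) (k := 1) (l := e.deg + 1) (by omega) hw
      simpa using this
    have hC : m.C < 2 ^ w := by have := hm.1; omega
    let f : Mem → ℕ → ℕ := fun m i => e.eval m 1 (Function.update (fun _ => 0) 0 i)
    let Inv : ℕ → State → Prop := fun i s =>
      s.Rep (m.tabUpTo a f i) ∧ ∀ x, s.reg (3 * x + 4) = st.reg (3 * x + 4)
    have hbody : ∀ i < m.C, ∀ s : State, s.reg 0 = m.C → s.reg 2 = i → Inv i s →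
        ∃ s', Exec w (.seq (e.comp 1 0)
          (.write a (.reg 2) (.mul (.lt (.reg 3) (.reg 1)) (.reg 3)))) s s'
          (e.time.eval m.C + 7) ∧ s'.reg 0 = m.C ∧ s'.reg 2 = i ∧
          Inv (i + 1) (s'.setReg 2 (i + 1)) := by
      intro i hi s h0 h2 ⟨hR, hp⟩
      set mi := m.tabUpTo a f i with hmi
      obtain ⟨hCi, hDi⟩ := m.tabUpTo_C a f i
      rw [← hmi] at hCi hDi
      have hbi : mi.Bounded := hm.tabUpTo a f i
      obtain ⟨s₁, h₁, ha₁, hr₁, hp₁⟩ := e.exec_comp (w := w) hbi 1 0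
        (Function.update (fun _ => 0) 0 i)
        (fun x hx => by obtain rfl : x = 0 := by omega
                        rw [hDi, Function.update_self]; exact hi.le.trans hm.1)
        (by rw [hDi]; exact hw) s hR
        (fun x hx => by obtain rfl : x = 0 := by omega
                        rw [Function.update_self]; exact h2)
      have h0₁ : s₁.reg 0 = m.C := (hp₁ 0 (by unfold Protected; omega)).trans h0
      have h1₁ : s₁.reg 1 = m.D :=
        (hp₁ 1 (by unfold Protected; omega)).trans (hR.reg_one.trans hDi)
      have h2₁ : s₁.reg 2 = i := (hp₁ 2 (by unfold Protected; omega)).trans h2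
      have hr₁' : s₁.reg 3 = f mi i := hr₁
      have hval : (Arith.mul (.lt (.reg 3) (.reg 1)) (.reg 3)).eval w s₁ = cap m.D (f mi i) := by
        simp only [Arith.eval, h1₁, hr₁', cap]
        split
        · rw [one_mul, Nat.mod_eq_of_lt (by omega)]
        · simp
      have hwr := Exec.write (w := w) s₁ a (.reg 2) (.mul (.lt (.reg 3) (.reg 1)) (.reg 3))
      rw [hval] at hwr
      simp only [Arith.eval, h2₁] at hwr
      rw [hCi] at h₁
      refine ⟨_, Exec.seq h₁ hwr, h0₁, h2₁, ⟨?_, ?_, ?_⟩, ?_⟩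
      · simp only [State.setReg]
        rw [Function.update_of_ne (by omega), h0₁, (m.tabUpTo_C a f (i + 1)).1]
      · simp only [State.setReg]
        rw [Function.update_of_ne (by omega), h1₁, (m.tabUpTo_C a f (i + 1)).2]
      · simp only [State.setReg, Mem.tabUpTo, Mem.store]
        rw [ha₁, hR.arr, ← hmi, hDi]
      · intro x
        simp only [State.setReg]
        rw [Function.update_of_ne (by omega), hp₁ _ (by unfold Protected; omega), hp x]
    obtain ⟨s', he, hI⟩ := exec_forLoop (by omega) hC Inv hbody st hst.reg_zero
      ⟨⟨by simp only [State.setReg]; rw [Function.update_of_ne (by omega)]; exact hst.reg_zero,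
        by simp only [State.setReg]; rw [Function.update_of_ne (by omega)]; exact hst.reg_one,
        hst.arr⟩,
        fun x => by simp only [State.setReg]; rw [Function.update_of_ne (by omega)]⟩
    refine ⟨s', ?_, hI.1, fun x _ => hI.2 x⟩
    exact he.of_time_eq (by simp [BProg.time])
  | seq s u ihs ihu =>
    intro k m hm hw st hst
    obtain ⟨hb, hC, hD⟩ := s.den_bounded hm
    obtain ⟨st₁, h₁, hr₁, hp₁⟩ := ihs k hm (hmono (by simp only [BProg.deg]; omega) hw) st hst
    obtain ⟨st₂, h₂, hr₂, hp₂⟩ := ihu k hb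
      (by rw [hD]; exact hmono (by simp only [BProg.deg]; omega) hw) st₁ hr₁
    rw [hC] at h₂
    refine ⟨st₂, ?_, hr₂, fun x hx => (hp₂ x hx).trans (hp₁ x hx)⟩
    exact (Exec.seq h₁ h₂).of_time_eq (by simp [BProg.time])
  | rep s ih =>
    intro k m hm hw st hst
    have hlt : m.D + 2 < 2 ^ w := by
      have := hmono (D := m.D) (k := 1) (l := s.deg + 1) (by omega) hw
      simpa using this
    have hC : m.C < 2 ^ w := by have := hm.1; omega
    have hb : ∀ j, (s.den^[j] m).Bounded ∧ (s.den^[j] m).C = m.C ∧ (s.den^[j] m).D = m.D := by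
      intro j
      induction j with
      | zero => exact ⟨hm, rfl, rfl⟩
      | succ j ihj =>
        rw [Function.iterate_succ_apply']
        obtain ⟨h1, h2, h3⟩ := s.den_bounded ihj.1
        exact ⟨h1, h2.trans ihj.2.1, h3.trans ihj.2.2⟩
    let Inv : ℕ → State → Prop := fun i u =>
      u.Rep (s.den^[i] m) ∧ ∀ x < k, u.reg (3 * x + 4) = st.reg (3 * x + 4)
    have hbody : ∀ i < m.C, ∀ u : State, u.reg 0 = m.C → u.reg (3 * k + 4) = i → Inv i u →
        ∃ u', Exec w (s.comp (k + 1)) u u' (s.time.eval m.C) ∧ u'.reg 0 = m.C ∧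
          u'.reg (3 * k + 4) = i ∧ Inv (i + 1) (u'.setReg (3 * k + 4) (i + 1)) := by
      intro i hi u h0 hk ⟨hR, hp⟩
      obtain ⟨hbi, hCi, hDi⟩ := hb i
      obtain ⟨u₁, h₁, hr₁, hp₁⟩ := ih (k + 1) hbi
        (by rw [hDi]; exact hmono (by simp only [BProg.deg]; omega) hw) u hR
      rw [hCi] at h₁
      obtain ⟨-, hC₁, -⟩ := s.den_bounded hbi
      have hr₁' : u₁.Rep (s.den^[i + 1] m) := by rwa [Function.iterate_succ_apply']
      refine ⟨u₁, h₁, hr₁'.reg_zero.trans (hb _).2.1, (hp₁ k (by omega)).trans hk,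
        ⟨?_, ?_, hr₁'.arr⟩, ?_⟩
      · simp only [State.setReg]; rw [Function.update_of_ne (by omega)]; exact hr₁'.reg_zero
      · simp only [State.setReg]; rw [Function.update_of_ne (by omega)]; exact hr₁'.reg_one
      · intro x hx
        simp only [State.setReg]
        rw [Function.update_of_ne (by omega), hp₁ x (by omega), hp x hx]
    obtain ⟨u', he, hI⟩ := exec_forLoop (by omega) hC Inv hbody st hst.reg_zero
      ⟨⟨by simp only [State.setReg]; rw [Function.update_of_ne (by omega)]; exact hst.reg_zero,
        by simp only [State.setReg]; rw [Function.update_of_ne (by omega)]; exact hst.reg_one,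
        hst.arr⟩,
        fun x hx => by simp only [State.setReg]; rw [Function.update_of_ne (by omega)]⟩
    refine ⟨u', ?_, hI.1, hI.2⟩
    exact he.of_time_eq (by simp [BProg.time])

/-! ### Functions of the memory given by bounded expressions -/

/-- Contexts: the memory together with finitely many numbers, the values of the free variables. -/
class Ctx (α : Type) where
  depth : ℕ
  env : α → ℕ → ℕ
  mem : α → Mem

instance : Ctx Mem where
  depth := 0
  env _ _ := 0
  mem m := m

instance {α : Type} [Ctx α] : Ctx (α × ℕ) where
  depth := Ctx.depth α + 1
  env q := Function.update (Ctx.env q.1) (Ctx.depth α) q.2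
  mem q := Ctx.mem q.1

/-- The value of a bounded expression in a context. -/
def BTerm.val {α : Type} [Ctx α] (e : BTerm) (p : α) : ℕ :=
  e.eval (Ctx.mem p) (Ctx.depth α) (Ctx.env p)

/-- The function is given by a bounded expression. As instances of this class and of the following
ones are found by the syntax of the function, definitions by formulas compile to machine code. -/
class Ev {α : Type} [Ctx α] (f : α → ℕ) : Prop where
  exists_term : ∃ e : BTerm, ∀ p, e.val p = f p

open Classical in
/-- The predicate is decided by a bounded expression with values `0` and `1`. -/
class EvP {α : Type} [Ctx α] (q : α → Prop) : Prop where
  exists_term : ∃ e : BTerm, ∀ p, e.val p = if q p then 1 else 0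

/-- The function is the projection of a context to its memory. -/
class IsMem {α : Type} [Ctx α] (g : α → Mem) : Prop where
  eq_mem : ∀ p, g p = Ctx.mem p

/-- The function is given by a bounded expression and bounded by the number `C` of rounds of a
loop, so that it may serve as a range of summation or quantification. -/
class EvLe {α : Type} [Ctx α] (f : α → ℕ) : Prop extends Ev f where
  le_C : ∀ p, f p ≤ (Ctx.mem p).C

/-- Renaming of the bound variables, to make room for one more free variable. -/
def BTerm.lift (c : ℕ) : BTerm → BTerm
  | .const n => .const n
  | .var x => .var (if x < c then x else x + 1)
  | .read a e => .read a (e.lift c)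
  | .op o e f => .op o (e.lift c) (f.lift c)
  | .sum e => .sum (e.lift c)

theorem BTerm.eval_lift (m : Mem) (c : ℕ) (e : BTerm) : ∀ (d : ℕ) (ρ ρ' : ℕ → ℕ), c ≤ d →
    (∀ x < c, ρ' x = ρ x) → (∀ x, c ≤ x → x < d → ρ' (x + 1) = ρ x) →
    (e.lift c).eval m (d + 1) ρ' = e.eval m d ρ := by
  induction e with
  | const n => intros; rfl
  | var x =>
    intro d ρ ρ' hc h1 h2
    simp only [BTerm.lift, BTerm.eval]
    split_ifs <;> first | omega | exact h1 x ‹_› | exact h2 x (by omega) ‹_›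
  | read a e ih =>
    intro d ρ ρ' hc h1 h2
    simp only [BTerm.lift, BTerm.eval, ih d ρ ρ' hc h1 h2]
  | op o e f ihe ihf =>
    intro d ρ ρ' hc h1 h2
    simp only [BTerm.lift, BTerm.eval, ihe d ρ ρ' hc h1 h2, ihf d ρ ρ' hc h1 h2]
  | sum e ih =>
    intro d ρ ρ' hc h1 h2
    simp only [BTerm.lift, BTerm.eval]
    refine sum_congr rfl fun i _ => ih _ _ _ (by omega) ?_ ?_
    · intro x hx
      rw [Function.update_of_ne (by omega), Function.update_of_ne (by omega), h1 x hx]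
    · intro x hx hxd
      rcases eq_or_ne x d with rfl | hne
      · simp
      · rw [Function.update_of_ne (by omega), Function.update_of_ne hne, h2 x hx (by omega)]

section Instances

variable {α : Type} [Ctx α]

theorem IsMem.id : IsMem (fun m : Mem => m) := ⟨fun _ => rfl⟩
attribute [instance] IsMem.id

instance IsMem.weak {g : α → Mem} [h : IsMem g] : IsMem (fun q : α × ℕ => g q.1) :=
  ⟨fun q => h.eq_mem q.1⟩

instance IsMem.weak₂ {g : α → Mem} [IsMem g] : IsMem (fun q : (α × ℕ) × ℕ => g q.1.1) :=
  IsMem.weak (g := fun q : α × ℕ => g q.1)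

instance IsMem.fst : IsMem (fun q : Mem × ℕ => q.1) := IsMem.weak (g := fun m : Mem => m)

instance IsMem.fst₂ : IsMem (fun q : (Mem × ℕ) × ℕ => q.1.1) :=
  IsMem.weak (g := fun q : Mem × ℕ => q.1)

instance IsMem.fst₃ : IsMem (fun q : ((Mem × ℕ) × ℕ) × ℕ => q.1.1.1) :=
  IsMem.weak (g := fun q : (Mem × ℕ) × ℕ => q.1.1)

instance Ev.const (n : ℕ) : Ev (fun _ : α => n) := ⟨.const n, fun _ => rfl⟩

instance Ev.weak {f : α → ℕ} [h : Ev f] : Ev (fun q : α × ℕ => f q.1) := by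
  obtain ⟨e, he⟩ := h.exists_term
  refine ⟨e.lift (Ctx.depth α), fun q => ?_⟩
  rw [← he q.1]
  refine BTerm.eval_lift _ _ e _ _ _ le_rfl (fun x hx => ?_) fun x h1 h2 => ?_
  · exact Function.update_of_ne (by omega) _ _
  · omega

instance Ev.weak₂ {f : α → ℕ} [Ev f] : Ev (fun q : (α × ℕ) × ℕ => f q.1.1) :=
  Ev.weak (f := fun q : α × ℕ => f q.1)

/-- Weakening by a variable that precedes the last one. -/
theorem Ev.skip {f : α × ℕ → ℕ} (h : Ev f) : Ev (fun q : (α × ℕ) × ℕ => f (q.1.1, q.2)) := by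
  obtain ⟨e, he⟩ := h.exists_term
  refine ⟨e.lift (Ctx.depth α), fun q => ?_⟩
  rw [← he (q.1.1, q.2)]
  refine BTerm.eval_lift _ _ e (Ctx.depth α + 1) (Ctx.env (q.1.1, q.2)) _ (Nat.le_succ _)
    (fun x hx => ?_) fun x h1 (h2 : x < Ctx.depth α + 1) => ?_
  · have hd : x ≠ Ctx.depth (α × ℕ) := by change x ≠ Ctx.depth α + 1; omega
    exact (Function.update_of_ne hd _ _).trans ((Function.update_of_ne (by omega) _ _).trans
      (Function.update_of_ne (by omega) _ _).symm)
  · obtain rfl : x = Ctx.depth α := by omega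
    exact (Function.update_self _ _ _).trans
      (Function.update_self (Ctx.depth α) q.2 (Ctx.env q.1.1)).symm

instance Ev.snd : Ev (fun q : α × ℕ => q.2) := by
  refine ⟨.var (Ctx.depth α), fun q => ?_⟩
  change (if Ctx.depth α < Ctx.depth α + 1 then
    Function.update (Ctx.env q.1) (Ctx.depth α) q.2 (Ctx.depth α) else 0) = q.2
  simp

instance Ev.snd₂ : Ev (fun q : (α × ℕ) × ℕ => q.1.2) := Ev.weak (f := fun q : α × ℕ => q.2)

instance Ev.snd₃ : Ev (fun q : ((α × ℕ) × ℕ) × ℕ => q.1.1.2) :=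
  Ev.weak (f := fun q : (α × ℕ) × ℕ => q.1.2)

instance Ev.arr {g : α → Mem} {f : α → ℕ} [hg : IsMem g] [h : Ev f] (a : ℕ) :
    Ev (fun p => (g p).arr a (f p)) := by
  obtain ⟨e, he⟩ := h.exists_term
  refine ⟨.read a e, fun p => ?_⟩
  rw [← he p, hg.eq_mem p]
  rfl

theorem Ev.op {f g : α → ℕ} [hf : Ev f] [hg : Ev g] (o : Op) : Ev (fun p => o.eval (f p) (g p)) := by
  obtain ⟨e, he⟩ := hf.exists_term
  obtain ⟨e', he'⟩ := hg.exists_term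
  refine ⟨.op o e e', fun p => ?_⟩
  rw [← he p, ← he' p]
  rfl

instance Ev.add {f g : α → ℕ} [Ev f] [Ev g] : Ev (fun p => f p + g p) := Ev.op .add
instance Ev.sub {f g : α → ℕ} [Ev f] [Ev g] : Ev (fun p => f p - g p) := Ev.op .sub
instance Ev.mul {f g : α → ℕ} [Ev f] [Ev g] : Ev (fun p => f p * g p) := Ev.op .mul
instance Ev.div {f g : α → ℕ} [Ev f] [Ev g] : Ev (fun p => f p / g p) := Ev.op .div
instance Ev.mod {f g : α → ℕ} [Ev f] [Ev g] : Ev (fun p => f p % g p) := Ev.op .mod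

theorem Ev.of_eq {f g : α → ℕ} (hf : Ev f) (h : ∀ p, f p = g p) : Ev g := by
  obtain ⟨e, he⟩ := hf.exists_term
  exact ⟨e, fun p => (he p).trans (h p)⟩

instance Ev.min {f g : α → ℕ} [Ev f] [Ev g] : Ev (fun p => min (f p) (g p)) :=
  Ev.of_eq (f := fun p => f p - (f p - g p)) inferInstance fun p => by omega

instance EvLe.C {g : α → Mem} [hg : IsMem g] : EvLe (fun p => (g p).C) where
  exists_term := ⟨.sum (.const 1), fun p => by
    rw [hg.eq_mem p]
    simp [BTerm.val, BTerm.eval]⟩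
  le_C p := by rw [hg.eq_mem p]

instance EvLe.minC {g : α → Mem} {f : α → ℕ} [hg : IsMem g] [Ev f] :
    EvLe (fun p => min (f p) (g p).C) where
  exists_term := Ev.exists_term
  le_C p := by rw [hg.eq_mem p]; exact min_le_right _ _

instance EvLe.weak {f : α → ℕ} [h : EvLe f] : EvLe (fun q : α × ℕ => f q.1) where
  exists_term := Ev.exists_term
  le_C q := h.le_C q.1

instance EvLe.weak₂ {f : α → ℕ} [EvLe f] : EvLe (fun q : (α × ℕ) × ℕ => f q.1.1) :=
  EvLe.weak (f := fun q : α × ℕ => f q.1)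

theorem Ev.boole {q : α → Prop} [h : EvP q] {d : ∀ p, Decidable (q p)} :
    Ev (fun p => if q p then 1 else 0) := by
  obtain ⟨e, he⟩ := h.exists_term
  exact ⟨e, fun p => (he p).trans (by congr)⟩

theorem EvP.of_ev {q : α → Prop} {f : α → ℕ} (hf : Ev f) (h : ∀ p, q p → f p = 1)
    (h' : ∀ p, ¬ q p → f p = 0) : EvP q := by
  obtain ⟨e, he⟩ := hf.exists_term
  refine ⟨e, fun p => (he p).trans ?_⟩
  split
  · exact h p ‹_›
  · exact h' p ‹_›

instance EvP.lt {f g : α → ℕ} [Ev f] [Ev g] : EvP (fun p => f p < g p) :=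
  EvP.of_ev (Ev.op (f := f) (g := g) .lt) (fun _ h => if_pos h) (fun _ h => if_neg h)

instance EvP.eq {f g : α → ℕ} [Ev f] [Ev g] : EvP (fun p => f p = g p) :=
  EvP.of_ev (Ev.op (f := f) (g := g) .eq) (fun _ h => if_pos h) (fun _ h => if_neg h)

instance EvP.not {q : α → Prop} [EvP q] : EvP (fun p => ¬ q p) := by
  classical
  refine EvP.of_ev (f := fun p => 1 - if q p then 1 else 0) ?_ (fun p h => by simp [h])
    (fun p h => by simp [not_not.1 h])
  have := Ev.boole (q := q) (d := fun p => Classical.propDecidable _)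
  infer_instance

theorem EvP.of_iff {q q' : α → Prop} (h : EvP q) (hq : ∀ p, q p ↔ q' p) : EvP q' := by
  obtain rfl : q = q' := funext fun p => propext (hq p)
  exact h

instance EvP.ne {f g : α → ℕ} [Ev f] [Ev g] : EvP (fun p => f p ≠ g p) :=
  EvP.not (q := fun p => f p = g p)

instance EvP.le {f g : α → ℕ} [Ev f] [Ev g] : EvP (fun p => f p ≤ g p) :=
  EvP.of_iff (EvP.not (q := fun p => g p < f p)) fun _ => not_lt

instance EvP.and {q q' : α → Prop} [EvP q] [EvP q'] : EvP (fun p => q p ∧ q' p) := by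
  classical
  have h1 := Ev.boole (q := q) (d := fun p => Classical.propDecidable _)
  have h2 := Ev.boole (q := q') (d := fun p => Classical.propDecidable _)
  refine EvP.of_ev (Ev.mul (f := fun p => if q p then 1 else 0)
    (g := fun p => if q' p then 1 else 0)) (fun p h => by simp [h.1, h.2]) fun p h => ?_
  rw [not_and_or] at h
  rcases h with h | h <;> simp [h]

instance EvP.or {q q' : α → Prop} [EvP q] [EvP q'] : EvP (fun p => q p ∨ q' p) :=
  EvP.of_iff (EvP.not (q := fun p => ¬ q p ∧ ¬ q' p)) fun _ => by tauto

instance EvP.imp {q q' : α → Prop} [EvP q] [EvP q'] : EvP (fun p => q p → q' p) :=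
  EvP.of_iff (EvP.not (q := fun p => q p ∧ ¬ q' p)) fun _ => by tauto

instance Ev.ite {q : α → Prop} {f g : α → ℕ} [EvP q] [Ev f] [Ev g] {d : ∀ p, Decidable (q p)} :
    Ev (fun p => if q p then f p else g p) := by
  obtain ⟨b, hb⟩ : ∃ b : α → ℕ, b = fun p => if q p then 1 else 0 := ⟨_, rfl⟩
  have h : Ev b := hb ▸ Ev.boole
  have hbfg :  Ev (fun p => b p * f p + (1 - b p) * g p) := inferInstance
  refine hbfg.of_eq fun p => ?_
  rw [hb]
  dsimp only
  split <;> simp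

theorem Ev.sum_C {f : α → ℕ → ℕ} [h : Ev (fun q : α × ℕ => f q.1 q.2)] :
    Ev (fun p => ∑ i ∈ range (Ctx.mem p).C, f p i) := by
  obtain ⟨e, he⟩ := h.exists_term
  refine ⟨.sum e, fun p => ?_⟩
  simp only [BTerm.val, BTerm.eval]
  exact sum_congr rfl fun i _ => he (p, i)

instance Ev.sum {N : α → ℕ} {f : α → ℕ → ℕ} [hN : EvLe N] [Ev (fun q : α × ℕ => f q.1 q.2)] :
    Ev (fun p => ∑ i ∈ range (N p), f p i) := by
  refine Ev.of_eq (Ev.sum_C (f := fun p i => if i < N p then f p i else 0)) fun p => ?_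
  rw [← sum_filter]
  refine sum_congr ?_ fun _ _ => rfl
  ext i
  have := hN.le_C p
  simp only [mem_filter, mem_range]
  omega

instance EvP.bex {N : α → ℕ} {q : α → ℕ → Prop} [EvLe N] [EvP (fun r : α × ℕ => q r.1 r.2)] :
    EvP (fun p => ∃ i, i < N p ∧ q p i) := by
  classical
  have := Ev.boole (q := fun r : α × ℕ => q r.1 r.2) (d := fun p => Classical.propDecidable _)
  refine EvP.of_iff (EvP.lt (f := fun _ => 0)
    (g := fun p => ∑ i ∈ range (N p), if q p i then 1 else 0)) fun p => ?_
  rw [sum_boole, Nat.cast_id, card_pos]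
  simp [Finset.Nonempty, mem_filter]

instance EvP.ball {N : α → ℕ} {q : α → ℕ → Prop} [EvLe N] [EvP (fun r : α × ℕ => q r.1 r.2)] :
    EvP (fun p => ∀ i, i < N p → q p i) :=
  EvP.of_iff (EvP.not (q := fun p => ∃ i, i < N p ∧ ¬ q p i)) fun p => by
    push Not
    rfl

open Classical in
/-- The least number below `N` with the property `q`, and `N` if there is none. -/
noncomputable def least (N : ℕ) (q : ℕ → Prop) : ℕ :=
  ∑ x ∈ range N, if ∃ y, y < N ∧ y ≤ x ∧ q y then 0 else 1

theorem least_le (N : ℕ) (q : ℕ → Prop) : least N q ≤ N := by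
  classical
  unfold least
  refine (sum_le_sum (g := fun _ => 1) fun i _ => ?_).trans (by simp)
  split <;> simp

theorem least_eq_of_forall_not {N : ℕ} {q : ℕ → Prop} (h : ∀ x < N, ¬ q x) : least N q = N := by
  classical
  unfold least
  rw [sum_congr rfl (g := fun _ => 1)]
  · simp
  · intro x _
    rw [if_neg]
    rintro ⟨y, hy, -, hq⟩
    exact h y hy hq

theorem least_spec {N : ℕ} {q : ℕ → Prop} (h : ∃ x < N, q x) :
    least N q < N ∧ q (least N q) := by
  classical
  have hx := Nat.find_spec h
  have hmin : ∀ y < N, q y → Nat.find h ≤ y := fun y hy hq => Nat.find_min' h ⟨hy, hq⟩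
  have : least N q = Nat.find h := by
    unfold least
    rw [sum_congr rfl (g := fun x => if x < Nat.find h then 1 else 0)]
    · rw [sum_boole, Nat.cast_id]
      have : filter (fun x => x < Nat.find h) (range N) = range (Nat.find h) := by
        ext x
        simp only [mem_filter, mem_range]
        omega
      rw [this, card_range]
    · intro x _
      by_cases hlt : x < Nat.find h
      · rw [if_pos hlt, if_neg]
        rintro ⟨y, hy, hyx, hq⟩
        have := hmin y hy hq
        omega
      · rw [if_neg hlt, if_pos ⟨_, hx.1, by omega, hx.2⟩]
  rw [this]
  exact hx

instance Ev.least {N : α → ℕ} {q : α → ℕ → Prop} [EvLe N]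
    [h : EvP (fun r : α × ℕ => q r.1 r.2)] : Ev (fun p => least (N p) (q p)) := by
  unfold DiverseStrings.least
  have : EvP (fun r : (α × ℕ) × ℕ => q r.1.1 r.2) :=
    EvP.of_ev (Ev.skip (Ev.boole (q := fun r : α × ℕ => q r.1 r.2)
      (d := fun p => Classical.propDecidable _))) (fun _ h => if_pos h) (fun _ h => if_neg h)
  infer_instance

/-- The transformation of the memory is the effect of a bounded program. -/
def IsProg (F : Mem → Mem) : Prop := ∃ s : BProg, ∀ m, s.den m = F m

theorem IsProg.tab (a : ℕ) (f : Mem → ℕ → ℕ) [h : Ev (fun q : Mem × ℕ => f q.1 q.2)] :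
    IsProg (fun m => m.tab a f) := by
  obtain ⟨e, he⟩ := h.exists_term
  refine ⟨.tab a e, fun m => ?_⟩
  have : (fun (m : Mem) (i : ℕ) => e.eval m 1 (Function.update (fun _ => 0) 0 i)) = f := by
    funext m i
    rw [← he (m, i)]
    rfl
  simp only [BProg.den, this]

theorem IsProg.comp {F G : Mem → Mem} (hF : IsProg F) (hG : IsProg G) :
    IsProg (fun m => G (F m)) := by
  obtain ⟨s, hs⟩ := hF
  obtain ⟨u, hu⟩ := hG
  exact ⟨.seq s u, fun m => by simp only [BProg.den, hs, hu]⟩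

theorem IsProg.iterate {F : Mem → Mem} (hF : IsProg F) : IsProg (fun m => F^[m.C] m) := by
  obtain ⟨s, hs⟩ := hF
  obtain rfl : s.den = F := funext hs
  exact ⟨.rep s, fun m => rfl⟩

end Instances

/-! ### The search for new strings -/

/-- The data of the search for new strings: an automaton with edges `e < M` from `src e` to `tgt e`
labelled by `lab e`, initial state `s` and accepting states `v` with `acc v ≠ 0`; the length `r` of
the strings; the number `K` of strings wanted, the number `kk` of strings present, which are
`X 0, …, X (kk - 1)`, and the number `p` of strings searched for at once. Numbers below `C` code
configurations and actions by their digits in base `M`, and `pw` lists the powers of `M`. -/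
structure Core where
  C : ℕ
  M : ℕ
  p : ℕ
  K : ℕ
  s : ℕ
  r : ℕ
  kk : ℕ
  L : ℕ
  src : ℕ → ℕ
  lab : ℕ → ℕ
  tgt : ℕ → ℕ
  acc : ℕ → ℕ
  pw : ℕ → ℕ
  X : ℕ → ℕ → ℕ

namespace Core

variable (E : Core)

/-- Digit `x` of the code `c`. -/
def dg (c x : ℕ) : ℕ := c / E.pw x % E.M

/-- The number of symbols still to be read. -/
def top (c : ℕ) : ℕ := c / E.pw E.L

/-- The position of the next symbol. -/
def pos (c : ℕ) : ℕ := E.r - E.top c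

/-- The index of the string to be replaced. -/
def idx (c : ℕ) : ℕ := E.dg c 0

/-- The sum of the distances of the remaining parts of the new strings to the old strings. -/
def wt (c : ℕ) : ℕ := E.dg c 1

/-- The state of the automaton reached by new string `h`. -/
def vert (c h : ℕ) : ℕ := E.dg c (2 + h)

/-- The index of an old string that agrees with new string `h` so far; `K` if there is none. -/
def rep (c h : ℕ) : ℕ := E.dg c (2 + E.p + h)

/-- The distance of the remaining parts of new strings `h` and `h'`. -/
def dd (c h h' : ℕ) : ℕ := E.dg c (2 + 2 * E.p + (h * E.p + h'))

/-- The symbol that action `a` appends to new string `h`. -/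
def chr (a h : ℕ) : ℕ := E.lab (E.dg a h)

/-- The old string `j` is kept when string `i` is replaced. -/
def Kept (i j : ℕ) : Prop := j < E.kk ∧ j ≠ i

/-- The old strings `j` and `j'` agree before position `l`. -/
def SamePre (j j' l : ℕ) : Prop := ∀ x, x < E.r → x < l → E.X j x = E.X j' x

/-- The kept string that agrees with a new string after it reads `ch` at position `l`, given a kept
string `j` that agrees with it before. -/
noncomputable def trieStep (i j l ch : ℕ) : ℕ :=
  if j < E.K then least E.K fun j' => E.Kept i j' ∧ E.SamePre j' j l ∧ E.X j' l = ch else E.K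

/-- A kept string, if there is one. -/
noncomputable def root (i : ℕ) : ℕ := least E.K fun j' => E.Kept i j'

/-- The number of kept strings and new strings that differ at position `l`, if action `a` appends
the symbols of the new strings there. -/
def cost (i a l : ℕ) : ℕ :=
  ∑ h ∈ range E.p, ∑ j ∈ range E.kk, if j ≠ i ∧ E.chr a h ≠ E.X j l then 1 else 0

/-- `1` if the action `a` appends different symbols to the new strings `h` and `h'`, else `0`. -/
def neq (a h h' : ℕ) : ℕ := if E.chr a h ≠ E.chr a h' then 1 else 0

/-- The action `a` is possible in the configuration `c`. -/
def Ok (c a : ℕ) : Prop :=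
  1 ≤ E.top c ∧ (∀ h, h < E.p → E.src (E.dg a h) = E.vert c h) ∧
    E.cost (E.idx c) a (E.pos c) ≤ E.wt c ∧
    ∀ h, h < E.p → ∀ h', h' < E.p → E.neq a h h' ≤ E.dd c h h'

/-- Digit `x` of the configuration after the action `a`. -/
noncomputable def nd (c a x : ℕ) : ℕ :=
  if x = 0 then E.idx c
  else if x = 1 then E.wt c - E.cost (E.idx c) a (E.pos c)
  else if x < 2 + E.p then E.tgt (E.dg a (x - 2))
  else if x < 2 + 2 * E.p then
    E.trieStep (E.idx c) (E.dg c x) (E.pos c) (E.chr a (x - (2 + E.p)))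
  else E.dg c x - E.neq a ((x - (2 + 2 * E.p)) / E.p) ((x - (2 + 2 * E.p)) % E.p)

/-- The configuration after the action `a`. -/
noncomputable def nxt (c a : ℕ) : ℕ :=
  (E.top c - 1) * E.pw E.L + ∑ x ∈ range E.L, E.nd c a x * E.pw x

/-- The configuration is final: all distances are used up and the new strings are accepted and
differ from the kept ones. -/
def Fin (c : ℕ) : Prop :=
  E.top c = 0 ∧ E.wt c = 0 ∧ (∀ h, h < E.p → E.acc (E.vert c h) ≠ 0 ∧ E.K ≤ E.rep c h) ∧
    ∀ h, h < E.p → ∀ h', h' < E.p → E.dd c h h' = 0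

/-- The string `i` may be replaced: any string if there are `K` of them, and otherwise the first
free place. -/
def Allowed (i : ℕ) : Prop := (E.kk < E.K ∧ i = E.kk) ∨ (E.kk = E.K ∧ i < E.K)

/-- Hamming distance. -/
def hd (u v : ℕ → ℕ) : ℕ := ∑ x ∈ range E.r, if u x ≠ v x then 1 else 0

/-- The sum of the distances of the ordered pairs of kept strings. -/
def rest (i : ℕ) : ℕ :=
  ∑ j ∈ range E.kk, ∑ j' ∈ range E.kk, if j ≠ i ∧ j' ≠ i then E.hd (E.X j) (E.X j') else 0

/-- The configuration is a possible start of the search. -/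
def Init (c : ℕ) : Prop :=
  E.top c = E.r ∧ E.Allowed (E.idx c) ∧
    (∀ h, h < E.p → E.vert c h = E.s ∧ E.rep c h = E.root (E.idx c)) ∧
    ∀ h, h < E.p → ∀ h', h' < E.p → h < h' → 1 ≤ E.dd c h h'

/-- The sum of the distances of the ordered pairs of strings after the replacement announced by an
initial configuration. -/
def score (c : ℕ) : ℕ :=
  E.rest (E.idx c) + 2 * E.wt c + ∑ h ∈ range E.p, ∑ h' ∈ range E.p, E.dd c h h'

/-- A final configuration can be reached by actions that decrease the code. -/
inductive Acc : ℕ → Prop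
  | fin {c : ℕ} : E.Fin c → Acc c
  | step {c a : ℕ} : a < E.C → E.Ok c a → E.nxt c a < c → Acc (E.nxt c a) → Acc c

/-- The automaton reads from state `v` the last `R` symbols of the string `y` of length `r` and
accepts. -/
def Reads : ℕ → ℕ → (ℕ → ℕ) → Prop
  | v, 0, _ => E.acc v ≠ 0
  | v, R + 1, y => ∃ e, e < E.M ∧ E.src e = v ∧ E.lab e = y (E.r - (R + 1)) ∧ Reads (E.tgt e) R y

/-- The string `y` is accepted. -/
def InLang (y : ℕ → ℕ) : Prop := E.Reads E.s E.r y

/-- Hamming distance of the last `R` symbols. -/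
def hdFrom (R : ℕ) (u v : ℕ → ℕ) : ℕ :=
  ∑ x ∈ range E.r, if E.r - R ≤ x ∧ u x ≠ v x then 1 else 0

/-- If `j` is an old string, then the last `R` symbols of `y` differ from those of every kept string
that agrees with `j` before. -/
def Avoids (i j R : ℕ) (y : ℕ → ℕ) : Prop :=
  j < E.K → ∀ j', E.Kept i j' → E.SamePre j' j (E.r - R) →
    ∃ x, E.r - R ≤ x ∧ x < E.r ∧ E.X j' x ≠ y x

/-- The sizes fit together: all digits are below the base `M`, and configurations and actions are
below `C`. -/
structure WF : Prop where
  pw_eq : ∀ x ≤ E.L, E.pw x = E.M ^ x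
  L_eq : E.L = 2 + 2 * E.p + E.p * E.p
  pow_le : E.M ^ (E.L + 1) ≤ E.C
  one_lt_M : 1 < E.M
  one_le_p : 1 ≤ E.p
  r_lt : E.r < E.M
  K_lt : E.K < E.M
  kk_le : E.kk ≤ E.K
  tgt_lt : ∀ e < E.M, E.tgt e < E.M
  s_lt : E.s < E.M
  cross_lt : E.p * (E.kk * E.r) < E.M

end Core

/-! ### Digits -/

theorem sum_mul_pow_lt {M : ℕ} {f : ℕ → ℕ} {n : ℕ} (hf : ∀ x < n, f x < M) :
    ∑ x ∈ range n, f x * M ^ x < M ^ n := by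
  induction n with
  | zero => simp
  | succ n ih =>
    rw [sum_range_succ, pow_succ]
    have h1 := ih fun x hx => hf x (by omega)
    have h2 := hf n (by omega)
    have h3 : (f n + 1) * M ^ n ≤ M * M ^ n := Nat.mul_le_mul_right _ h2
    nlinarith

theorem digit_of_sum {M : ℕ} {f : ℕ → ℕ} {n : ℕ} (hf : ∀ x < n, f x < M) (t : ℕ) {x : ℕ}
    (hx : x < n) : (t * M ^ n + ∑ x ∈ range n, f x * M ^ x) / M ^ x % M = f x := by
  have hM : 0 < M := (Nat.zero_le _).trans_lt (hf x hx)
  obtain ⟨k, rfl⟩ : ∃ k, n = x + 1 + k := ⟨n - (x + 1), by omega⟩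
  have hsum : t * M ^ (x + 1 + k) + ∑ y ∈ range (x + 1 + k), f y * M ^ y
      = ∑ y ∈ range x, f y * M ^ y
        + (f x + M * (t * M ^ k + ∑ y ∈ range k, f (x + 1 + y) * M ^ y)) * M ^ x := by
    rw [sum_range_add, sum_range_succ]
    have : ∑ y ∈ range k, f (x + 1 + y) * M ^ (x + 1 + y)
        = M * M ^ x * ∑ y ∈ range k, f (x + 1 + y) * M ^ y := by
      rw [mul_sum]
      exact sum_congr rfl fun y _ => by ring
    rw [this]
    ring
  rw [hsum, Nat.add_mul_div_right _ _ (by positivity),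
    Nat.div_eq_of_lt (sum_mul_pow_lt fun y hy => hf y (by omega)), zero_add,
    Nat.add_mul_mod_self_left, Nat.mod_eq_of_lt (hf x hx)]

theorem div_pow_of_sum {M : ℕ} {f : ℕ → ℕ} {n : ℕ} (hM : 0 < M) (hf : ∀ x < n, f x < M) (t : ℕ) :
    (t * M ^ n + ∑ x ∈ range n, f x * M ^ x) / M ^ n = t := by
  rw [add_comm, Nat.add_mul_div_right _ _ (by positivity), Nat.div_eq_of_lt (sum_mul_pow_lt hf),
    zero_add]

/-! ### Correctness of the search -/

namespace Core

variable {E : Core}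

theorem dg_lt (hE : E.WF) (c x : ℕ) : E.dg c x < E.M := Nat.mod_lt _ (by have := hE.one_lt_M; omega)

theorem trieStep_le (i j l ch : ℕ) : E.trieStep i j l ch ≤ E.K := by
  unfold trieStep
  split
  · exact least_le _ _
  · exact le_rfl

theorem nd_lt (hE : E.WF) (c a x : ℕ) : E.nd c a x < E.M := by
  unfold nd
  split_ifs
  · exact dg_lt hE _ _
  · exact (Nat.sub_le _ _).trans_lt (dg_lt hE _ _)
  · exact hE.tgt_lt _ (dg_lt hE _ _)
  · exact (trieStep_le _ _ _ _).trans_lt hE.K_lt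
  · exact (Nat.sub_le _ _).trans_lt (dg_lt hE _ _)

theorem nxt_eq (hE : E.WF) (c a : ℕ) :
    E.nxt c a = (E.top c - 1) * E.M ^ E.L + ∑ x ∈ range E.L, E.nd c a x * E.M ^ x := by
  unfold nxt
  rw [hE.pw_eq _ le_rfl]
  congr 1
  exact sum_congr rfl fun x hx => by rw [hE.pw_eq x (mem_range.1 hx).le]

theorem dg_nxt (hE : E.WF) (c a : ℕ) {x : ℕ} (hx : x < E.L) : E.dg (E.nxt c a) x = E.nd c a x := by
  rw [dg, nxt_eq hE, hE.pw_eq x hx.le]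
  exact digit_of_sum (fun x _ => nd_lt hE c a x) _ hx

theorem top_nxt (hE : E.WF) (c a : ℕ) : E.top (E.nxt c a) = E.top c - 1 := by
  rw [top, nxt_eq hE, hE.pw_eq _ le_rfl]
  exact div_pow_of_sum (by have := hE.one_lt_M; omega) (fun x _ => nd_lt hE c a x) _

theorem nxt_lt (hE : E.WF) {c a : ℕ} (h : 1 ≤ E.top c) : E.nxt c a < c := by
  by_contra hc
  have h1 : E.top c ≤ E.top (E.nxt c a) := Nat.div_le_div_right (not_lt.1 hc)
  rw [top_nxt hE] at h1
  omega

theorem idx_nxt (hE : E.WF) (c a : ℕ) : E.idx (E.nxt c a) = E.idx c := by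
  rw [idx, dg_nxt hE c a (by rw [hE.L_eq]; omega)]
  rfl

theorem wt_nxt (hE : E.WF) (c a : ℕ) :
    E.wt (E.nxt c a) = E.wt c - E.cost (E.idx c) a (E.pos c) := by
  rw [wt, dg_nxt hE c a (by rw [hE.L_eq]; omega)]
  rfl

theorem vert_nxt (hE : E.WF) (c a : ℕ) {h : ℕ} (hh : h < E.p) :
    E.vert (E.nxt c a) h = E.tgt (E.dg a h) := by
  rw [vert, dg_nxt hE c a (by rw [hE.L_eq]; omega), nd, if_neg (by omega), if_neg (by omega),
    if_pos (by omega)]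
  congr 2
  omega

theorem rep_nxt (hE : E.WF) (c a : ℕ) {h : ℕ} (hh : h < E.p) :
    E.rep (E.nxt c a) h = E.trieStep (E.idx c) (E.rep c h) (E.pos c) (E.chr a h) := by
  rw [rep, dg_nxt hE c a (by rw [hE.L_eq]; omega), nd, if_neg (by omega), if_neg (by omega),
    if_neg (by omega), if_pos (by omega)]
  congr 2
  omega

theorem pair_lt {p h h' : ℕ} (hh : h < p) (hh' : h' < p) : h * p + h' < p * p := by
  nlinarith [Nat.mul_le_mul_right p (Nat.succ_le_of_lt hh)]

theorem dd_nxt (hE : E.WF) (c a : ℕ) {h h' : ℕ} (hh : h < E.p) (hh' : h' < E.p) :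
    E.dd (E.nxt c a) h h' = E.dd c h h' - E.neq a h h' := by
  have hlt := pair_lt hh hh'
  rw [dd, dg_nxt hE c a (by rw [hE.L_eq]; omega), nd, if_neg (by omega), if_neg (by omega),
    if_neg (by omega), if_neg (by omega), Nat.add_sub_cancel_left]
  have h1 : (h * E.p + h') / E.p = h := by
    rw [add_comm, Nat.add_mul_div_right _ _ (by omega), Nat.div_eq_of_lt hh', zero_add]
  have h2 : (h * E.p + h') % E.p = h' := by
    rw [add_comm, Nat.add_mul_mod_self_right, Nat.mod_eq_of_lt hh']
  rw [h1, h2]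
  rfl

theorem hdFrom_zero (u v : ℕ → ℕ) : E.hdFrom 0 u v = 0 := by
  unfold hdFrom
  refine sum_eq_zero fun x hx => if_neg ?_
  have := mem_range.1 hx
  omega

theorem hdFrom_succ {R : ℕ} (hR : R + 1 ≤ E.r) (u v : ℕ → ℕ) :
    E.hdFrom (R + 1) u v
      = (if u (E.r - (R + 1)) ≠ v (E.r - (R + 1)) then 1 else 0) + E.hdFrom R u v := by
  have h : (if u (E.r - (R + 1)) ≠ v (E.r - (R + 1)) then 1 else 0)
      = ∑ x ∈ range E.r, if x = E.r - (R + 1) then (if u x ≠ v x then 1 else 0) else 0 := by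
    rw [sum_ite_eq' (range E.r) _ fun x => if u x ≠ v x then 1 else 0,
      if_pos (mem_range.2 (by omega))]
  rw [h, hdFrom, hdFrom, ← sum_add_distrib]
  refine sum_congr rfl fun x hx => ?_
  have := mem_range.1 hx
  by_cases huv : u x = v x
  · simp [huv]
  · simp only [huv, ne_eq, not_false_eq_true, and_true, if_true]
    split_ifs <;> omega

theorem hdFrom_r (u v : ℕ → ℕ) : E.hdFrom E.r u v = E.hd u v := by
  simp [hdFrom, hd]

/-- One action pays for the distances to the kept strings at one position. -/
theorem cost_add_hdFrom {R : ℕ} (hR : R + 1 ≤ E.r) (i a : ℕ) (y : ℕ → ℕ → ℕ)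
    (hy : ∀ h < E.p, y h (E.r - (R + 1)) = E.chr a h) :
    ∑ h ∈ range E.p, ∑ j ∈ range E.kk, (if j ≠ i then E.hdFrom (R + 1) (y h) (E.X j) else 0)
      = E.cost i a (E.r - (R + 1)) +
        ∑ h ∈ range E.p, ∑ j ∈ range E.kk, (if j ≠ i then E.hdFrom R (y h) (E.X j) else 0) := by
  unfold cost
  rw [← sum_add_distrib]
  refine sum_congr rfl fun h hh => ?_
  rw [← sum_add_distrib]
  refine sum_congr rfl fun j _ => ?_
  by_cases hj : j = i
  · simp [hj]
  · simp [hj, hdFrom_succ hR, hy h (mem_range.1 hh)]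

/-- It suffices to remember one kept string among those that agree with a new string so far: the
others that do so are those that agree with this one. -/
theorem Avoids.of_step {i j R : ℕ} {y : ℕ → ℕ} (hE : E.WF) (hR : R + 1 ≤ E.r)
    (h : E.Avoids i (E.trieStep i j (E.r - (R + 1)) (y (E.r - (R + 1)))) R y) :
    E.Avoids i j (R + 1) y := by
  intro hj j' hj' hpre
  by_cases hx : E.X j' (E.r - (R + 1)) = y (E.r - (R + 1))
  · have hex : ∃ x < E.K, E.Kept i x ∧ E.SamePre x j (E.r - (R + 1)) ∧
        E.X x (E.r - (R + 1)) = y (E.r - (R + 1)) :=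
      ⟨j', hj'.1.trans_le hE.kk_le, hj', hpre, hx⟩
    rw [trieStep, if_pos hj] at h
    obtain ⟨h1, h2, h3, h4⟩ := least_spec hex
    obtain ⟨x, hx1, hx2, hx3⟩ := h h1 j' hj' fun x hxr hxl => by
      rcases Nat.lt_or_ge x (E.r - (R + 1)) with hlt | hge
      · rw [hpre x hxr hlt, h3 x hxr hlt]
      · obtain rfl : x = E.r - (R + 1) := by omega
        rw [hx, h4]
    exact ⟨x, by omega, hx2, hx3⟩
  · exact ⟨_, le_rfl, by omega, hx⟩

theorem Avoids.step {i j R : ℕ} {y : ℕ → ℕ} (hR : R + 1 ≤ E.r) (h : E.Avoids i j (R + 1) y) :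
    E.Avoids i (E.trieStep i j (E.r - (R + 1)) (y (E.r - (R + 1)))) R y := by
  intro hlt j' hj' hpre
  by_cases hj : j < E.K
  · rw [trieStep, if_pos hj] at hlt hpre
    have hex : ∃ x < E.K, E.Kept i x ∧ E.SamePre x j (E.r - (R + 1)) ∧
        E.X x (E.r - (R + 1)) = y (E.r - (R + 1)) := by
      by_contra hno
      push Not at hno
      rw [least_eq_of_forall_not] at hlt
      · exact lt_irrefl _ hlt
      · rintro x hx ⟨h1, h2, h3⟩
        exact hno x hx h1 h2 h3
    obtain ⟨-, -, h3, h4⟩ := least_spec hex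
    obtain ⟨x, hx1, hx2, hx3⟩ := h hj j' hj' fun x hxr hxl =>
      (hpre x hxr (by omega)).trans (h3 x hxr hxl)
    refine ⟨x, ?_, hx2, hx3⟩
    rcases Nat.lt_or_ge x (E.r - R) with hlt' | hge
    · obtain rfl : x = E.r - (R + 1) := by omega
      exact absurd ((hpre _ hx2 hlt').trans h4) hx3
    · exact hge
  · rw [trieStep, if_neg hj] at hlt
    exact absurd hlt (lt_irrefl _)

theorem kept_of_trieStep_lt {i j l ch : ℕ} (h : E.trieStep i j l ch < E.K) :
    E.Kept i (E.trieStep i j l ch) := by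
  by_cases hj : j < E.K
  · rw [trieStep, if_pos hj] at h ⊢
    by_cases hex : ∃ x < E.K, E.Kept i x ∧ E.SamePre x j l ∧ E.X x l = ch
    · exact (least_spec hex).2.1
    · push Not at hex
      rw [least_eq_of_forall_not] at h
      · exact absurd h (lt_irrefl _)
      · rintro x hx ⟨h1, h2, h3⟩
        exact hex x hx h1 h2 h3
  · rw [trieStep, if_neg hj] at h
    exact absurd h (lt_irrefl _)

theorem kept_of_root_lt {i : ℕ} (h : E.root i < E.K) : E.Kept i (E.root i) := by
  unfold root at h ⊢
  by_cases hex : ∃ x < E.K, E.Kept i x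
  · exact (least_spec hex).2
  · push Not at hex
    rw [least_eq_of_forall_not hex] at h
    exact absurd h (lt_irrefl _)

theorem avoids_root (hE : E.WF) {i : ℕ} {y : ℕ → ℕ} :
    E.Avoids i (E.root i) E.r y ↔ ∀ j', E.Kept i j' → ∃ x < E.r, E.X j' x ≠ y x := by
  constructor
  · intro h j' hj'
    have hroot : E.root i < E.K := (least_spec ⟨j', hj'.1.trans_le hE.kk_le, hj'⟩).1
    obtain ⟨x, -, h2, h3⟩ := h hroot j' hj' fun x _ hx => by omega
    exact ⟨x, h2, h3⟩
  · intro h _ j' hj' _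
    obtain ⟨x, h1, h2⟩ := h j' hj'
    exact ⟨x, by omega, h1, h2⟩

/-- The new strings `y` complete the configuration `c`. -/
structure Completes (E : Core) (c R : ℕ) (y : ℕ → ℕ → ℕ) : Prop where
  reads : ∀ h < E.p, E.Reads (E.vert c h) R (y h)
  avoids : ∀ h < E.p, E.Avoids (E.idx c) (E.rep c h) R (y h)
  wt_eq : E.wt c = ∑ h ∈ range E.p, ∑ j ∈ range E.kk,
    if j ≠ E.idx c then E.hdFrom R (y h) (E.X j) else 0
  dd_eq : ∀ h < E.p, ∀ h' < E.p, E.dd c h h' = E.hdFrom R (y h) (y h')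

/-- Strings that complete a configuration spell out a sequence of actions that leads from it to a
final one. -/
theorem Completes.acc (hE : E.WF) (y : ℕ → ℕ → ℕ) {R : ℕ} (hR : R ≤ E.r) : ∀ {c : ℕ},
    E.top c = R → (∀ h < E.p, E.rep c h < E.K → E.Kept (E.idx c) (E.rep c h)) →
    E.Completes c R y → E.Acc c := by
  induction R with
  | zero =>
    intro c hc hrep h
    refine .fin ⟨hc, ?_, fun g hg => ⟨h.reads g hg, ?_⟩, fun g hg g' hg' => ?_⟩
    · simp [h.wt_eq, hdFrom_zero]
    · by_contra hlt
      push Not at hlt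
      obtain ⟨x, h1, h2, -⟩ := h.avoids g hg hlt _ (hrep g hg hlt) fun _ _ _ => rfl
      omega
    · simp [h.dd_eq g hg g' hg', hdFrom_zero]
  | succ R ih =>
    intro c hc hrep h
    have hpos : E.pos c = E.r - (R + 1) := by rw [pos, hc]
    choose! e he using h.reads
    have hdg : ∀ g < E.p, E.dg (∑ g ∈ range E.p, e g * E.M ^ g) g = e g := fun g hg => by
      rw [dg, hE.pw_eq g (by rw [hE.L_eq]; omega)]
      simpa using digit_of_sum (fun x hx => (he x hx).1) 0 hg
    set a := ∑ g ∈ range E.p, e g * E.M ^ g with ha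
    have haC : a < E.C := by
      refine (sum_mul_pow_lt fun x hx => (he x hx).1).trans_le (le_trans ?_ hE.pow_le)
      exact Nat.pow_le_pow_right (by have := hE.one_lt_M; omega) (by rw [hE.L_eq]; omega)
    have hchr : ∀ g < E.p, y g (E.r - (R + 1)) = E.chr a g := fun g hg => by
      rw [chr, hdg g hg, (he g hg).2.2.1]
    have hcost := cost_add_hdFrom hR (E.idx c) a y hchr
    have hwt := h.wt_eq
    rw [hcost] at hwt
    have hdd : ∀ g < E.p, ∀ g' < E.p, E.dd c g g' = E.neq a g g' + E.hdFrom R (y g) (y g') :=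
      fun g hg g' hg' => by
        rw [h.dd_eq g hg g' hg', hdFrom_succ hR, hchr g hg, hchr g' hg']
        rfl
    refine .step haC ⟨by omega, fun g hg => ?_, ?_, fun g hg g' hg' => ?_⟩
      (nxt_lt hE (by omega)) (ih (by omega) ?_ ?_ ⟨fun g hg => ?_, fun g hg => ?_, ?_,
        fun g hg g' hg' => ?_⟩)
    · rw [hdg g hg, (he g hg).2.1]
    · rw [hpos]; omega
    · rw [hdd g hg g' hg']; omega
    · rw [top_nxt hE, hc]; rfl
    · intro g hg
      rw [rep_nxt hE c a hg, idx_nxt hE]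
      exact kept_of_trieStep_lt
    · rw [vert_nxt hE c a hg, hdg g hg]
      exact (he g hg).2.2.2
    · rw [rep_nxt hE c a hg, idx_nxt hE, hpos, ← hchr g hg]
      exact (h.avoids g hg).step hR
    · rw [wt_nxt hE, idx_nxt hE, hpos]
      omega
    · rw [dd_nxt hE c a hg hg', hdd g hg g' hg']
      omega

/-- A run of the search that follows a strategy `pk` spells strings that complete its
configurations. -/
theorem completes_of_run (hE : E.WF) {pk cs : ℕ → ℕ}
    (hpk : ∀ c < E.C, E.Acc c → 1 ≤ E.top c →
      E.Ok c (pk c) ∧ E.nxt c (pk c) < c ∧ E.Acc (E.nxt c (pk c)))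
    (hC : cs 0 < E.C) (hacc : E.Acc (cs 0)) (htop : E.top (cs 0) = E.r)
    (hcs : ∀ t < E.r, E.nxt (cs t) (pk (cs t)) < E.C → cs (t + 1) = E.nxt (cs t) (pk (cs t))) :
    E.Completes (cs 0) E.r fun h x => E.chr (pk (cs x)) h := by
  have hrun : ∀ t ≤ E.r, cs t < E.C ∧ E.Acc (cs t) ∧ E.top (cs t) = E.r - t := by
    intro t
    induction t with
    | zero => exact fun _ => ⟨hC, hacc, htop⟩
    | succ t ih =>
      intro ht
      obtain ⟨h1, h2, h3⟩ := ih (by omega)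
      obtain ⟨-, h5, h6⟩ := hpk _ h1 h2 (by omega)
      rw [hcs t (by omega) (h5.trans h1)]
      exact ⟨h5.trans h1, h6, by rw [top_nxt hE, h3]; omega⟩
  have key : ∀ R ≤ E.r, E.Completes (cs (E.r - R)) R fun h x => E.chr (pk (cs x)) h := by
    intro R
    induction R with
    | zero =>
      intro _
      obtain ⟨h1, h2, h3⟩ := hrun E.r le_rfl
      rw [Nat.sub_self] at h3
      rw [Nat.sub_zero]
      cases h2 with
      | fin hf =>
        obtain ⟨-, f2, f3, f4⟩ := hf
        refine ⟨fun h hh => (f3 h hh).1, fun h hh hlt => ?_, by simp [f2, hdFrom_zero],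
          fun h hh h' hh' => by rw [f4 h hh h' hh', hdFrom_zero]⟩
        exact absurd (f3 h hh).2 (not_le.2 hlt)
      | step _ hok _ _ => exact absurd hok.1 (by omega)
    | succ R ih =>
      intro hR
      have hI := ih (by omega)
      set y : ℕ → ℕ → ℕ := fun h x => E.chr (pk (cs x)) h with hy
      obtain ⟨h1, h2, h3⟩ := hrun (E.r - (R + 1)) (by omega)
      obtain ⟨⟨-, o2, o3, o4⟩, o5, -⟩ := hpk _ h1 h2 (by omega)
      have hnext := hcs (E.r - (R + 1)) (by omega) (o5.trans h1)
      rw [show E.r - (R + 1) + 1 = E.r - R by omega] at hnext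
      set c := cs (E.r - (R + 1)) with hc
      have hpos : E.pos c = E.r - (R + 1) := by rw [pos, h3]; omega
      set a := pk c with ha
      have hchr : ∀ g < E.p, y g (E.r - (R + 1)) = E.chr a g := fun g _ => rfl
      rw [hnext] at hI
      refine ⟨fun g hg => ⟨E.dg a g, dg_lt hE _ _, o2 g hg, rfl, ?_⟩, fun g hg => ?_, ?_,
        fun g hg g' hg' => ?_⟩
      · have := hI.reads g hg
        rwa [vert_nxt hE c a hg] at this
      · have := hI.avoids g hg
        rw [rep_nxt hE c a hg, idx_nxt hE, hpos] at this
        exact Avoids.of_step hE hR this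
      · have := hI.wt_eq
        rw [wt_nxt hE, idx_nxt hE, hpos] at this
        rw [hpos] at o3
        rw [cost_add_hdFrom hR (E.idx c) a y hchr]
        omega
      · have := hI.dd_eq g hg g' hg'
        rw [dd_nxt hE c a hg hg'] at this
        have h4 := o4 g hg g' hg'
        have h5 : E.neq a g g' = if y g (E.r - (R + 1)) ≠ y g' (E.r - (R + 1)) then 1 else 0 := rfl
        rw [hdFrom_succ hR, ← h5]
        omega
  simpa using key E.r le_rfl

end Core

/-! ### Optimality of the search -/

namespace Core

variable (E : Core)

open Classical in
/-- The table entry that tells whether a final configuration can be reached from `c`, given the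
entries `g` for smaller codes. -/
noncomputable def accStep (g : ℕ → ℕ) (c : ℕ) : ℕ :=
  if E.Fin c ∨ ∃ a, a < E.C ∧ (E.Ok c a ∧ E.nxt c a < c ∧ g (E.nxt c a) ≠ 0) then 1 else 0

/-- The first action after which a final configuration can still be reached. -/
noncomputable def pick (g : ℕ → ℕ) (c : ℕ) : ℕ :=
  least E.C fun a => E.Ok c a ∧ E.nxt c a < c ∧ g (E.nxt c a) ≠ 0

/-- The first start of the search with the greatest score. -/
noncomputable def best (g : ℕ → ℕ) : ℕ :=
  least E.C fun c => (E.Init c ∧ g c ≠ 0) ∧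
    ∀ c', c' < E.C → E.Init c' ∧ g c' ≠ 0 → E.score c' ≤ E.score c

/-- Putting the strings `y` in the place of string `i` gives distinct strings of the language. -/
structure Admissible (i : ℕ) (y : ℕ → ℕ → ℕ) : Prop where
  allowed : E.Allowed i
  inLang : ∀ h < E.p, E.InLang (y h)
  ne_kept : ∀ h < E.p, ∀ j, E.Kept i j → ∃ x < E.r, E.X j x ≠ y h x
  ne_new : ∀ h < E.p, ∀ h' < E.p, h < h' → ∃ x < E.r, y h x ≠ y h' x

/-- The sum of the distances of the ordered pairs of strings after `y` has been put in the place of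
string `i`. -/
def value (i : ℕ) (y : ℕ → ℕ → ℕ) : ℕ :=
  E.rest i + 2 * (∑ h ∈ range E.p, ∑ j ∈ range E.kk, if j ≠ i then E.hd (y h) (E.X j) else 0)
    + ∑ h ∈ range E.p, ∑ h' ∈ range E.p, E.hd (y h) (y h')

variable {E}

theorem hd_le (u v : ℕ → ℕ) : E.hd u v ≤ E.r := by
  unfold hd
  refine (sum_le_sum (g := fun _ => 1) fun x _ => ?_).trans (by simp)
  split <;> simp

theorem one_le_hd {u v : ℕ → ℕ} : 1 ≤ E.hd u v ↔ ∃ x < E.r, u x ≠ v x := by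
  rw [hd, sum_boole, Nat.cast_id, Nat.one_le_iff_ne_zero, card_ne_zero]
  simp [Finset.Nonempty, mem_filter]

theorem Allowed.le {i : ℕ} (h : E.Allowed i) : i ≤ E.K := by
  rcases h with ⟨h1, rfl⟩ | ⟨-, h⟩ <;> omega

/-- The start that announces the strings `y` and their distances. -/
theorem Admissible.exists_config (hE : E.WF) {i : ℕ} {y : ℕ → ℕ → ℕ} (h : E.Admissible i y) :
    ∃ c < E.C, E.Init c ∧ E.Acc c ∧ E.score c = E.value i y := by
  set W := ∑ h ∈ range E.p, ∑ j ∈ range E.kk, (if j ≠ i then E.hd (y h) (E.X j) else 0) with hW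
  have hWlt : W < E.M := by
    refine lt_of_le_of_lt ?_ hE.cross_lt
    calc W ≤ ∑ h ∈ range E.p, ∑ j ∈ range E.kk, E.r :=
          sum_le_sum fun g _ => sum_le_sum fun j _ => by
            split
            · exact hd_le _ _
            · exact Nat.zero_le _
      _ = _ := by simp
  have hhd : ∀ u v, E.hd u v < E.M := fun u v => (hd_le u v).trans_lt hE.r_lt
  have hroot : E.root i ≤ E.K := least_le _ _
  let f : ℕ → ℕ := fun x => if x = 0 then i else if x = 1 then W else if x < 2 + E.p then E.s
    else if x < 2 + 2 * E.p then E.root i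
    else E.hd (y ((x - (2 + 2 * E.p)) / E.p)) (y ((x - (2 + 2 * E.p)) % E.p))
  have hf : ∀ x < E.L, f x < E.M := by
    intro x _
    have := h.allowed.le
    have := hE.K_lt
    simp only [f]
    split_ifs
    · omega
    · exact hWlt
    · exact hE.s_lt
    · omega
    · exact hhd _ _
  set c := E.r * E.M ^ E.L + ∑ x ∈ range E.L, f x * E.M ^ x with hc
  have hcC : c < E.C := by
    refine lt_of_lt_of_le ?_ hE.pow_le
    have h1 := sum_mul_pow_lt hf
    have h2 : (E.r + 1) * E.M ^ E.L ≤ E.M * E.M ^ E.L := Nat.mul_le_mul_right _ hE.r_lt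
    rw [pow_succ, mul_comm (E.M ^ E.L)]
    nlinarith
  have hdg : ∀ x < E.L, E.dg c x = f x := fun x hx => by
    rw [dg, hE.pw_eq x hx.le, hc]
    exact digit_of_sum hf _ hx
  have hL := hE.L_eq
  have hp := hE.one_le_p
  have htop : E.top c = E.r := by
    rw [top, hE.pw_eq _ le_rfl]
    exact div_pow_of_sum (by have := hE.one_lt_M; omega) hf _
  have hidx : E.idx c = i := (hdg 0 (by omega)).trans rfl
  have hwt : E.wt c = W := (hdg 1 (by omega)).trans rfl
  have hvert : ∀ g < E.p, E.vert c g = E.s := fun g hg => by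
    rw [vert, hdg _ (by omega)]
    simp only [f]
    rw [if_neg (by omega), if_neg (by omega), if_pos (by omega)]
  have hrep : ∀ g < E.p, E.rep c g = E.root i := fun g hg => by
    rw [rep, hdg _ (by omega)]
    simp only [f]
    rw [if_neg (by omega), if_neg (by omega), if_neg (by omega), if_pos (by omega)]
  have hdd : ∀ g < E.p, ∀ g' < E.p, E.dd c g g' = E.hd (y g) (y g') := fun g hg g' hg' => by
    have hlt := pair_lt hg hg'
    rw [dd, hdg _ (by omega)]
    simp only [f]
    rw [if_neg (by omega), if_neg (by omega), if_neg (by omega), if_neg (by omega),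
      Nat.add_sub_cancel_left]
    have h1 : (g * E.p + g') / E.p = g := by
      rw [add_comm, Nat.add_mul_div_right _ _ (by omega), Nat.div_eq_of_lt hg', zero_add]
    have h2 : (g * E.p + g') % E.p = g' := by
      rw [add_comm, Nat.add_mul_mod_self_right, Nat.mod_eq_of_lt hg']
    rw [h1, h2]
  refine ⟨c, hcC, ⟨htop, by rw [hidx]; exact h.allowed,
    fun g hg => ⟨hvert g hg, by rw [hrep g hg, hidx]⟩, fun g hg g' hg' hlt => ?_⟩, ?_, ?_⟩
  · rw [hdd g hg g' hg']
    exact one_le_hd.2 (h.ne_new g hg g' hg' hlt)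
  · refine Completes.acc hE y le_rfl htop (fun g hg => ?_) ⟨fun g hg => ?_, fun g hg => ?_, ?_,
      fun g hg g' hg' => ?_⟩
    · rw [hrep g hg, hidx]
      exact kept_of_root_lt
    · rw [hvert g hg]
      exact h.inLang g hg
    · rw [hrep g hg, hidx]
      exact (avoids_root hE).2 (h.ne_kept g hg)
    · simp only [hwt, hidx, hdFrom_r, hW]
    · rw [hdd g hg g' hg', hdFrom_r]
  · rw [score, value, hidx, hwt]
    congr 1
    exact sum_congr rfl fun g hg => sum_congr rfl fun g' hg' =>
      hdd g (mem_range.1 hg) g' (mem_range.1 hg')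

/-- The search succeeds if there are admissible strings, and then the strings spelled out by the run
`cs` from the best start are admissible and of greatest value. -/
theorem search_spec (hE : E.WF) {g cs : ℕ → ℕ} (hg : ∀ c < E.C, g c ≠ 0 ↔ E.Acc c)
    (h0 : E.best g < E.C → cs 0 = E.best g)
    (hcs : ∀ t < E.r, E.nxt (cs t) (E.pick g (cs t)) < E.C →
      cs (t + 1) = E.nxt (cs t) (E.pick g (cs t))) :
    ((∃ i y, E.Admissible i y) → E.best g < E.C) ∧
    (E.best g < E.C →
      E.Admissible (E.idx (cs 0)) (fun h x => E.chr (E.pick g (cs x)) h) ∧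
      ∀ i y, E.Admissible i y →
        E.value i y ≤ E.value (E.idx (cs 0)) fun h x => E.chr (E.pick g (cs x)) h) := by
  classical
  have hbest : ∀ c₁ < E.C, E.Init c₁ ∧ g c₁ ≠ 0 → E.best g < E.C ∧
      (E.Init (E.best g) ∧ g (E.best g) ≠ 0) ∧
      ∀ c', c' < E.C → E.Init c' ∧ g c' ≠ 0 → E.score c' ≤ E.score (E.best g) := by
    intro c₁ hc₁ h₁
    obtain ⟨c, hc, hmax⟩ := exists_max_image ((range E.C).filter fun c => E.Init c ∧ g c ≠ 0) E.score
      ⟨c₁, mem_filter.2 ⟨mem_range.2 hc₁, h₁⟩⟩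
    rw [mem_filter, mem_range] at hc
    exact least_spec (q := fun c => (E.Init c ∧ g c ≠ 0) ∧
      ∀ c', c' < E.C → E.Init c' ∧ g c' ≠ 0 → E.score c' ≤ E.score c) ⟨c, hc.1, hc.2, fun c' h1 h2 =>
      hmax c' (mem_filter.2 ⟨mem_range.2 h1, h2⟩)⟩
  constructor
  · rintro ⟨i, y, h⟩
    obtain ⟨c, hc, hi, ha, -⟩ := h.exists_config hE
    exact (hbest c hc ⟨hi, (hg c hc).2 ha⟩).1
  · intro hlt
    obtain ⟨⟨hi, hgb⟩, hmax⟩ : (E.Init (E.best g) ∧ g (E.best g) ≠ 0) ∧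
        ∀ c', c' < E.C → E.Init c' ∧ g c' ≠ 0 → E.score c' ≤ E.score (E.best g) := by
      by_contra hno
      exact absurd hlt (not_lt.2 (least_eq_of_forall_not fun c hc h =>
        hno (hbest c hc h.1).2).ge)
    have hacc := (hg _ hlt).1 hgb
    replace h0 := h0 hlt
    have hpk : ∀ c < E.C, E.Acc c → 1 ≤ E.top c → E.Ok c (E.pick g c) ∧
        E.nxt c (E.pick g c) < c ∧ E.Acc (E.nxt c (E.pick g c)) := by
      intro c hc ha htop
      have hex : ∃ a < E.C, E.Ok c a ∧ E.nxt c a < c ∧ g (E.nxt c a) ≠ 0 := by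
        cases ha with
        | fin hf => exact absurd hf.1 (by omega)
        | @step _ a h1 h2 h3 h4 => exact ⟨a, h1, h2, h3, (hg _ (h3.trans hc)).2 h4⟩
      obtain ⟨-, h2, h3, h4⟩ := least_spec hex
      exact ⟨h2, h3, (hg _ (h3.trans hc)).1 h4⟩
    have hc := completes_of_run hE (pk := E.pick g) (cs := cs) hpk (by rwa [h0]) (by rwa [h0])
      (by rw [h0]; exact hi.1) hcs
    rw [← h0] at hi hmax
    set y : ℕ → ℕ → ℕ := fun h x => E.chr (E.pick g (cs x)) h with hy
    have hval : E.score (cs 0) = E.value (E.idx (cs 0)) y := by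
      rw [score, value, hc.wt_eq]
      simp only [hdFrom_r]
      congr 1
      refine sum_congr rfl fun a ha => sum_congr rfl fun b hb => ?_
      rw [hc.dd_eq a (mem_range.1 ha) b (mem_range.1 hb), hdFrom_r]
    refine ⟨⟨hi.2.1, fun h hh => ?_, fun h hh => ?_, fun h hh h' hh' hlt' => ?_⟩,
      fun i z hz => ?_⟩
    · have := hc.reads h hh
      rwa [(hi.2.2.1 h hh).1] at this
    · have := hc.avoids h hh
      rw [(hi.2.2.1 h hh).2] at this
      exact (avoids_root hE).1 this
    · have := hi.2.2.2 h hh h' hh' hlt'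
      rw [hc.dd_eq h hh h' hh', hdFrom_r] at this
      exact one_le_hd.1 this
    · obtain ⟨c, hcC, hci, hca, hcs'⟩ := hz.exists_config hE
      rw [← hcs', ← hval]
      exact hmax c hcC ⟨hci, (hg c hcC).2 hca⟩

end Core

/-! ### Local optima -/

theorem hammingDist_eq_sum {r : ℕ} {A : Type} [DecidableEq A] (x y : Fin r → A) :
    hammingDist x y = ∑ c, if x c ≠ y c then 1 else 0 := by
  rw [hammingDist, sum_boole, Nat.cast_id]

/-- In one coordinate, the Hamming distance is of negative type: the difference of the two sides is
the sum of the squares of the differences of the numbers of occurrences of each symbol. -/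
theorem sum_ne_add_sum_ne_le {ι A : Type} [Fintype ι] [DecidableEq A] (u v : ι → A) :
    (∑ i, ∑ j, if u i ≠ u j then 1 else 0) + (∑ i, ∑ j, if v i ≠ v j then 1 else 0)
      ≤ 2 * ∑ i, ∑ j, if v i ≠ u j then 1 else 0 := by
  classical
  set S : Finset A := univ.image u ∪ univ.image v with hS
  have hu : ∀ i, u i ∈ S := fun i => mem_union_left _ (mem_image_of_mem _ (mem_univ i))
  have hv : ∀ i, v i ∈ S := fun i => mem_union_right _ (mem_image_of_mem _ (mem_univ i))
  have hδ : ∀ x ∈ S, ∀ y, ((if x ≠ y then 1 else 0 : ℕ) : ℤ)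
      = 1 - ∑ a ∈ S, (if x = a then 1 else 0) * (if y = a then 1 else 0) := by
    intro x hx y
    simp only [ite_mul, one_mul, zero_mul, sum_ite_eq, hx, if_true]
    by_cases h : x = y
    · simp [h]
    · simp [h, Ne.symm h]
  have key : ∀ f g : ι → A, (∀ i, f i ∈ S) →
      ((∑ i, ∑ j, if f i ≠ g j then 1 else 0 : ℕ) : ℤ)
        = Fintype.card ι * Fintype.card ι - ∑ a ∈ S,
          (∑ i, if f i = a then 1 else 0) * (∑ j, if g j = a then 1 else 0) := by
    intro f g hf
    push_cast
    have : ∀ i, ∑ j, (if f i ≠ g j then (1 : ℤ) else 0)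
        = Fintype.card ι - ∑ j, ∑ a ∈ S, (if f i = a then 1 else 0) * (if g j = a then 1 else 0) := by
      intro i
      rw [Fintype.card_eq_sum_ones, Nat.cast_sum, ← sum_sub_distrib]
      refine sum_congr rfl fun j _ => ?_
      have := hδ (f i) (hf i) (g j)
      push_cast at this ⊢
      exact this
    rw [sum_congr rfl fun i _ => this i, sum_sub_distrib]
    congr 1
    · simp
    · rw [sum_congr rfl fun i _ => sum_comm, sum_comm]
      exact sum_congr rfl fun a _ => (sum_mul_sum _ _ _ _).symm
  zify
  have h1 := key u u hu
  have h2 := key v v hv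
  have h3 := key v u hv
  push_cast at h1 h2 h3 ⊢
  rw [h1, h2, h3]
  have hsq : 0 ≤ ∑ a ∈ S, ((∑ i, if u i = a then (1 : ℤ) else 0)
      - ∑ i, if v i = a then (1 : ℤ) else 0) ^ 2 := sum_nonneg fun _ _ => sq_nonneg _
  have hexp : ∑ a ∈ S, ((∑ i, if u i = a then (1 : ℤ) else 0)
        - ∑ i, if v i = a then (1 : ℤ) else 0) ^ 2
      = (∑ a ∈ S, (∑ i, if u i = a then (1 : ℤ) else 0) * (∑ j, if u j = a then 1 else 0))
        + (∑ a ∈ S, (∑ i, if v i = a then (1 : ℤ) else 0) * (∑ j, if v j = a then 1 else 0))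
        - 2 * ∑ a ∈ S, (∑ i, if v i = a then (1 : ℤ) else 0) * (∑ j, if u j = a then 1 else 0) := by
    rw [mul_sum, ← sum_add_distrib, ← sum_sub_distrib]
    exact sum_congr rfl fun a _ => by ring
  linarith

/-- The Hamming distance is of negative type. -/
theorem sum_hammingDist_add_le {ι A : Type} [Fintype ι] [DecidableEq A] {r : ℕ}
    (X Y : ι → Fin r → A) :
    (∑ i, ∑ j, hammingDist (X i) (X j)) + (∑ i, ∑ j, hammingDist (Y i) (Y j))
      ≤ 2 * ∑ i, ∑ j, hammingDist (Y i) (X j) := by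
  have key : ∀ Z W : ι → Fin r → A, ∑ i, ∑ j, hammingDist (Z i) (W j)
      = ∑ c, ∑ i, ∑ j, if Z i c ≠ W j c then 1 else 0 := by
    intro Z W
    simp only [hammingDist_eq_sum]
    rw [sum_congr rfl fun i _ => sum_comm, sum_comm]
  rw [key, key, key, mul_sum, ← sum_add_distrib]
  exact sum_le_sum fun c _ => sum_ne_add_sum_ne_le (fun i => X i c) fun i => Y i c

/-- If no exchange of a single string of `X` for a string of `Y` increases the sum of the distances,
then that sum is at least `(K - 1) / (K + 3)` times the one of `Y`. -/
theorem local_optimum_bound {K r : ℕ} {A : Type} [DecidableEq A] (X Y : Fin K → Fin r → A)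
    (hX : Function.Injective X) (hY : Function.Injective Y)
    (hopt : ∀ i k, (∀ j, j ≠ i → X j ≠ Y k) →
      ∑ j, (if j ≠ i then hammingDist (Y k) (X j) else 0)
        ≤ ∑ j, if j ≠ i then hammingDist (X i) (X j) else 0) :
    K * ∑ i, ∑ j, hammingDist (Y i) (Y j)
      ≤ (K + 3) * (∑ i, ∑ j, hammingDist (X i) (X j)) + ∑ i, ∑ j, hammingDist (Y i) (Y j) := by
  classical
  have hcard : Fintype.card (Fin K) = #(univ.image Y) := by
    rw [card_image_of_injective _ hY, card_univ]
  -- The strings of `Y` are matched with those of `X`, the common ones with themselves.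
  obtain ⟨g, hg⟩ := exists_equiv_extend_of_card_eq hcard
    (s := univ.filter fun i => X i ∈ univ.image Y) (f := X)
    (by
      intro z hz
      obtain ⟨i, hi, rfl⟩ := mem_image.1 hz
      exact (mem_filter.1 hi).2) hX.injOn
  have hgX : ∀ i j, j ≠ i → X j ≠ g i := by
    intro i j hji h
    have hj : X j ∈ univ.image Y := h ▸ (g i).2
    have := hg j (mem_filter.2 ⟨mem_univ _, hj⟩)
    exact hji (g.injective (Subtype.ext (this.trans h)))
  have hsum : ∀ F : (Fin r → A) → ℕ, ∑ i, F (g i) = ∑ k, F (Y k) := by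
    intro F
    rw [Equiv.sum_comp g fun z => F z, sum_coe_sort (univ.image Y) F, sum_image hY.injOn]
  have hoptg : ∀ i, ∑ j, hammingDist (g i : Fin r → A) (X j)
      ≤ (∑ j, hammingDist (X i) (X j)) + hammingDist (g i : Fin r → A) (X i) := by
    intro i
    obtain ⟨k, -, hk⟩ := mem_image.1 (g i).2
    have h := hopt i k (by rw [hk]; exact hgX i)
    rw [hk] at h
    have hsplit : ∀ F : Fin K → ℕ, ∑ j, F j = (∑ j, if j ≠ i then F j else 0) + F i := by
      intro F
      have : F i = ∑ j, if j = i then F j else 0 := by simp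
      rw [this, ← sum_add_distrib]
      refine sum_congr rfl fun j _ => ?_
      by_cases hj : j = i <;> simp [hj]
    rw [hsplit fun j => hammingDist (g i : Fin r → A) (X j), hsplit fun j => hammingDist (X i) (X j),
      hammingDist_self]
    omega
  set a := ∑ i, ∑ j, hammingDist (X i) (X j) with ha
  set b := ∑ i, ∑ j, hammingDist (Y i) (X j) with hb
  set p := ∑ i, hammingDist (g i : Fin r → A) (X i) with hp
  have h1 : b ≤ a + p := by
    rw [hb, ← hsum fun z => ∑ j, hammingDist z (X j), ha, hp, ← sum_add_distrib]
    exact sum_le_sum fun i _ => hoptg i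
  have h2 : K * p ≤ b + a := by
    have : K * p = ∑ i, ∑ _j : Fin K, hammingDist (g i : Fin r → A) (X i) := by
      simp [hp, mul_sum]
    rw [this, hb, ← hsum fun z => ∑ j, hammingDist z (X j), ha, ← sum_add_distrib]
    refine sum_le_sum fun i _ => ?_
    rw [← sum_add_distrib]
    refine sum_le_sum fun j _ => ?_
    rw [hammingDist_comm (X i)]
    exact hammingDist_triangle _ _ _
  have h3 := sum_hammingDist_add_le X Y
  rw [← ha, ← hb] at h3
  rcases Nat.eq_zero_or_pos K with rfl | hK
  · simp
  · obtain ⟨k, rfl⟩ : ∃ k, K = k + 1 := ⟨K - 1, by omega⟩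
    nlinarith [Nat.mul_le_mul_left k h3, Nat.mul_le_mul_left (k + 1) h1]

namespace Core

/-! ### Greedy choice and local search -/

variable (E : Core)

/-- The first `k` strings of `X` are distinct strings of the language. -/
def Valid (k : ℕ) (X : ℕ → ℕ → ℕ) : Prop :=
  (∀ j < k, E.InLang (X j)) ∧ ∀ j < k, ∀ j' < k, j < j' → ∃ x < E.r, X j x ≠ X j' x

/-- The sum of the distances of the ordered pairs of strings among the first `k` of `X`. -/
def div₂ (k : ℕ) (X : ℕ → ℕ → ℕ) : ℕ := ∑ j ∈ range k, ∑ j' ∈ range k, E.hd (X j) (X j')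

/-- The search with other old strings. -/
def withOld (kk : ℕ) (X : ℕ → ℕ → ℕ) : Core := { E with kk := kk, X := X }

/-- The numbers of old strings and the strings before and after one round of the search, in which
the number of strings grows by at most `kinc`. -/
structure Outcome (E : Core) (kinc : ℕ) (found : Prop) (kk' : ℕ) (X' : ℕ → ℕ → ℕ) : Prop where
  found_iff : found ↔ ∃ i y, E.Admissible i y
  of_not_found : ¬ found → kk' = E.kk ∧ ∀ j < E.K, ∀ x < E.r, X' j x = E.X j x
  of_found : found → kk' = min E.K (E.kk + kinc) ∧ ∃ i y, E.Admissible i y ∧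
    (∀ i' y', E.Admissible i' y' → E.value i' y' ≤ E.value i y) ∧
    ∀ j < E.K, ∀ x < E.r, X' j x = if i ≤ j ∧ j < i + E.p then y (j - i) x else E.X j x

variable {E}

theorem reads_withOld {kk : ℕ} {X : ℕ → ℕ → ℕ} {R : ℕ} {y : ℕ → ℕ} :
    ∀ {v : ℕ}, (E.withOld kk X).Reads v R y ↔ E.Reads v R y := by
  induction R with
  | zero => exact Iff.rfl
  | succ R ih =>
    intro v
    exact exists_congr fun e => and_congr_right fun _ => and_congr_right fun _ =>
      and_congr_right fun _ => ih

theorem valid_withOld {kk k : ℕ} {X Y : ℕ → ℕ → ℕ} :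
    (E.withOld kk X).Valid k Y ↔ E.Valid k Y :=
  and_congr_left fun _ => forall₂_congr fun _ _ => reads_withOld

theorem hd_comm (u v : ℕ → ℕ) : E.hd u v = E.hd v u :=
  sum_congr rfl fun x _ => by simp only [ne_comm]

theorem hd_self (u : ℕ → ℕ) : E.hd u u = 0 := by simp [hd]

theorem hd_congr {u v u' v' : ℕ → ℕ} (hu : ∀ x < E.r, u x = u' x) (hv : ∀ x < E.r, v x = v' x) :
    E.hd u v = E.hd u' v' :=
  sum_congr rfl fun x hx => by rw [hu x (mem_range.1 hx), hv x (mem_range.1 hx)]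

theorem Reads.congr {y y' : ℕ → ℕ} (hy : ∀ x < E.r, y x = y' x) {R : ℕ} (hR : R ≤ E.r) :
    ∀ {v : ℕ}, E.Reads v R y → E.Reads v R y' := by
  induction R with
  | zero => exact fun h => h
  | succ R ih =>
    rintro v ⟨e, h1, h2, h3, h4⟩
    exact ⟨e, h1, h2, h3.trans (hy _ (by omega)), ih (by omega) h4⟩

theorem InLang.congr {y y' : ℕ → ℕ} (h : E.InLang y) (hy : ∀ x < E.r, y x = y' x) : E.InLang y' :=
  Reads.congr hy le_rfl h

theorem Valid.congr {k : ℕ} {X X' : ℕ → ℕ → ℕ} (h : E.Valid k X)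
    (hX : ∀ j < k, ∀ x < E.r, X j x = X' j x) : E.Valid k X' := by
  refine ⟨fun j hj => (h.1 j hj).congr (hX j hj), fun j hj j' hj' hlt => ?_⟩
  obtain ⟨x, hx, hne⟩ := h.2 j hj j' hj' hlt
  exact ⟨x, hx, by rwa [← hX j hj x hx, ← hX j' hj' x hx]⟩

theorem Valid.ne {k : ℕ} {X : ℕ → ℕ → ℕ} (h : E.Valid k X) {j j' : ℕ} (hj : j < k) (hj' : j' < k)
    (hne : j ≠ j') : ∃ x < E.r, X j x ≠ X j' x := by
  rcases Nat.lt_or_gt_of_ne hne with hlt | hgt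
  · exact h.2 j hj j' hj' hlt
  · obtain ⟨x, hx, hx'⟩ := h.2 j' hj' j hj hgt
    exact ⟨x, hx, hx'.symm⟩

theorem div₂_congr {k : ℕ} {X X' : ℕ → ℕ → ℕ} (hX : ∀ j < k, ∀ x < E.r, X j x = X' j x) :
    E.div₂ k X = E.div₂ k X' :=
  sum_congr rfl fun j hj => sum_congr rfl fun j' hj' =>
    hd_congr (hX j (mem_range.1 hj)) (hX j' (mem_range.1 hj'))

theorem div₂_le (k : ℕ) (X : ℕ → ℕ → ℕ) : E.div₂ k X ≤ k * k * E.r :=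
  (sum_le_sum fun _ _ => sum_le_sum fun _ _ => hd_le _ _).trans (by simp [mul_assoc])

/-- The sum of the distances after `z` is put in the place of string `i`. -/
theorem div₂_replace {X : ℕ → ℕ → ℕ} {z : ℕ → ℕ} {i : ℕ} (hi : i < E.kk)
    (hX : ∀ j < E.kk, ∀ x < E.r, X j x = if j = i then z x else E.X j x) :
    E.div₂ E.kk X
      = E.rest i + 2 * ∑ j ∈ range E.kk, if j ≠ i then E.hd z (E.X j) else 0 := by
  have hXi : ∀ x < E.r, X i x = z x := fun x hx => by rw [hX i hi x hx, if_pos rfl]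
  have hXj : ∀ j < E.kk, j ≠ i → ∀ x < E.r, X j x = E.X j x := fun j hj hne x hx => by
    rw [hX j hj x hx, if_neg hne]
  have hterm : ∀ j ∈ range E.kk, ∀ j' ∈ range E.kk, E.hd (X j) (X j')
      = (if j ≠ i ∧ j' ≠ i then E.hd (E.X j) (E.X j') else 0)
        + ((if j = i then (if j' ≠ i then E.hd z (E.X j') else 0) else 0)
          + (if j' = i then (if j ≠ i then E.hd z (E.X j) else 0) else 0)) := by
    intro j hj j' hj'
    rw [mem_range] at hj hj'
    by_cases h : j = i
    · subst h
      by_cases h' : j' = j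
      · subst h'; simp [hd_self]
      · simp [h', hd_congr hXi (hXj j' hj' h')]
    · by_cases h' : j' = i
      · subst h'
        rw [hd_comm]
        simp [h, hd_congr hXi (hXj j hj h)]
      · simp [h, h', hd_congr (hXj j hj h) (hXj j' hj' h')]
  rw [div₂, sum_congr rfl fun j hj => sum_congr rfl (hterm j hj)]
  simp only [sum_add_distrib]
  have h1 : ∑ j ∈ range E.kk, ∑ j' ∈ range E.kk,
      (if j = i then (if j' ≠ i then E.hd z (E.X j') else 0) else 0)
      = ∑ j ∈ range E.kk, if j ≠ i then E.hd z (E.X j) else 0 := by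
    rw [sum_eq_single i]
    · simp
    · intro j _ hne; simp [hne]
    · intro h; exact absurd (mem_range.2 hi) h
  have h2 : ∑ j ∈ range E.kk, ∑ j' ∈ range E.kk,
      (if j' = i then (if j ≠ i then E.hd z (E.X j) else 0) else 0)
      = ∑ j ∈ range E.kk, if j ≠ i then E.hd z (E.X j) else 0 := by
    refine sum_congr rfl fun j _ => ?_
    rw [sum_ite_eq', if_pos (mem_range.2 hi)]
  rw [h1, h2, rest]
  ring

theorem value_one (hp : E.p = 1) (i : ℕ) (y : ℕ → ℕ → ℕ) :
    E.value i y = E.rest i + 2 * ∑ j ∈ range E.kk, if j ≠ i then E.hd (y 0) (E.X j) else 0 := by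
  simp [value, hp, hd_self]

theorem admissible_one (hp : E.p = 1) {i : ℕ} {z : ℕ → ℕ} (hi : E.Allowed i) (hz : E.InLang z)
    (hne : ∀ j, E.Kept i j → ∃ x < E.r, E.X j x ≠ z x) : E.Admissible i fun _ => z :=
  ⟨hi, fun _ _ => hz, fun _ _ => hne, fun h hh h' hh' hlt => by omega⟩

/-- As long as there are fewer than `K` strings, and `K` strings exist, one more can be found. -/
theorem exists_admissible (hp : E.p = 1) (hkk : E.kk < E.K) {Y : ℕ → ℕ → ℕ}
    (hY : E.Valid E.K Y) : ∃ i y, E.Admissible i y := by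
  by_contra hno
  have h : ∀ q : _root_.Fin E.K, ∃ j : _root_.Fin E.kk, ∀ x < E.r, E.X j x = Y q x := by
    intro q
    by_contra hq
    push Not at hq
    refine hno ⟨E.kk, fun _ => Y q, admissible_one hp (Or.inl ⟨hkk, rfl⟩) (hY.1 q q.2)
      fun j hj => ?_⟩
    exact hq ⟨j, hj.1⟩
  choose f hf using h
  have hinj : Function.Injective f := by
    intro q q' hqq
    by_contra hne
    obtain ⟨x, hx, hx'⟩ := hY.ne q.2 q'.2 fun h => hne (Fin.ext h)
    exact hx' (by rw [← hf q x hx, ← hf q' x hx, hqq])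
  have := Fintype.card_le_of_injective f hinj
  simp at this
  omega

/-- A round that searches for a single string keeps the strings distinct and in the language. -/
theorem Outcome.valid {kk' : ℕ} {X' : ℕ → ℕ → ℕ} {found : Prop} (hp : E.p = 1)
    (h : E.Outcome 1 found kk' X') (hkk : E.kk ≤ E.K) (hX : E.Valid E.kk E.X) :
    kk' ≤ E.K ∧ E.Valid kk' X' := by
  by_cases hf : found
  · obtain ⟨hk, i, y, hy, -, hX'⟩ := h.of_found hf
    refine ⟨by omega, ?_⟩
    rw [hp] at hX'
    have hXi : ∀ j < kk', ∀ x < E.r, X' j x = if j = i then y 0 x else E.X j x := by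
      intro j hj x hx
      rw [hX' j (by omega) x hx]
      by_cases hji : j = i
      · rw [if_pos (by omega), if_pos hji, hji, Nat.sub_self]
      · rw [if_neg (by omega), if_neg hji]
    have hlt : ∀ j < kk', j ≠ i → j < E.kk := by
      intro j hj hji
      rcases hy.allowed with ⟨h1, h2⟩ | ⟨h1, h2⟩ <;> omega
    have hlang : ∀ j < kk', E.InLang (X' j) := by
      intro j hj
      by_cases hji : j = i
      · exact (hy.inLang 0 (by omega)).congr fun x hx => by rw [hXi j hj x hx, if_pos hji]
      · exact (hX.1 j (hlt j hj hji)).congr fun x hx => by rw [hXi j hj x hx, if_neg hji]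
    refine ⟨hlang, fun j hj j' hj' hjj => ?_⟩
    by_cases hji : j = i
    · have hji' : j' ≠ i := by omega
      obtain ⟨x, hx, hne⟩ := hy.ne_kept 0 (by omega) j' ⟨hlt j' hj' hji', hji'⟩
      refine ⟨x, hx, ?_⟩
      rw [hXi j hj x hx, if_pos hji, hXi j' hj' x hx, if_neg hji']
      exact hne.symm
    · by_cases hji' : j' = i
      · obtain ⟨x, hx, hne⟩ := hy.ne_kept 0 (by omega) j ⟨hlt j hj hji, hji⟩
        refine ⟨x, hx, ?_⟩
        rw [hXi j hj x hx, if_neg hji, hXi j' hj' x hx, if_pos hji']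
        exact hne
      · obtain ⟨x, hx, hne⟩ := hX.2 j (hlt j hj hji) j' (hlt j' hj' hji') hjj
        refine ⟨x, hx, ?_⟩
        rwa [hXi j hj x hx, if_neg hji, hXi j' hj' x hx, if_neg hji']
  · obtain ⟨hk, hX'⟩ := h.of_not_found hf
    rw [hk]
    exact ⟨hkk, hX.congr fun j hj x hx => (hX' j (by omega) x hx).symm⟩

/-- One round of local search is at least as good as any exchange of a single string. -/
theorem Outcome.exchange_le {kk' : ℕ} {X' : ℕ → ℕ → ℕ} {found : Prop} (hp : E.p = 1)
    (h : E.Outcome 1 found kk' X') (hkk : E.kk = E.K) {i : ℕ} {z : ℕ → ℕ} (hi : i < E.K)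
    (hz : E.InLang z) (hne : ∀ j < E.K, j ≠ i → ∃ x < E.r, E.X j x ≠ z x) :
    kk' = E.K ∧
    E.rest i + 2 * (∑ j ∈ range E.K, if j ≠ i then E.hd z (E.X j) else 0) ≤ E.div₂ E.K X' := by
  have hadm : E.Admissible i fun _ => z :=
    admissible_one hp (Or.inr ⟨hkk, hi⟩) hz fun j hj => hne j (hkk ▸ hj.1) hj.2
  have hf : found := h.found_iff.2 ⟨_, _, hadm⟩
  obtain ⟨hk, i₀, y, hy, hmax, hX'⟩ := h.of_found hf
  have hi₀ : i₀ < E.K := by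
    rcases hy.allowed with ⟨h1, h2⟩ | ⟨h1, h2⟩ <;> omega
  refine ⟨by omega, ?_⟩
  have h1 := hmax _ _ hadm
  rw [value_one hp, value_one hp, ← div₂_replace (X := X') (z := y 0) (i := i₀) (by omega),
    hkk] at h1
  · exact h1
  · intro j hj x hx
    rw [hX' j (by omega) x hx, hp]
    by_cases hji : j = i₀
    · rw [if_pos (by omega), if_pos hji, hji, Nat.sub_self]
    · rw [if_neg (by omega), if_neg hji]

theorem div₂_eq (hkk : E.kk = E.K) {i : ℕ} (hi : i < E.K) :
    E.div₂ E.K E.X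
      = E.rest i + 2 * ∑ j ∈ range E.K, if j ≠ i then E.hd (E.X i) (E.X j) else 0 := by
  have h := div₂_replace (E := E) (X := E.X) (z := E.X i) (i := i) (by omega) fun j hj x hx => by
    by_cases hji : j = i
    · rw [if_pos hji, hji]
    · rw [if_neg hji]
  rwa [hkk] at h

theorem hammingDist_eq_hd (u v : ℕ → ℕ) :
    hammingDist (fun x : _root_.Fin E.r => u x) (fun x => v x) = E.hd u v := by
  rw [hammingDist_eq_sum, hd, sum_range]

theorem sum_fin_eq_div₂ (k : ℕ) (X : ℕ → ℕ → ℕ) :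
    ∑ i : _root_.Fin k, ∑ j : _root_.Fin k,
      hammingDist (fun x : _root_.Fin E.r => X i x) (fun x => X j x) = E.div₂ k X := by
  simp only [hammingDist_eq_hd, div₂, sum_range]

/-- If a round of local search brings no progress, then the strings are almost optimal. -/
theorem Outcome.almost_optimal {kk' : ℕ} {X' Y : ℕ → ℕ → ℕ} {found : Prop} (hp : E.p = 1)
    (h : E.Outcome 1 found kk' X') (hkk : E.kk = E.K) (hX : E.Valid E.K E.X)
    (hle : E.div₂ E.K X' ≤ E.div₂ E.K E.X) (hY : E.Valid E.K Y) :
    E.K * E.div₂ E.K Y ≤ (E.K + 3) * E.div₂ E.K E.X + E.div₂ E.K Y := by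
  have hinj : ∀ Z : ℕ → ℕ → ℕ, E.Valid E.K Z →
      Function.Injective fun (i : _root_.Fin E.K) (x : _root_.Fin E.r) => Z i x := by
    intro Z hZ i j hij
    by_contra hne
    obtain ⟨x, hx, hx'⟩ := hZ.ne i.2 j.2 fun h => hne (Fin.ext h)
    exact hx' (congrFun hij ⟨x, hx⟩)
  have key := local_optimum_bound (fun (i : _root_.Fin E.K) (x : _root_.Fin E.r) => E.X i x)
    (fun i x => Y i x) (hinj _ hX) (hinj _ hY) ?_
  · rwa [sum_fin_eq_div₂, sum_fin_eq_div₂] at key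
  · intro i k hik
    have h1 := (h.exchange_le hp hkk i.2 (hY.1 k k.2) fun j hj hji => by
      have h2 := hik ⟨j, hj⟩ fun h => hji (by rw [← h])
      by_contra hno
      push Not at hno
      exact h2 (funext fun x => hno x x.2)).2
    have h3 := h1.trans (hle.trans_eq (div₂_eq hkk i.2))
    have h4 : ∀ z : ℕ → ℕ, ∑ j : _root_.Fin E.K, (if j ≠ i then
        hammingDist (fun x : _root_.Fin E.r => z x) (fun x => E.X j x) else 0)
        = ∑ j ∈ range E.K, if j ≠ (i : ℕ) then E.hd z (E.X j) else 0 := by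
      intro z
      rw [sum_range]
      refine sum_congr rfl fun j _ => ?_
      rw [hammingDist_eq_hd]
      simp only [ne_eq, Fin.ext_iff]
    rw [h4 (Y k), h4 (E.X i)]
    omega

/-- Greedy choice of `K` strings followed by local search: the sum of the distances is bounded by
`K * K * r`, so that there is a round without progress before round `T`. -/
theorem local_search (E : Core) (hp : E.p = 1) {kk : ℕ → ℕ} {X : ℕ → ℕ → ℕ → ℕ} {found : ℕ → Prop}
    (h0 : kk 0 = 0)
    (hstep : ∀ t, (E.withOld (kk t) (X t)).Outcome 1 (found t) (kk (t + 1)) (X (t + 1)))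
    {T : ℕ} (hT : E.K + E.K * E.K * E.r + 1 ≤ T) :
    (kk T = E.K → E.Valid E.K (X T)) ∧ ∀ Y, E.Valid E.K Y → kk T = E.K ∧
      E.K * E.div₂ E.K Y ≤ (E.K + 3) * E.div₂ E.K (X T) + E.div₂ E.K Y := by
  have hinv : ∀ t, kk t ≤ E.K ∧ E.Valid (kk t) (X t) := by
    intro t
    induction t with
    | zero => rw [h0]; exact ⟨Nat.zero_le _, fun j hj => by omega, fun j hj => by omega⟩
    | succ t ih =>
      obtain ⟨h1, h2⟩ := (hstep t).valid (E := E.withOld (kk t) (X t)) hp ih.1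
        (valid_withOld.2 ih.2)
      exact ⟨h1, valid_withOld.1 h2⟩
  refine ⟨fun h => h ▸ (hinv T).2, fun Y hY => ?_⟩
  have hgreedy : ∀ t, kk t = min t E.K := by
    intro t
    induction t with
    | zero => omega
    | succ t ih =>
      rcases Nat.lt_or_ge (kk t) E.K with hlt | hge
      · have hf : found t := (hstep t).found_iff.2
          (exists_admissible (E := E.withOld (kk t) (X t)) hp hlt (valid_withOld.2 hY))
        have := ((hstep t).of_found hf).1
        change kk (t + 1) = min E.K (kk t + 1) at this
        omega
      · by_cases hf : found t
        · have := ((hstep t).of_found hf).1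
          change kk (t + 1) = min E.K (kk t + 1) at this
          omega
        · have := ((hstep t).of_not_found hf).1
          change kk (t + 1) = kk t at this
          omega
  have hkk : ∀ t, E.K ≤ t → kk t = E.K := fun t ht => by rw [hgreedy]; omega
  have hval : ∀ t, E.K ≤ t → E.Valid E.K (X t) := fun t ht => by
    have := (hinv t).2
    rwa [hkk t ht] at this
  refine ⟨hkk T (by omega), ?_⟩
  rcases Nat.eq_zero_or_pos E.K with hK | hK
  · simp [hK, div₂]
  have hmono : ∀ t, E.K ≤ t → E.div₂ E.K (X t) ≤ E.div₂ E.K (X (t + 1)) := by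
    intro t ht
    have h1 := ((hstep t).exchange_le (E := E.withOld (kk t) (X t)) hp (hkk t ht) (i := 0)
      (z := X t 0) hK (reads_withOld.2 ((hval t ht).1 0 hK))
      fun j hj hj0 => (hval t ht).ne hj hK hj0).2
    have h2 := div₂_eq (E := E.withOld (kk t) (X t)) (hkk t ht) hK
    exact h2.trans_le h1
  obtain ⟨t, ht, htT, hle⟩ : ∃ t, E.K ≤ t ∧ t < T ∧
      E.div₂ E.K (X (t + 1)) ≤ E.div₂ E.K (X t) := by
    by_contra hno
    push Not at hno
    have : ∀ n, E.K + n ≤ T → n ≤ E.div₂ E.K (X (E.K + n)) := by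
      intro n
      induction n with
      | zero => exact fun _ => Nat.zero_le _
      | succ n ih =>
        intro hn
        have h1 := ih (by omega)
        have h2 := hno (E.K + n) (by omega) (by omega)
        rw [← Nat.add_assoc]
        omega
    have h1 := this (T - E.K) (by omega)
    have h2 := div₂_le (E := E) E.K (X (E.K + (T - E.K)))
    omega
  have hTt : E.div₂ E.K (X t) ≤ E.div₂ E.K (X T) := by
    have : ∀ n, E.div₂ E.K (X t) ≤ E.div₂ E.K (X (t + n)) := by
      intro n
      induction n with
      | zero => exact le_rfl
      | succ n ih => exact ih.trans (hmono _ (by omega))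
    have := this (T - t)
    rwa [Nat.add_sub_cancel' htT.le] at this
  have h1 := (hstep t).almost_optimal (E := E.withOld (kk t) (X t)) hp (hkk t ht)
    (valid_withOld.2 (hval t ht)) hle (valid_withOld.2 hY)
  exact h1.trans (Nat.add_le_add_right (Nat.mul_le_mul_left _ hTt) _)

/-- With `p = K` and no old strings, one round finds `K` strings of greatest value. -/
theorem exhaustive_search {kk' : ℕ} {X' : ℕ → ℕ → ℕ} {found : Prop} (hp : E.p = E.K)
    (hK : 1 ≤ E.K) (h0 : E.kk = 0) (h : E.Outcome 0 found kk' X') :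
    kk' = 0 ∧ (found → E.Valid E.K X') ∧
      ∀ Y, E.Valid E.K Y → found ∧ E.div₂ E.K Y ≤ E.div₂ E.K X' := by
  have hvalue : ∀ i y, E.value i y = E.div₂ E.K y := by
    intro i y
    simp [value, rest, h0, hp, div₂]
  have hadm : ∀ i y, E.Admissible i y ↔ i = 0 ∧ E.Valid E.K y := by
    intro i y
    constructor
    · intro hy
      refine ⟨?_, fun j hj => hy.inLang j (by omega), fun j hj j' hj' => hy.ne_new j (by omega) j'
        (by omega)⟩
      rcases hy.allowed with ⟨h1, h2⟩ | ⟨h1, h2⟩ <;> omega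
    · rintro ⟨rfl, hy⟩
      refine ⟨Or.inl ⟨by omega, h0.symm⟩, fun j hj => hy.1 j (by omega), fun j _ j' hj' => ?_,
        fun j hj j' hj' => hy.2 j (by omega) j' (by omega)⟩
      have := hj'.1
      omega
  have hfound : found → E.Valid E.K X' ∧ ∀ Y, E.Valid E.K Y → E.div₂ E.K Y ≤ E.div₂ E.K X' := by
    intro hf
    obtain ⟨-, i, y, hy, hmax, hX'⟩ := h.of_found hf
    obtain ⟨rfl, hyv⟩ := (hadm i y).1 hy
    have hXy : ∀ j < E.K, ∀ x < E.r, y j x = X' j x := fun j hj x hx => by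
      rw [hX' j hj x hx, if_pos (by omega), Nat.sub_zero]
    refine ⟨hyv.congr hXy, fun Y hY => ?_⟩
    have := hmax 0 Y ((hadm 0 Y).2 ⟨rfl, hY⟩)
    rwa [hvalue, hvalue, div₂_congr hXy] at this
  refine ⟨?_, fun hf => (hfound hf).1, fun Y hY => ?_⟩
  · by_cases hf : found
    · have := (h.of_found hf).1
      omega
    · exact (h.of_not_found hf).1.trans h0
  · have hf := h.found_iff.2 ⟨0, Y, (hadm 0 Y).2 ⟨rfl, hY⟩⟩
    exact ⟨hf, (hfound hf).2 Y hY⟩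

end Core

/-! ### The search as a bounded program -/

/-- The data of the search as they are stored in the memory. Array `2` holds the parameters, arrays
`3` to `6` the automaton, array `7` the powers of the base, array `8` the strings, and array `13`
their number. Numbers that bound loops are cut off at `C`, so that they may serve as ranges of bounded
expressions. -/
def Mem.core (m : Mem) : Core where
  C := m.C
  M := min (m.arr 2 0) m.C
  p := min (m.arr 2 1) m.C
  K := min (m.arr 2 2) m.C
  s := m.arr 2 3
  r := min (m.arr 2 4) m.C
  kk := min (m.arr 13 0) m.C
  L := min (m.arr 2 5) m.C
  src := m.arr 3
  lab := m.arr 4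
  tgt := m.arr 5
  acc := m.arr 6
  pw := m.arr 7
  X j x := m.arr 8 (j * min (m.arr 2 0) m.C + x)

section Instances

variable {α : Type} [Ctx α] {g : α → Mem} [IsMem g]

instance : EvLe (fun p => (g p).core.C) := inferInstanceAs (EvLe fun p => (g p).C)
instance : EvLe (fun p => (g p).core.M) :=
  inferInstanceAs (EvLe fun p => min ((g p).arr 2 0) (g p).C)
instance : EvLe (fun p => (g p).core.p) :=
  inferInstanceAs (EvLe fun p => min ((g p).arr 2 1) (g p).C)
instance : EvLe (fun p => (g p).core.K) :=
  inferInstanceAs (EvLe fun p => min ((g p).arr 2 2) (g p).C)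
instance : EvLe (fun p => (g p).core.r) :=
  inferInstanceAs (EvLe fun p => min ((g p).arr 2 4) (g p).C)
instance : EvLe (fun p => (g p).core.kk) :=
  inferInstanceAs (EvLe fun p => min ((g p).arr 13 0) (g p).C)
instance : EvLe (fun p => (g p).core.L) :=
  inferInstanceAs (EvLe fun p => min ((g p).arr 2 5) (g p).C)
instance : Ev (fun p => (g p).core.s) := inferInstanceAs (Ev fun p => (g p).arr 2 3)

variable {a b c d e : α → ℕ} [Ev a] [Ev b] [Ev c] [Ev d] [Ev e]

instance : Ev (fun p => (g p).core.src (a p)) := inferInstanceAs (Ev fun p => (g p).arr 3 (a p))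
instance : Ev (fun p => (g p).core.lab (a p)) := inferInstanceAs (Ev fun p => (g p).arr 4 (a p))
instance : Ev (fun p => (g p).core.tgt (a p)) := inferInstanceAs (Ev fun p => (g p).arr 5 (a p))
instance : Ev (fun p => (g p).core.acc (a p)) := inferInstanceAs (Ev fun p => (g p).arr 6 (a p))
instance : Ev (fun p => (g p).core.pw (a p)) := inferInstanceAs (Ev fun p => (g p).arr 7 (a p))
instance : Ev (fun p => (g p).core.X (a p) (b p)) :=
  inferInstanceAs (Ev fun p => (g p).arr 8 (a p * min ((g p).arr 2 0) (g p).C + b p))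
instance : Ev (fun p => (g p).core.dg (a p) (b p)) := by unfold Core.dg; infer_instance
instance : Ev (fun p => (g p).core.top (a p)) := by unfold Core.top; infer_instance
instance : Ev (fun p => (g p).core.pos (a p)) := by unfold Core.pos; infer_instance
instance : Ev (fun p => (g p).core.idx (a p)) := by unfold Core.idx; infer_instance
instance : Ev (fun p => (g p).core.wt (a p)) := by unfold Core.wt; infer_instance
instance : Ev (fun p => (g p).core.vert (a p) (b p)) := by unfold Core.vert; infer_instance
instance : Ev (fun p => (g p).core.rep (a p) (b p)) := by unfold Core.rep; infer_instance
instance : Ev (fun p => (g p).core.dd (a p) (b p) (c p)) := by unfold Core.dd; infer_instance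
instance : Ev (fun p => (g p).core.chr (a p) (b p)) := by unfold Core.chr; infer_instance
instance : EvP (fun p => (g p).core.Kept (a p) (b p)) := by unfold Core.Kept; infer_instance
instance : EvP (fun p => (g p).core.SamePre (a p) (b p) (c p)) := by
  unfold Core.SamePre; infer_instance
instance : Ev (fun p => (g p).core.trieStep (a p) (b p) (c p) (d p)) := by
  unfold Core.trieStep; infer_instance
instance : Ev (fun p => (g p).core.root (a p)) := by unfold Core.root; infer_instance
instance : Ev (fun p => (g p).core.cost (a p) (b p) (c p)) := by unfold Core.cost; infer_instance
instance : Ev (fun p => (g p).core.neq (a p) (b p) (c p)) := by unfold Core.neq; infer_instance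
instance : EvP (fun p => (g p).core.Ok (a p) (b p)) := by unfold Core.Ok; infer_instance
instance : Ev (fun p => (g p).core.nd (a p) (b p) (c p)) := by unfold Core.nd; infer_instance
instance : Ev (fun p => (g p).core.nxt (a p) (b p)) := by unfold Core.nxt; infer_instance
instance : EvP (fun p => (g p).core.Fin (a p)) := by unfold Core.Fin; infer_instance
instance : EvP (fun p => (g p).core.Allowed (a p)) := by unfold Core.Allowed; infer_instance
instance : Ev (fun p => (g p).core.hd ((g p).core.X (a p)) ((g p).core.X (b p))) := by
  unfold Core.hd; infer_instance
instance : Ev (fun p => (g p).core.rest (a p)) := by unfold Core.rest; infer_instance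
instance : EvP (fun p => (g p).core.Init (a p)) := by unfold Core.Init; infer_instance
instance : Ev (fun p => (g p).core.score (a p)) := by unfold Core.score; infer_instance
instance (i : ℕ) : Ev (fun p => (g p).core.accStep ((g p).arr i) (a p)) := by
  unfold Core.accStep; infer_instance
instance (i : ℕ) : Ev (fun p => (g p).core.pick ((g p).arr i) (a p)) := by
  unfold Core.pick; infer_instance
instance (i : ℕ) : Ev (fun p => (g p).core.best ((g p).arr i)) := by
  unfold Core.best; infer_instance

end Instances

/-! ### One round of the search -/

theorem Mem.tabUpTo_arr (m : Mem) (a : ℕ) (f : Mem → ℕ → ℕ) (k a' i : ℕ) :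
    (m.tabUpTo a f k).arr a' i
      = if a' = a ∧ i < k then cap m.D (f (m.tabUpTo a f i) i) else m.arr a' i := by
  induction k with
  | zero => simp [Mem.tabUpTo]
  | succ k ih =>
    simp only [Mem.tabUpTo, Mem.store]
    by_cases ha : a' = a
    · subst ha
      rw [Function.update_self]
      by_cases hi : i = k
      · subst hi
        rw [Function.update_self, if_pos ⟨rfl, by omega⟩, (m.tabUpTo_C a' f i).2]
      · rw [Function.update_of_ne hi, ih]
        by_cases hik : i < k
        · rw [if_pos ⟨rfl, hik⟩, if_pos ⟨rfl, by omega⟩]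
        · rw [if_neg (by omega), if_neg (by omega)]
    · rw [Function.update_of_ne ha, ih, if_neg (by tauto), if_neg (by tauto)]

theorem Mem.tabUpTo_arr_ne (m : Mem) {a a' : ℕ} (f : Mem → ℕ → ℕ) (k : ℕ) (h : a' ≠ a) :
    (m.tabUpTo a f k).arr a' = m.arr a' :=
  funext fun i => by rw [m.tabUpTo_arr, if_neg (by tauto)]

theorem Mem.tabUpTo_arr_of_le (m : Mem) (a : ℕ) (f : Mem → ℕ → ℕ) {k i : ℕ} (h : k ≤ i) :
    (m.tabUpTo a f k).arr a i = m.arr a i := by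
  rw [m.tabUpTo_arr, if_neg (by omega)]

theorem Mem.tabUpTo_arr_of_lt (m : Mem) (a : ℕ) (f : Mem → ℕ → ℕ) {k i : ℕ} (h : i < k)
    (hk : k ≤ m.C) : (m.tabUpTo a f k).arr a i = (m.tab a f).arr a i := by
  rw [m.tabUpTo_arr, if_pos ⟨rfl, h⟩, Mem.tab, m.tabUpTo_arr, if_pos ⟨rfl, by omega⟩]

theorem Mem.tab_C (m : Mem) (a : ℕ) (f : Mem → ℕ → ℕ) : (m.tab a f).C = m.C :=
  (m.tabUpTo_C a f _).1

theorem Mem.tab_D (m : Mem) (a : ℕ) (f : Mem → ℕ → ℕ) : (m.tab a f).D = m.D :=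
  (m.tabUpTo_C a f _).2

theorem Mem.tab_arr_ne (m : Mem) {a a' : ℕ} (f : Mem → ℕ → ℕ) (h : a' ≠ a) :
    (m.tab a f).arr a' = m.arr a' :=
  m.tabUpTo_arr_ne f _ h

theorem Mem.tab_arr (m : Mem) (a : ℕ) (f : Mem → ℕ → ℕ) {i : ℕ} (h : i < m.C) :
    (m.tab a f).arr a i = cap m.D (f (m.tabUpTo a f i) i) := by
  rw [Mem.tab, m.tabUpTo_arr, if_pos ⟨rfl, h⟩]

theorem Mem.tab_arr_of_lt (m : Mem) (a : ℕ) (f : Mem → ℕ → ℕ) {i : ℕ} (h : i < m.C)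
    (hD : f (m.tabUpTo a f i) i < m.D) : (m.tab a f).arr a i = f (m.tabUpTo a f i) i := by
  rw [m.tab_arr a f h, cap_of_lt hD]

theorem cap_lt {D v : ℕ} (h : 0 < D) : cap D v < D := by
  unfold cap; split <;> omega

/-- Memories with the same data of the search. -/
theorem Mem.core_congr {m m' : Mem} (hC : m'.C = m.C)
    (h : ∀ a, (2 ≤ a ∧ a ≤ 8) ∨ a = 13 → m'.arr a = m.arr a) : m'.core = m.core := by
  simp only [Mem.core, hC, h 2 (by omega), h 3 (by omega), h 4 (by omega), h 5 (by omega),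
    h 6 (by omega), h 7 (by omega), h 8 (by omega), h 13 (by omega)]

theorem Mem.core_tabUpTo {m : Mem} {a : ℕ} (ha : 9 ≤ a ∧ a ≤ 12) (f : Mem → ℕ → ℕ) (k : ℕ) :
    (m.tabUpTo a f k).core = m.core :=
  Mem.core_congr (m.tabUpTo_C a f k).1 fun _ _ => m.tabUpTo_arr_ne f k (by omega)

theorem Mem.core_tab {m : Mem} {a : ℕ} (ha : 9 ≤ a ∧ a ≤ 12) (f : Mem → ℕ → ℕ) :
    (m.tab a f).core = m.core := Mem.core_tabUpTo ha f _

/-- The table of the configurations from which a final one can be reached. -/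
noncomputable def Mem.tabAcc (m : Mem) : Mem :=
  m.tab 9 fun m c => m.core.accStep (m.arr 9) c

/-- The table of the configurations of the run of the search from the best start. -/
noncomputable def Mem.tabRun (m : Mem) : Mem :=
  m.tab 10 fun m t => if t = 0 then m.core.best (m.arr 9) else
    m.core.nxt (m.arr 10 (t - 1)) (m.core.pick (m.arr 9) (m.arr 10 (t - 1)))

/-- The mark whether the search succeeds. -/
noncomputable def Mem.tabFound (m : Mem) : Mem :=
  m.tab 12 fun m _ => if m.core.best (m.arr 9) < m.C then 1 else 0

/-- The table of the symbols of the new strings. -/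
noncomputable def Mem.tabNew (m : Mem) : Mem :=
  m.tab 11 fun m q =>
    m.core.chr (m.core.pick (m.arr 9) (m.arr 10 (q % m.core.M))) (q / m.core.M)

/-- The table of the symbols of all strings after the replacement. -/
noncomputable def Mem.tabReplace (m : Mem) : Mem :=
  m.tab 8 fun m q =>
    if m.arr 12 0 ≠ 0 ∧ m.core.idx (m.arr 10 0) ≤ q / m.core.M ∧
      q / m.core.M < m.core.idx (m.arr 10 0) + m.core.p
    then m.arr 11 ((q / m.core.M - m.core.idx (m.arr 10 0)) * m.core.M + q % m.core.M)
    else m.arr 8 q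

/-- The number of strings after the replacement. -/
noncomputable def Mem.tabCount (m : Mem) : Mem :=
  m.tab 13 fun m _ =>
    if m.arr 12 0 ≠ 0 then min m.core.K (m.core.kk + m.arr 2 6) else m.core.kk

/-- One round of greedy choice or local search. -/
noncomputable def Mem.searchRound (m : Mem) : Mem :=
  m.tabAcc.tabRun.tabFound.tabNew.tabReplace.tabCount

theorem isProg_searchRound : IsProg Mem.searchRound := by
  refine IsProg.comp (F := fun m => m.tabAcc.tabRun.tabFound.tabNew.tabReplace) (G := Mem.tabCount)
    (IsProg.comp (F := fun m => m.tabAcc.tabRun.tabFound.tabNew) (G := Mem.tabReplace)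
    (IsProg.comp (F := fun m => m.tabAcc.tabRun.tabFound) (G := Mem.tabNew)
    (IsProg.comp (F := fun m => m.tabAcc.tabRun) (G := Mem.tabFound)
    (IsProg.comp (F := Mem.tabAcc) (G := Mem.tabRun) ?_ ?_) ?_) ?_) ?_) ?_
  · exact IsProg.tab 9 _
  · exact IsProg.tab 10 _
  · exact IsProg.tab 12 _
  · exact IsProg.tab 11 _
  · exact IsProg.tab 8 _
  · exact IsProg.tab 13 _

/-- Since the codes of configurations decrease along actions, the entries needed for `c` have been
written before. -/
theorem Mem.tabAcc_spec {m : Mem} (h1 : 1 < m.D) : ∀ c < m.C,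
    m.tabAcc.arr 9 c ≠ 0 ↔ m.core.Acc c := by
  intro c
  induction c using Nat.strong_induction_on with
  | _ c ih =>
    intro hc
    have hval : m.tabAcc.arr 9 c = cap m.D (m.core.accStep (fun c' =>
        (m.tabUpTo 9 (fun m c => m.core.accStep (m.arr 9) c) c).arr 9 c') c) := by
      rw [Mem.tabAcc, m.tab_arr 9 _ hc, Mem.core_tabUpTo (by omega)]
    have hprev : ∀ c' < c, (m.tabUpTo 9 (fun m c => m.core.accStep (m.arr 9) c) c).arr 9 c' ≠ 0 ↔
        m.core.Acc c' := fun c' hc' => by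
      rw [m.tabUpTo_arr_of_lt 9 _ hc' hc.le]
      exact ih c' hc' (by omega)
    have hiff : (m.core.Fin c ∨ ∃ a, a < m.core.C ∧ (m.core.Ok c a ∧ m.core.nxt c a < c ∧
        (m.tabUpTo 9 (fun m c => m.core.accStep (m.arr 9) c) c).arr 9 (m.core.nxt c a) ≠ 0)) ↔
        m.core.Acc c := by
      constructor
      · rintro (h | ⟨a, h1, h2, h3, h4⟩)
        · exact .fin h
        · exact .step h1 h2 h3 ((hprev _ h3).1 h4)
      · rintro (h | ⟨h1, h2, h3, h4⟩)
        · exact Or.inl h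
        · exact Or.inr ⟨_, h1, h2, h3, (hprev _ h3).2 h4⟩
    rw [hval, ← hiff, Core.accStep]
    split
    · rename_i h
      rw [cap_of_lt h1]
      exact iff_of_true one_ne_zero h
    · rename_i h
      rw [cap_of_lt (by omega)]
      exact iff_of_false (fun h => h rfl) h

theorem Mem.tabRun_spec {m : Mem} (hCD : m.C ≤ m.D) :
    (0 < m.C → m.core.best (m.arr 9) < m.C → m.tabRun.arr 10 0 = m.core.best (m.arr 9)) ∧
    ∀ t, t + 1 < m.C → m.core.nxt (m.tabRun.arr 10 t)
      (m.core.pick (m.arr 9) (m.tabRun.arr 10 t)) < m.C →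
      m.tabRun.arr 10 (t + 1) = m.core.nxt (m.tabRun.arr 10 t)
        (m.core.pick (m.arr 9) (m.tabRun.arr 10 t)) := by
  unfold Mem.tabRun
  set f : Mem → ℕ → ℕ := fun m t => if t = 0 then m.core.best (m.arr 9) else
    m.core.nxt (m.arr 10 (t - 1)) (m.core.pick (m.arr 9) (m.arr 10 (t - 1))) with hf
  constructor
  · intro hC hlt
    exact m.tab_arr_of_lt 10 f hC (hlt.trans_le hCD)
  · intro t ht hlt
    have hval : f (m.tabUpTo 10 f (t + 1)) (t + 1) = m.core.nxt ((m.tab 10 f).arr 10 t)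
        (m.core.pick (m.arr 9) ((m.tab 10 f).arr 10 t)) := by
      simp only [hf]
      rw [if_neg (by omega), Nat.add_sub_cancel, Mem.core_tabUpTo (by omega),
        m.tabUpTo_arr_ne _ _ (by omega : 9 ≠ 10), m.tabUpTo_arr_of_lt 10 _ (by omega) ht.le]
    rw [m.tab_arr_of_lt 10 f ht (by rw [hval]; omega), hval]

set_option maxHeartbeats 1000000 in
/-- A round of the search replaces or adds strings as described by `Core.Outcome` and leaves the
automaton and the parameters alone. -/
theorem Mem.searchRound_spec {m : Mem} (hE : m.core.WF) (hCD : m.C ≤ m.D)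
    (hlab : ∀ e < m.core.M, m.core.lab e < m.D) (hX : ∀ q < m.C, m.arr 8 q < m.D) :
    m.searchRound.C = m.C ∧ m.searchRound.D = m.D ∧ (∀ a < 8, m.searchRound.arr a = m.arr a) ∧
    (∀ q < m.C, m.searchRound.arr 8 q < m.D) ∧
    m.core.Outcome (m.arr 2 6) (m.searchRound.arr 12 0 ≠ 0) m.searchRound.core.kk
      m.searchRound.core.X := by
  have hM1 := hE.one_lt_M
  have hM2 : m.core.M * m.core.M ≤ m.C := by
    refine le_trans ?_ hE.pow_le
    rw [← pow_two]
    exact Nat.pow_le_pow_right (by omega) (by rw [hE.L_eq]; omega)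
  have hMC : m.core.M < m.C := by nlinarith
  have hr := hE.r_lt
  have hK := hE.K_lt
  set m₁ := m.tabAcc with hm₁
  set m₂ := m₁.tabRun with hm₂
  set m₃ := m₂.tabFound with hm₃
  set m₄ := m₃.tabNew with hm₄
  set m₅ := m₄.tabReplace with hm₅
  have hm₆ : m.searchRound = m₅.tabCount := rfl
  have c₁ : m₁.core = m.core := Mem.core_tab (by omega) _
  have c₂ : m₂.core = m.core := (Mem.core_tab (by omega) _).trans c₁
  have c₃ : m₃.core = m.core := (Mem.core_tab (by omega) _).trans c₂
  have c₄ : m₄.core = m.core := (Mem.core_tab (by omega) _).trans c₃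
  have C₁ : m₁.C = m.C := m.tab_C _ _
  have C₂ : m₂.C = m.C := (m₁.tab_C _ _).trans C₁
  have C₃ : m₃.C = m.C := (m₂.tab_C _ _).trans C₂
  have C₄ : m₄.C = m.C := (m₃.tab_C _ _).trans C₃
  have C₅ : m₅.C = m.C := (m₄.tab_C _ _).trans C₄
  have C₆ : m.searchRound.C = m.C := (m₅.tab_C _ _).trans C₅
  have D₁ : m₁.D = m.D := m.tab_D _ _
  have D₂ : m₂.D = m.D := (m₁.tab_D _ _).trans D₁
  have D₃ : m₃.D = m.D := (m₂.tab_D _ _).trans D₂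
  have D₄ : m₄.D = m.D := (m₃.tab_D _ _).trans D₃
  have D₅ : m₅.D = m.D := (m₄.tab_D _ _).trans D₄
  have D₆ : m.searchRound.D = m.D := (m₅.tab_D _ _).trans D₅
  have n₁ : ∀ a, a ≠ 9 → m₁.arr a = m.arr a := fun a h => m.tab_arr_ne _ h
  have n₂ : ∀ a, a ≠ 10 → m₂.arr a = m₁.arr a := fun a h => m₁.tab_arr_ne _ h
  have n₃ : ∀ a, a ≠ 12 → m₃.arr a = m₂.arr a := fun a h => m₂.tab_arr_ne _ h
  have n₄ : ∀ a, a ≠ 11 → m₄.arr a = m₃.arr a := fun a h => m₃.tab_arr_ne _ h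
  have n₅ : ∀ a, a ≠ 8 → m₅.arr a = m₄.arr a := fun a h => m₄.tab_arr_ne _ h
  have n₆ : ∀ a, a ≠ 13 → m.searchRound.arr a = m₅.arr a := fun a h => m₅.tab_arr_ne _ h
  set g := m₁.arr 9 with hg
  set cs := m₂.arr 10 with hcs
  have hgacc : ∀ c < m.core.C, g c ≠ 0 ↔ m.core.Acc c := Mem.tabAcc_spec (by omega)
  obtain ⟨hr0, hr1⟩ := Mem.tabRun_spec (m := m₁) (by omega)
  rw [← hm₂, ← hcs, c₁, C₁, ← hg] at hr0 hr1
  obtain ⟨s1, s2⟩ := Core.search_spec hE hgacc (cs := cs) (hr0 (by omega))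
    fun t ht => hr1 t (by omega)
  have hg₂ : m₂.arr 9 = g := n₂ 9 (by omega)
  have hfound : m₃.arr 12 0 = if m.core.best g < m.C then 1 else 0 := by
    rw [hm₃, Mem.tabFound, m₂.tab_arr_of_lt 12 _ (by omega)]
    · rw [Mem.core_tabUpTo (by omega), m₂.tabUpTo_arr_ne _ _ (by omega : 9 ≠ 12), c₂, hg₂,
        (m₂.tabUpTo_C _ _ _).1, C₂]
    · split <;> omega
  have hf₄ : m₄.arr 12 0 = m₃.arr 12 0 := by rw [n₄ 12 (by omega)]
  have hf₅ : m₅.arr 12 0 = m₃.arr 12 0 := by rw [n₅ 12 (by omega), hf₄]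
  have hf₆ : m.searchRound.arr 12 0 = m₃.arr 12 0 := by rw [n₆ 12 (by omega), hf₅]
  have hfiff : m₃.arr 12 0 ≠ 0 ↔ m.core.best g < m.C := by
    rw [hfound]; split <;> simp_all
  have hnew : ∀ q < m.C, m₄.arr 11 q
      = m.core.chr (m.core.pick g (cs (q % m.core.M))) (q / m.core.M) := by
    intro q hq
    have e9 : m₃.arr 9 = g := by rw [n₃ 9 (by omega), hg₂]
    have e10 : m₃.arr 10 = cs := n₃ 10 (by omega)
    rw [hm₄, Mem.tabNew, m₃.tab_arr_of_lt 11 _ (by omega)]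
    · rw [Mem.core_tabUpTo (by omega), m₃.tabUpTo_arr_ne _ _ (by omega : 9 ≠ 11),
        m₃.tabUpTo_arr_ne _ _ (by omega : 10 ≠ 11), c₃, e9, e10]
    · rw [Mem.core_tabUpTo (by omega), c₃, D₃]
      exact hlab _ (Core.dg_lt hE _ _)
  have hrep : ∀ q < m.C, m₅.arr 8 q
      = if m₃.arr 12 0 ≠ 0 ∧ m.core.idx (cs 0) ≤ q / m.core.M ∧
          q / m.core.M < m.core.idx (cs 0) + m.core.p
        then cap m.D (m₄.arr 11 ((q / m.core.M - m.core.idx (cs 0)) * m.core.M + q % m.core.M))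
        else m.arr 8 q := by
    intro q hq
    have e10 : m₄.arr 10 = cs := by rw [n₄ 10 (by omega), n₃ 10 (by omega)]
    have e8 : m₄.arr 8 = m.arr 8 := by
      rw [n₄ 8 (by omega), n₃ 8 (by omega), n₂ 8 (by omega), n₁ 8 (by omega)]
    rw [hm₅, Mem.tabReplace, m₄.tab_arr 8 _ (by omega), D₄]
    set u := m₄.tabUpTo 8 _ q with hu
    have uM : u.core.M = m.core.M := by
      rw [← c₄]
      simp only [Mem.core, hu, (m₄.tabUpTo_C _ _ _).1, m₄.tabUpTo_arr_ne _ _ (by omega : 2 ≠ 8)]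
    have up : u.core.p = m.core.p := by
      rw [← c₄]
      simp only [Mem.core, hu, (m₄.tabUpTo_C _ _ _).1, m₄.tabUpTo_arr_ne _ _ (by omega : 2 ≠ 8)]
    have u10 : u.arr 10 = cs := by rw [hu, m₄.tabUpTo_arr_ne _ _ (by omega : 10 ≠ 8), e10]
    have u11 : u.arr 11 = m₄.arr 11 := m₄.tabUpTo_arr_ne _ _ (by omega)
    have u12 : u.arr 12 = m₄.arr 12 := m₄.tabUpTo_arr_ne _ _ (by omega)
    have u8 : u.arr 8 q = m.arr 8 q := by rw [hu, m₄.tabUpTo_arr_of_le _ _ le_rfl, e8]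
    have uidx : ∀ c, u.core.idx c = m.core.idx c := by
      intro c
      have upw : u.core.pw = m.core.pw := by
        rw [← c₄]
        exact m₄.tabUpTo_arr_ne _ _ (by omega)
      rw [Core.idx, Core.idx, Core.dg, Core.dg, uM, upw]
    rw [u12, hf₄, u10, uidx, uM, up, u11, u8]
    split
    · rfl
    · exact cap_of_lt (hX q hq)
  have c₅ : m₅.core.kk = m.core.kk ∧ m₅.core.K = m.core.K := by
    rw [← c₄]
    simp only [Mem.core, C₅, C₄, n₅ 13 (by omega), n₅ 2 (by omega), and_self]
  have e2 : m₅.arr 2 = m.arr 2 := by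
    rw [n₅ 2 (by omega), n₄ 2 (by omega), n₃ 2 (by omega), n₂ 2 (by omega), n₁ 2 (by omega)]
  have hkkK := hE.kk_le
  have hcount : m.searchRound.arr 13 0
      = if m₃.arr 12 0 ≠ 0 then min m.core.K (m.core.kk + m.arr 2 6) else m.core.kk := by
    rw [hm₆, Mem.tabCount, m₅.tab_arr_of_lt 13 _ (by omega)]
    · change (if m₅.arr 12 0 ≠ 0 then min m₅.core.K (m₅.core.kk + m₅.arr 2 6) else m₅.core.kk) = _
      rw [hf₅, c₅.1, c₅.2, e2]
    · change (if m₅.arr 12 0 ≠ 0 then min m₅.core.K (m₅.core.kk + m₅.arr 2 6) else m₅.core.kk) < _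
      rw [c₅.1, c₅.2, D₅]
      split <;> omega
  have hkk' : m.searchRound.core.kk = m.searchRound.arr 13 0 := by
    change min _ m.searchRound.C = _
    rw [hcount, C₆]
    split <;> omega
  have a8 : ∀ a < 8, m.searchRound.arr a = m.arr a := fun a ha => by
    rw [n₆ a (by omega), n₅ a (by omega), n₄ a (by omega), n₃ a (by omega), n₂ a (by omega),
      n₁ a (by omega)]
  have hXX : m.searchRound.core.X = fun j x => m₅.arr 8 (j * m.core.M + x) := by
    funext j x
    change m.searchRound.arr 8 (j * min (m.searchRound.arr 2 0) m.searchRound.C + x) = _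
    rw [n₆ 8 (by omega), a8 2 (by omega), C₆]
    rfl
  have hq : ∀ j ≤ m.core.K, ∀ x < m.core.r, j * m.core.M + x < m.C ∧
      (j * m.core.M + x) / m.core.M = j ∧ (j * m.core.M + x) % m.core.M = x := by
    intro j hj x hx
    refine ⟨?_, ?_, ?_⟩
    · have : (j + 1) * m.core.M ≤ m.core.M * m.core.M := Nat.mul_le_mul_right _ (by omega)
      nlinarith
    · rw [add_comm, Nat.add_mul_div_right _ _ (by omega), Nat.div_eq_of_lt (by omega), zero_add]
    · rw [add_comm, Nat.add_mul_mod_self_right, Nat.mod_eq_of_lt (by omega)]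
  refine ⟨C₆, D₆, a8, ?_, ⟨?_, ?_, ?_⟩⟩
  · intro q hq
    rw [n₆ 8 (by omega), hrep q hq]
    split
    · exact cap_lt (by omega)
    · exact hX q hq
  · rw [hf₆, hfiff]
    refine ⟨fun h => ⟨_, _, (s2 h).1⟩, s1⟩
  · intro h
    rw [hf₆] at h
    refine ⟨by rw [hkk', hcount, if_neg h], fun j hj x hx => ?_⟩
    obtain ⟨q1, -, -⟩ := hq j hj.le x hx
    rw [hXX]
    change m₅.arr 8 (j * m.core.M + x) = m.arr 8 (j * m.core.M + x)
    rw [hrep _ q1, if_neg fun h' => h h'.1]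
  · intro h
    rw [hf₆] at h
    obtain ⟨t1, t2⟩ := s2 (hfiff.1 h)
    refine ⟨by rw [hkk', hcount, if_pos h], _, _, t1, t2, fun j hj x hx => ?_⟩
    obtain ⟨q1, q2, q3⟩ := hq j hj.le x hx
    rw [hXX]
    change m₅.arr 8 (j * m.core.M + x) = _
    rw [hrep _ q1, q2, q3]
    by_cases hij : m.core.idx (cs 0) ≤ j ∧ j < m.core.idx (cs 0) + m.core.p
    · obtain ⟨q1', q2', q3'⟩ := hq (j - m.core.idx (cs 0)) (by omega) x hx
      rw [if_pos ⟨h, hij.1, hij.2⟩, if_pos hij, hnew _ q1', q2', q3']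
      exact cap_of_lt (hlab _ (Core.dg_lt hE _ _))
    · rw [if_neg fun h' => hij h'.2, if_neg hij]
      rfl

/-! ### All rounds of the search -/

theorem Core.WF.withOld {E : Core} (hE : E.WF) {kk : ℕ} (X : ℕ → ℕ → ℕ) (hkk : kk ≤ E.K)
    (h : E.p * (kk * E.r) < E.M) : (E.withOld kk X).WF where
  pw_eq := hE.pw_eq
  L_eq := hE.L_eq
  pow_le := hE.pow_le
  one_lt_M := hE.one_lt_M
  one_le_p := hE.one_le_p
  r_lt := hE.r_lt
  K_lt := hE.K_lt
  kk_le := hkk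
  tgt_lt := hE.tgt_lt
  s_lt := hE.s_lt
  cross_lt := h

/-- All rounds of the search. -/
noncomputable def Mem.searchAll (m : Mem) : Mem := Mem.searchRound^[m.C] m

/-- The search has found `K` strings. -/
def Mem.Success (m : Mem) : Prop :=
  (m.arr 2 6 = 1 ∧ m.core.kk = m.core.K) ∨ (m.arr 2 6 ≠ 1 ∧ m.arr 12 0 ≠ 0)

/-- The numbers that control the search fit together: either the strings are chosen one by one, and
their number `K` is at least `4 / ε` where `ε = a / b`, or they are searched for all at once. -/
def Mem.Mode (m : Mem) (a b : ℕ) : Prop :=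
  (m.core.p = 1 ∧ m.arr 2 6 = 1 ∧ m.core.K * m.core.r < m.core.M ∧ 4 * b ≤ m.core.K * a) ∨
    (m.core.p = m.core.K ∧ m.arr 2 6 = 0)

/-- The factor `(K - 1) / (K + 3)` of local search is at least `1 - a / b` if `K ≥ 4 * b / a`. -/
theorem Mem.searchAll_spec {m : Mem} (hE : m.core.WF) (h0 : m.core.kk = 0) (hK : 1 ≤ m.core.K)
    (hCD : m.C ≤ m.D) (hlab : ∀ e < m.core.M, m.core.lab e < m.D)
    (hX : ∀ q < m.C, m.arr 8 q < m.D) {a b : ℕ} (hmode : m.Mode a b) :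
    m.searchAll.C = m.C ∧ m.searchAll.D = m.D ∧
    m.searchAll.core = m.core.withOld m.searchAll.core.kk m.searchAll.core.X ∧
    (∀ q < m.C, m.searchAll.arr 8 q < m.D) ∧
    (m.searchAll.Success → m.core.Valid m.core.K m.searchAll.core.X) ∧
    ∀ Y, m.core.Valid m.core.K Y → m.searchAll.Success ∧
      b * m.core.div₂ m.core.K Y
        ≤ b * m.core.div₂ m.core.K m.searchAll.core.X + a * m.core.div₂ m.core.K Y := by
  have hM1 := hE.one_lt_M
  let u : ℕ → Mem := fun t => Mem.searchRound^[t] m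
  have hu : ∀ t, u (t + 1) = (u t).searchRound := fun t => Function.iterate_succ_apply' _ _ _
  let Inv : ℕ → Prop := fun t => ((u t).C = m.C ∧ (u t).D = m.D ∧
    (∀ i < 8, (u t).arr i = m.arr i) ∧ ∀ q < m.C, (u t).arr 8 q < m.D) ∧
    (u t).core.kk ≤ m.core.K ∧ (m.arr 2 6 = 0 → (u t).core.kk = 0)
  have hcore : ∀ t, Inv t → (u t).core = m.core.withOld (u t).core.kk (u t).core.X := by
    rintro t ⟨⟨i1, i2, i3, i4⟩, i5, i6⟩
    simp only [Core.withOld, Mem.core, i1, i3 2 (by omega), i3 3 (by omega), i3 4 (by omega),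
      i3 5 (by omega), i3 6 (by omega), i3 7 (by omega)]
  have hround : ∀ t, Inv t → (u (t + 1)).C = m.C ∧ (u (t + 1)).D = m.D ∧
      (∀ i < 8, (u (t + 1)).arr i = m.arr i) ∧ (∀ q < m.C, (u (t + 1)).arr 8 q < m.D) ∧
      (m.core.withOld (u t).core.kk (u t).core.X).Outcome (m.arr 2 6)
        ((u (t + 1)).arr 12 0 ≠ 0) (u (t + 1)).core.kk (u (t + 1)).core.X := by
    intro t ht
    have hc := hcore t ht
    obtain ⟨⟨i1, i2, i3, i4⟩, i5, i6⟩ := ht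
    have hwf : (u t).core.WF := by
      rw [hc]
      refine hE.withOld _ i5 ?_
      rcases hmode with ⟨h1, h2, h3, -⟩ | ⟨h1, h2⟩
      · rw [h1, one_mul]
        exact (Nat.mul_le_mul_right _ i5).trans_lt h3
      · rw [i6 h2]
        simp
        omega
    have hl : ∀ e < (u t).core.M, (u t).core.lab e < (u t).D := by
      rw [hc, i2]
      exact hlab
    obtain ⟨s1, s2, s3, s4, s5⟩ := Mem.searchRound_spec hwf (by rw [i1, i2]; exact hCD) hl
      (by rw [i1, i2]; exact i4)
    rw [← hu] at s1 s2 s3 s4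
    rw [i1, i2] at s4
    rw [i3 2 (by omega), ← hu, hc] at s5
    exact ⟨s1.trans i1, s2.trans i2, fun i hi => (s3 i hi).trans (i3 i hi), s4, s5⟩
  have hinv : ∀ t, Inv t := by
    intro t
    induction t with
    | zero => exact ⟨⟨rfl, rfl, fun _ _ => rfl, hX⟩, by change m.core.kk ≤ _; omega, fun _ => h0⟩
    | succ t ih =>
      obtain ⟨s1, s2, s3, s4, s5⟩ := hround t ih
      refine ⟨⟨s1, s2, s3, s4⟩, ?_, fun h2 => ?_⟩
      · by_cases hf : (u (t + 1)).arr 12 0 ≠ 0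
        · exact (s5.of_found hf).1.trans_le (min_le_left _ _)
        · exact (s5.of_not_found hf).1.trans_le ih.2.1
      · by_cases hf : (u (t + 1)).arr 12 0 ≠ 0
        · rw [(s5.of_found hf).1, h2]
          change min _ ((u t).core.kk + 0) = 0
          rw [ih.2.2 h2]
          omega
        · exact (s5.of_not_found hf).1.trans (ih.2.2 h2)
  have hstep := fun t => (hround t (hinv t)).2.2.2.2
  obtain ⟨⟨i1, i2, i3, i4⟩, i5, i6⟩ := hinv m.C
  have hKC : (u m.C).core.K = m.core.K := by rw [hcore _ (hinv _)]; rfl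
  refine ⟨i1, i2, hcore m.C (hinv _), i4, ?_⟩
  change ((u m.C).Success → m.core.Valid m.core.K (u m.C).core.X) ∧
    ∀ Y, m.core.Valid m.core.K Y → (u m.C).Success ∧
      b * m.core.div₂ m.core.K Y
        ≤ b * m.core.div₂ m.core.K (u m.C).core.X + a * m.core.div₂ m.core.K Y
  have hC : m.core.K + m.core.K * m.core.K * m.core.r + 1 ≤ m.C := by
    have h1 : m.core.M ^ 4 ≤ m.C := by
      refine le_trans ?_ hE.pow_le
      exact Nat.pow_le_pow_right (by omega) (by rw [hE.L_eq]; have := hE.one_le_p; omega)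
    have h2 : m.core.K * m.core.K * m.core.r ≤ m.core.M * m.core.M * m.core.M :=
      Nat.mul_le_mul (Nat.mul_le_mul hE.K_lt.le hE.K_lt.le) hE.r_lt.le
    have h3 : m.core.M ^ 4 = m.core.M * (m.core.M * m.core.M * m.core.M) := by ring
    have h4 : m.core.M ≤ m.core.M * m.core.M * m.core.M := by nlinarith
    have h5 := hE.K_lt
    nlinarith
  rcases hmode with ⟨h1, h2, h3, h4⟩ | ⟨h1, h2⟩
  · rw [h2] at hstep
    obtain ⟨r1, r2⟩ := Core.local_search m.core h1 (kk := fun t => (u t).core.kk)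
      (X := fun t => (u t).core.X) (found := fun t => (u (t + 1)).arr 12 0 ≠ 0) h0 hstep hC
    have hsucc : (u m.C).Success ↔ (u m.C).core.kk = m.core.K := by
      rw [Mem.Success, i3 2 (by omega), h2, hKC]
      simp
    rw [hsucc]
    refine ⟨r1, fun Y hY => ?_⟩
    obtain ⟨r3, r4⟩ := r2 Y hY
    refine ⟨r3, ?_⟩
    by_contra hlt
    push Not at hlt
    set x := m.core.div₂ m.core.K (u m.C).core.X
    set y := m.core.div₂ m.core.K Y
    set K := m.core.K
    have e1 : (K + 3) * (b * x + a * y) < (K + 3) * (b * y) :=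
      Nat.mul_lt_mul_of_pos_left hlt (by omega)
    have e2 := Nat.mul_le_mul_left b r4
    have e3 := Nat.mul_le_mul_right y h4
    nlinarith
  · rw [h2] at hstep
    obtain ⟨T, hT⟩ : ∃ T, m.C = T + 1 := ⟨m.C - 1, by omega⟩
    have hs := hstep T
    rw [← hT] at hs
    obtain ⟨r1, r2, r3⟩ := Core.exhaustive_search
      (E := m.core.withOld (u T).core.kk (u T).core.X) h1 hK ((hinv T).2.2 h2) hs
    have hsucc : (u m.C).Success ↔ (u m.C).arr 12 0 ≠ 0 := by
      rw [Mem.Success, i3 2 (by omega), h2]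
      simp
    rw [hsucc]
    refine ⟨fun h => Core.valid_withOld.1 (r2 h), fun Y hY => ?_⟩
    obtain ⟨r4, r5⟩ := r3 Y (Core.valid_withOld.2 hY)
    exact ⟨r4, (Nat.mul_le_mul_left b r5).trans (Nat.le_add_right _ _)⟩

instance {α : Type} [Ctx α] {g : α → Mem} [IsMem g] : EvP (fun p => (g p).Success) := by
  unfold Mem.Success; infer_instance

open Classical in
/-- The output: `1` and the strings found, or `0`. -/
noncomputable def Mem.tabOut (m : Mem) : Mem :=
  m.tab 1 fun m q => if m.Success then
    (if q = 0 then 1 else m.core.X ((q - 1) / m.core.r) ((q - 1) % m.core.r)) else 0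

theorem Mem.tabOut_spec {m : Mem} (hD : 1 < m.D) (hX : ∀ q < m.C, m.arr 8 q < m.D)
    (hr : m.core.r < m.core.M) (hM : m.core.K * m.core.M < m.C) :
    (m.Success → m.tabOut.arr 1 0 = 1 ∧ ∀ j < m.core.K, ∀ x < m.core.r,
      m.tabOut.arr 1 (1 + (j * m.core.r + x)) = m.core.X j x) ∧
    (¬ m.Success → m.tabOut.arr 1 0 = 0) := by
  classical
  have hval : ∀ q < m.C, m.tabOut.arr 1 q = cap m.D (if m.Success then
      (if q = 0 then 1 else m.core.X ((q - 1) / m.core.r) ((q - 1) % m.core.r)) else 0) := by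
    intro q hq
    rw [Mem.tabOut, m.tab_arr 1 _ hq]
    have h1 := (m.tabUpTo_C 1 (fun m q => if m.Success then
      (if q = 0 then 1 else m.core.X ((q - 1) / m.core.r) ((q - 1) % m.core.r)) else 0) q).1
    have h2 : ∀ i, i ≠ 1 → (m.tabUpTo 1 (fun m q => if m.Success then
      (if q = 0 then 1 else m.core.X ((q - 1) / m.core.r) ((q - 1) % m.core.r)) else 0) q).arr i
        = m.arr i := fun i hi => m.tabUpTo_arr_ne _ _ hi
    rw [Mem.core_congr h1 fun i hi => h2 i (by omega), Mem.Success, h2 2 (by omega),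
      h2 12 (by omega), Mem.core_congr h1 fun i hi => h2 i (by omega)]
    rfl
  refine ⟨fun hs => ⟨?_, fun j hj x hx => ?_⟩, fun hs => ?_⟩
  · rw [hval 0 (by omega), if_pos hs, if_pos rfl, cap_of_lt hD]
  · have h1 : (j + 1) * m.core.M ≤ m.core.K * m.core.M := Nat.mul_le_mul_right _ hj
    have h2 : j * m.core.r ≤ j * m.core.M := Nat.mul_le_mul_left _ hr.le
    have h3 : (j + 1) * m.core.M = j * m.core.M + m.core.M := by ring
    rw [hval _ (by omega), if_pos hs, if_neg (by omega), Nat.add_sub_cancel_left]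
    have e1 : (j * m.core.r + x) / m.core.r = j := by
      rw [add_comm, Nat.add_mul_div_right _ _ (by omega), Nat.div_eq_of_lt hx, zero_add]
    have e2 : (j * m.core.r + x) % m.core.r = x := by
      rw [add_comm, Nat.add_mul_mod_self_right, Nat.mod_eq_of_lt hx]
    rw [e1, e2]
    refine cap_of_lt (hX _ ?_)
    change j * m.core.M + x < m.C
    omega
  · have hpos : 0 < m.C := by omega
    rw [hval 0 hpos, if_neg hs, cap_of_lt (by omega)]

/-! ### The parameters of the search -/

section Params

variable (e : ℕ) (B s r : Mem → ℕ)

/-- The powers of `B`. -/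
noncomputable def Mem.tabPow (m : Mem) : Mem :=
  m.tab 14 fun m x => if x = 0 then 1 else m.arr 14 (x - 1) * B m

/-- The powers of the base `B ^ e`. -/
noncomputable def Mem.tabBase (m : Mem) : Mem := m.tab 7 fun m x => m.arr 14 (e * x)

/-- The number of strings searched for at once, when `ε` is `arr 0 0 / arr 0 1` and the number of
strings wanted is `arr 0 2`. -/
def Mem.numNew (m : Mem) : ℕ := if m.arr 0 2 * m.arr 0 0 < 4 * m.arr 0 1 then m.arr 0 2 else 1

/-- The parameters of the search. -/
noncomputable def Mem.tabParams (m : Mem) : Mem :=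
  m.tab 2 fun m q =>
    if q = 0 then m.arr 14 e else if q = 1 then m.numNew else if q = 2 then m.arr 0 2
    else if q = 3 then s m else if q = 4 then r m
    else if q = 5 then 2 + 2 * m.numNew + m.numNew * m.numNew
    else if m.arr 0 2 * m.arr 0 0 < 4 * m.arr 0 1 then 0 else 1

/-- The whole search, for an automaton in arrays `3` to `6` with initial state `s`. -/
noncomputable def Mem.solve (m : Mem) : Mem :=
  (((m.tabPow B).tabBase e).tabParams e s r).searchAll.tabOut

instance {α : Type} [Ctx α] {g : α → Mem} [IsMem g] : Ev (fun p => (g p).numNew) := by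
  unfold Mem.numNew; infer_instance

theorem isProg_solve [Ev B] [Ev s] [Ev r] : IsProg (Mem.solve e B s r) := by
  refine IsProg.comp (F := fun m => (((m.tabPow B).tabBase e).tabParams e s r).searchAll)
    (G := Mem.tabOut)
    (IsProg.comp (F := fun m => ((m.tabPow B).tabBase e).tabParams e s r) (G := Mem.searchAll)
    (IsProg.comp (F := fun m => (m.tabPow B).tabBase e) (G := Mem.tabParams e s r)
    (IsProg.comp (F := Mem.tabPow B) (G := Mem.tabBase e) ?_ ?_) ?_)
    isProg_searchRound.iterate) ?_
  · have : Ev (fun q : Mem × ℕ => B q.1) := Ev.weak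
    exact IsProg.tab 14 _
  · exact IsProg.tab 7 _
  · have : Ev (fun q : Mem × ℕ => s q.1) := Ev.weak
    have : Ev (fun q : Mem × ℕ => r q.1) := Ev.weak
    exact IsProg.tab 2 _
  · exact IsProg.tab 1 _

end Params

/-- The value of `f` depends neither on the parameters of the search nor on the tables of powers. -/
def Mem.Stable (m : Mem) (f : Mem → ℕ) : Prop :=
  ∀ m' : Mem, m'.C = m.C → m'.D = m.D → (∀ i, i ≠ 2 → i ≠ 7 → i ≠ 14 → m'.arr i = m.arr i) →
    f m' = f m

/-- The parameters and the powers of the base, as stored for the search. If all strings are searched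
for at once, their number is below `4 * b` because `a ≥ 1`, so that the exponent of `C` suffices for
the digits of a configuration. -/
theorem Mem.tabParams_spec {e : ℕ} {B s r : Mem → ℕ} {m : Mem} (hB : m.Stable B) (hs : m.Stable s)
    (hr : m.Stable r) (he : 1 ≤ e) (ha : 1 ≤ m.arr 0 0) (hb : 1 ≤ m.arr 0 1)
    (hC : m.C = B m ^ (e * (4 * m.arr 0 1 + 2) ^ 2)) (hCD : m.C < m.D)
    (hB2 : 2 ≤ B m) (hrM : r m < B m ^ e) (hKM : m.arr 0 2 < B m ^ e) (hsM : s m < B m ^ e)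
    (hK1 : 1 ≤ m.arr 0 2) {m' : Mem} (hm' : m' = ((m.tabPow B).tabBase e).tabParams e s r) :
    m'.C = m.C ∧ m'.D = m.D ∧ (∀ i, i ≠ 2 → i ≠ 7 → i ≠ 14 → m'.arr i = m.arr i) ∧
    m'.core.M = B m ^ e ∧ m'.core.p = m.numNew ∧ m'.core.K = m.arr 0 2 ∧ m'.core.s = s m ∧
    m'.core.r = r m ∧ m'.core.L = 2 + 2 * m.numNew + m.numNew * m.numNew ∧
    m'.arr 2 6 = (if m.arr 0 2 * m.arr 0 0 < 4 * m.arr 0 1 then 0 else 1) ∧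
    (∀ x ≤ m'.core.L, m'.core.pw x = m'.core.M ^ x) ∧ m'.core.M ^ (m'.core.L + 1) ≤ m.C := by
  set n := e * (4 * m.arr 0 1 + 2) ^ 2 with hn
  set m₁ := m.tabPow B with hm₁
  set m₂ := m₁.tabBase e with hm₂
  have C₁ : m₁.C = m.C := m.tab_C _ _
  have C₂ : m₂.C = m.C := (m₁.tab_C _ _).trans C₁
  have C₃ : m'.C = m.C := by rw [hm']; exact (m₂.tab_C _ _).trans C₂
  have D₁ : m₁.D = m.D := m.tab_D _ _
  have D₂ : m₂.D = m.D := (m₁.tab_D _ _).trans D₁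
  have D₃ : m'.D = m.D := by rw [hm']; exact (m₂.tab_D _ _).trans D₂
  have n₁ : ∀ i, i ≠ 14 → m₁.arr i = m.arr i := fun i h => m.tab_arr_ne _ h
  have n₂ : ∀ i, i ≠ 7 → m₂.arr i = m₁.arr i := fun i h => m₁.tab_arr_ne _ h
  have n₃ : ∀ i, i ≠ 2 → m'.arr i = m₂.arr i := fun i h => by rw [hm']; exact m₂.tab_arr_ne _ h
  have hnC : n < m.C := by rw [hC]; exact Nat.lt_pow_self (by omega)
  have hpow : ∀ x ≤ n, B m ^ x ≤ m.C := fun x hx => by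
    rw [hC]; exact Nat.pow_le_pow_right (by omega) hx
  have h14 : ∀ x ≤ n, m₁.arr 14 x = B m ^ x := by
    intro x
    induction x with
    | zero =>
      intro _
      rw [hm₁, Mem.tabPow, m.tab_arr_of_lt 14 _ (by omega)]
      · rfl
      · change 1 < m.D
        omega
    | succ x ih =>
      intro hx
      have hval : (if x + 1 = 0 then 1 else
          (m.tabUpTo 14 (fun m x => if x = 0 then 1 else m.arr 14 (x - 1) * B m) (x + 1)).arr 14
            (x + 1 - 1) * B (m.tabUpTo 14 (fun m x => if x = 0 then 1 else
              m.arr 14 (x - 1) * B m) (x + 1))) = B m ^ (x + 1) := by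
        rw [if_neg (by omega), Nat.add_sub_cancel, m.tabUpTo_arr_of_lt 14 _ (by omega) (by omega),
          hB _ (m.tabUpTo_C _ _ _).1 (m.tabUpTo_C _ _ _).2
            fun i _ _ h => m.tabUpTo_arr_ne _ _ h, pow_succ]
        congr 1
        exact ih (by omega)
      rw [hm₁, Mem.tabPow, m.tab_arr_of_lt 14 _ (by omega)]
      · exact hval
      · rw [hval]
        exact (hpow _ hx).trans_lt hCD
  have h7 : ∀ x, e * x ≤ n → m₂.arr 7 x = (B m ^ e) ^ x := by
    intro x hx
    have hxn : x ≤ e * x := Nat.le_mul_of_pos_left _ he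
    have hval : (m₁.tabUpTo 7 (fun m x => m.arr 14 (e * x)) x).arr 14 (e * x) = (B m ^ e) ^ x := by
      rw [m₁.tabUpTo_arr_ne _ _ (by omega : 14 ≠ 7), h14 _ hx, pow_mul]
    rw [hm₂, Mem.tabBase, m₁.tab_arr_of_lt 7 _ (by omega)]
    · exact hval
    · rw [hval, ← pow_mul, D₁]
      exact (hpow _ hx).trans_lt hCD
  set p := m.numNew with hp
  have hp4 : 1 ≤ p ∧ p ≤ 4 * m.arr 0 1 := by
    rw [hp, Mem.numNew]
    split
    · rename_i h
      have := Nat.le_mul_of_pos_right (m.arr 0 2) ha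
      omega
    · omega
  have hL : e * (2 + 2 * p + p * p + 1) ≤ n := by
    refine Nat.mul_le_mul_left _ ?_
    have h1 : p * p ≤ 4 * m.arr 0 1 * (4 * m.arr 0 1) := Nat.mul_le_mul hp4.2 hp4.2
    nlinarith [hp4.2]
  have he1 : e ≤ n := le_trans (Nat.le_mul_of_pos_right _ (by omega)) hL
  have hL2 : 2 + 2 * p + p * p + 1 ≤ n := (Nat.le_mul_of_pos_left _ he).trans hL
  have h7n : 7 ≤ n := by
    have := Nat.pow_le_pow_left (show 6 ≤ 4 * m.arr 0 1 + 2 by omega) 2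
    exact (show 7 ≤ 1 * 6 ^ 2 by norm_num).trans (Nat.mul_le_mul he this)
  have h2 : ∀ q < 7, ∀ v < m.D, (if q = 0 then B m ^ e else if q = 1 then p else if q = 2 then
      m.arr 0 2 else if q = 3 then s m else if q = 4 then r m else if q = 5 then 2 + 2 * p + p * p
      else if m.arr 0 2 * m.arr 0 0 < 4 * m.arr 0 1 then 0 else 1) = v → m'.arr 2 q = v := by
    intro q hq v hv hqv
    have hsame : ∀ i, i ≠ 2 → i ≠ 7 → i ≠ 14 →
        (m₂.tabUpTo 2 (fun m q => if q = 0 then m.arr 14 e else if q = 1 then m.numNew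
          else if q = 2 then m.arr 0 2 else if q = 3 then s m else if q = 4 then r m
          else if q = 5 then 2 + 2 * m.numNew + m.numNew * m.numNew
          else if m.arr 0 2 * m.arr 0 0 < 4 * m.arr 0 1 then 0 else 1) q).arr i = m.arr i :=
      fun i i1 i2 i3 => by rw [m₂.tabUpTo_arr_ne _ _ i1, n₂ i i2, n₁ i i3]
    rw [hm', Mem.tabParams, m₂.tab_arr 2 _ (by omega), Mem.numNew, hsame 0 (by omega) (by omega)
      (by omega), m₂.tabUpTo_arr_ne _ _ (by omega : 14 ≠ 2), n₂ 14 (by omega), h14 e he1,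
      hs _ ((m₂.tabUpTo_C _ _ _).1.trans C₂) ((m₂.tabUpTo_C _ _ _).2.trans D₂) hsame,
      hr _ ((m₂.tabUpTo_C _ _ _).1.trans C₂) ((m₂.tabUpTo_C _ _ _).2.trans D₂) hsame, D₂]
    rw [hp, Mem.numNew] at hqv
    rw [hqv, cap_of_lt hv]
  have hMC := hpow e he1
  have q0 : m'.arr 2 0 = B m ^ e := h2 0 (by omega) _ (by omega) rfl
  have q1 : m'.arr 2 1 = p := h2 1 (by omega) _ (by omega) rfl
  have q2 : m'.arr 2 2 = m.arr 0 2 := h2 2 (by omega) _ (by omega) rfl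
  have q3 : m'.arr 2 3 = s m := h2 3 (by omega) _ (by omega) rfl
  have q4 : m'.arr 2 4 = r m := h2 4 (by omega) _ (by omega) rfl
  have q5 : m'.arr 2 5 = 2 + 2 * p + p * p := h2 5 (by omega) _ (by omega) rfl
  have hM : m'.core.M = B m ^ e := by
    change min (m'.arr 2 0) m'.C = _
    rw [q0, C₃]; omega
  have hLL : m'.core.L = 2 + 2 * p + p * p := by
    change min (m'.arr 2 5) m'.C = _
    rw [q5, C₃]; omega
  refine ⟨C₃, D₃, fun i i1 i2 i3 => by rw [n₃ i i1, n₂ i i2, n₁ i i3], hM, ?_, ?_, q3, ?_, hLL,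
    h2 6 (by omega) _ (by split <;> omega) rfl, fun x hx => ?_, ?_⟩
  · change min (m'.arr 2 1) m'.C = _
    rw [q1, C₃]; omega
  · change min (m'.arr 2 2) m'.C = _
    rw [q2, C₃]; omega
  · change min (m'.arr 2 4) m'.C = _
    rw [q4, C₃]; omega
  · change m'.arr 7 x = _
    rw [n₃ 7 (by omega), h7 x ?_, hM]
    exact (Nat.mul_le_mul_left e (by omega : x ≤ 2 + 2 * p + p * p + 1)).trans hL
  · rw [hM, hLL, ← pow_mul]
    exact hpow _ hL

/-- The search computes `K` distinct strings of the language whose sum of distances is at least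
`1 - a / b` times the greatest possible, or finds out that there are no `K` strings. -/
theorem Mem.solve_spec {e : ℕ} {B s r : Mem → ℕ} {m : Mem} (hB : m.Stable B) (hs : m.Stable s)
    (hr : m.Stable r) (he : 1 ≤ e) (ha : 1 ≤ m.arr 0 0) (hb : 1 ≤ m.arr 0 1)
    (hC : m.C = B m ^ (e * (4 * m.arr 0 1 + 2) ^ 2)) (hCD : m.C < m.D)
    (hB2 : 2 ≤ B m) (hrM : r m < B m ^ e) (hKM : m.arr 0 2 < B m ^ e) (hsM : s m < B m ^ e)
    (hK1 : 1 ≤ m.arr 0 2) (hKr : m.arr 0 2 * r m < B m ^ e)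
    (htgt : ∀ i < B m ^ e, m.arr 5 i < B m ^ e) (hlab : ∀ i < B m ^ e, m.arr 4 i < m.D)
    (h8 : ∀ q, m.arr 8 q = 0) (h13 : m.arr 13 0 = 0) :
    ∃ E : Core, (E.M = B m ^ e ∧ E.K = m.arr 0 2 ∧ E.s = s m ∧ E.r = r m ∧ E.src = m.arr 3 ∧
      E.lab = m.arr 4 ∧ E.tgt = m.arr 5 ∧ E.acc = m.arr 6) ∧
      (((m.solve e B s r).arr 1 0 = 1 ∧ ∃ X, E.Valid E.K X ∧
        (∀ j < E.K, ∀ x < E.r, (m.solve e B s r).arr 1 (1 + (j * E.r + x)) = X j x) ∧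
        ∀ Y, E.Valid E.K Y → m.arr 0 1 * E.div₂ E.K Y
          ≤ m.arr 0 1 * E.div₂ E.K X + m.arr 0 0 * E.div₂ E.K Y) ∨
      ((m.solve e B s r).arr 1 0 = 0 ∧ ¬ ∃ Y, E.Valid E.K Y)) := by
  set m' := ((m.tabPow B).tabBase e).tabParams e s r with hm'
  obtain ⟨p1, p2, p3, p4, p5, p6, p7, p8, p9, p10, p11, p12⟩ :=
    Mem.tabParams_spec hB hs hr he ha hb hC hCD hB2 hrM hKM hsM hK1 hm'
  have hM1 : 1 < m'.core.M := by
    rw [p4]; exact Nat.one_lt_pow (by omega) (by omega)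
  have hkk : m'.core.kk = 0 := by
    change min (m'.arr 13 0) m'.C = 0
    rw [p3 13 (by omega) (by omega) (by omega), h13]
    omega
  have hp1 : 1 ≤ m.numNew := by
    rw [Mem.numNew]; split <;> omega
  have hE : m'.core.WF :=
    { pw_eq := p11
      L_eq := by rw [p9, p5]
      pow_le := by
        change _ ≤ m'.C
        rw [p1]; exact p12
      one_lt_M := hM1
      one_le_p := by rw [p5]; exact hp1
      r_lt := by rw [p8, p4]; exact hrM
      K_lt := by rw [p6, p4]; exact hKM
      kk_le := by rw [hkk]; omega
      tgt_lt := by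
        rw [p4]
        change ∀ i < B m ^ e, m'.arr 5 i < _
        rw [p3 5 (by omega) (by omega) (by omega)]
        exact htgt
      s_lt := by rw [p7, p4]; exact hsM
      cross_lt := by rw [hkk]; simp; omega }
  have hmode : m'.Mode (m.arr 0 0) (m.arr 0 1) := by
    unfold Mem.Mode
    rw [p5, p6, p8, p4, p10, Mem.numNew]
    by_cases h : m.arr 0 2 * m.arr 0 0 < 4 * m.arr 0 1
    · right; simp [h]
    · left; simp [h, hKr]; omega
  have hlab' : ∀ i < m'.core.M, m'.core.lab i < m'.D := by
    rw [p4, p2]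
    change ∀ i < B m ^ e, m'.arr 4 i < _
    rw [p3 4 (by omega) (by omega) (by omega)]
    exact hlab
  have hX' : ∀ q < m'.C, m'.arr 8 q < m'.D := by
    intro q _
    rw [p3 8 (by omega) (by omega) (by omega), h8, p2]
    omega
  obtain ⟨s1, s2, s3, s4, s5, s6⟩ := Mem.searchAll_spec hE hkk (by rw [p6]; exact hK1)
    (by omega) hlab' hX' hmode
  have hMM : m'.core.M * m'.core.M ≤ m'.C := by
    refine le_trans ?_ hE.pow_le
    rw [← pow_two]
    exact Nat.pow_le_pow_right (by omega) (by rw [hE.L_eq]; omega)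
  have hMle := Nat.le_mul_self m'.core.M
  have sM : m'.searchAll.core.M = m'.core.M := by rw [s3]; rfl
  have sK : m'.searchAll.core.K = m'.core.K := by rw [s3]; rfl
  have sr : m'.searchAll.core.r = m'.core.r := by rw [s3]; rfl
  obtain ⟨o1, o2⟩ := Mem.tabOut_spec (m := m'.searchAll) (by omega)
    (by rw [s1, s2]; exact s4) (by rw [sM, sr]; exact hE.r_lt) (by
      rw [sM, sK, s1]
      exact (Nat.mul_lt_mul_of_pos_right hE.K_lt (by omega)).trans_le hMM)
  have hsolve : m.solve e B s r = m'.searchAll.tabOut := rfl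
  refine ⟨m'.core, ⟨p4, p6, p7, p8, p3 3 (by omega) (by omega) (by omega),
    p3 4 (by omega) (by omega) (by omega), p3 5 (by omega) (by omega) (by omega),
    p3 6 (by omega) (by omega) (by omega)⟩, ?_⟩
  rw [hsolve]
  by_cases h : m'.searchAll.Success
  · left
    obtain ⟨o3, o4⟩ := o1 h
    rw [sK, sr] at o4
    exact ⟨o3, _, s5 h, o4, fun Y hY => (s6 Y hY).2⟩
  · right
    exact ⟨o2 h, fun ⟨Y, hY⟩ => h (s6 Y hY).1⟩

/-! ### From bounded programs to approximation schemes -/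

/-- The sum of the cells of the input array with indices in `idx`, plus the constant `k`. -/
def inputSum (idx : List ℕ) (k : ℕ) (a : ℕ → ℕ) : ℕ := (idx.map a).sum + k

/-- The machine expression for `inputSum`. -/
def inputSumArith (idx : List ℕ) (k : ℕ) : Arith :=
  idx.foldr (fun i f => .add (.read 0 (.const i)) f) (.const k)

theorem inputSumArith_eval {w k : ℕ} {st : State} {idx : List ℕ} (hidx : ∀ i ∈ idx, i < 2 ^ w)
    (h : inputSum idx k (st.arr 0) < 2 ^ w) :
    (inputSumArith idx k).eval w st = inputSum idx k (st.arr 0) := by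
  induction idx with
  | nil =>
    simp only [inputSum, List.map_nil, List.sum_nil, zero_add] at h
    simp [inputSumArith, inputSum, Arith.eval, Nat.mod_eq_of_lt h]
  | cons i idx ih =>
    simp only [inputSum, List.map_cons, List.sum_cons] at h ih
    have ih' := ih (fun j hj => hidx j (List.mem_cons_of_mem _ hj)) (by omega)
    simp only [inputSumArith, List.foldr_cons, Arith.eval,
      Nat.mod_eq_of_lt (hidx i List.mem_cons_self)] at ih' ⊢
    rw [ih', Nat.mod_eq_of_lt (by omega), inputSum, List.map_cons, List.sum_cons]
    omega

instance {α : Type} [Ctx α] {g : α → Mem} [IsMem g] (idx : List ℕ) (k : ℕ) :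
    Ev (fun p => inputSum idx k ((g p).arr 0)) := by
  unfold inputSum
  have : Ev (fun p => (idx.map ((g p).arr 0)).sum) := by
    induction idx with
    | nil => exact Ev.const 0
    | cons i idx ih =>
      simp only [List.map_cons, List.sum_cons]
      infer_instance
  infer_instance

theorem inputSum_le {idx : List ℕ} {k N : ℕ} {a : ℕ → ℕ} (h : ∀ i, a i ≤ N) :
    inputSum idx k a ≤ idx.length * N + k := by
  induction idx with
  | nil => simp [inputSum]
  | cons i idx ih =>
    simp only [inputSum, List.map_cons, List.sum_cons, List.length_cons] at ih ⊢
    have := h i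
    rw [Nat.succ_mul]
    omega

/-- The number of rounds of the loops of the search is the power of `B` with this exponent, where
`b` is the denominator of `ε`. -/
def expo (e b : ℕ) : ℕ := e * (4 * b + 2) ^ 2

/-- The memory in which the search starts on the input `a`: the sum `B` of the cells `idxB` is
linear in the size of the instance, and `D` exceeds the sum of the cells `idxD`. -/
def initMem (idxB idxD : List ℕ) (e : ℕ) (l : List ℕ) : Mem where
  C := inputSum idxB 5 ((State.start l).arr 0) ^ expo e ((State.start l).arr 0 1)
  D := inputSum idxB 5 ((State.start l).arr 0) ^ expo e ((State.start l).arr 0 1)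
    + inputSum idxD 1 ((State.start l).arr 0)
  arr := (State.start l).arr

/-- Machine code that computes the numbers `C` and `D` of `initMem` by repeated multiplication. -/
def setup (idxB idxD : List ℕ) (e : ℕ) : Com :=
  .seq (.assign 2 (inputSumArith idxB 5))
  (.seq (.assign 3 (.mul (.const e)
      (.mul (.add (.mul (.const 4) (.read 0 (.const 1))) (.const 2))
        (.add (.mul (.const 4) (.read 0 (.const 1))) (.const 2)))))
  (.seq (.assign 0 (.const 1))
  (.seq (.loop (.reg 3) (.seq (.assign 0 (.mul (.reg 0) (.reg 2)))
      (.assign 3 (.sub (.reg 3) (.const 1)))))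
    (.assign 1 (.add (.reg 0) (inputSumArith idxD 1))))))

theorem exec_power_loop {w B : ℕ} : ∀ (q : ℕ) (st : State), st.reg 2 = B → st.reg 3 = q →
    1 < 2 ^ w → 1 ≤ B → st.reg 0 * B ^ q < 2 ^ w →
    ∃ st', Exec w (.loop (.reg 3) (.seq (.assign 0 (.mul (.reg 0) (.reg 2)))
      (.assign 3 (.sub (.reg 3) (.const 1))))) st st' (q * 10 + 2) ∧
      st'.reg 0 = st.reg 0 * B ^ q ∧ st'.arr = st.arr := by
  intro q
  induction q with
  | zero =>
    intro st h2 h3 hw hB hlt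
    exact ⟨st, (Exec.loop_false (by simp [Arith.eval, h3])).of_time_eq (by simp [Arith.cost]),
      by simp, rfl⟩
  | succ q ih =>
    intro st h2 h3 hw hB hlt
    have hlt1 : st.reg 0 * B < 2 ^ w := by
      refine lt_of_le_of_lt (Nat.mul_le_mul_left _ ?_) hlt
      exact Nat.le_self_pow (by omega) B
    have h1 := Exec.assign (w := w) st 0 (.mul (.reg 0) (.reg 2))
    have e1 : (Arith.mul (.reg 0) (.reg 2)).eval w st = st.reg 0 * B := by
      simp [Arith.eval, h2, Nat.mod_eq_of_lt hlt1]
    rw [e1] at h1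
    have h1' := Exec.assign (w := w) (st.setReg 0 (st.reg 0 * B)) 3 (.sub (.reg 3) (.const 1))
    have e2 : (Arith.sub (.reg 3) (.const 1)).eval w (st.setReg 0 (st.reg 0 * B)) = q := by
      simp [Arith.eval, State.setReg, h3, Nat.mod_eq_of_lt hw]
    rw [e2] at h1'
    obtain ⟨st', hl, hr, ha⟩ := ih ((st.setReg 0 (st.reg 0 * B)).setReg 3 q)
      (by simp [State.setReg, h2]) (by simp [State.setReg]) hw hB (by
        simp only [State.setReg, Function.update_self, Function.update_of_ne (show (0 : ℕ) ≠ 3 by omega)]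
        rwa [mul_assoc, ← pow_succ'])
    refine ⟨st', ?_, ?_, ha⟩
    · refine (Exec.loop_true (by simp [Arith.eval, h3]) (Exec.seq h1 h1') hl).of_time_eq ?_
      simp only [Arith.cost]
      ring
    · rw [hr]
      simp only [State.setReg, Function.update_self, Function.update_of_ne (show (0 : ℕ) ≠ 3 by omega)]
      rw [mul_assoc, ← pow_succ']

theorem exec_setup (idxB idxD : List ℕ) {e : ℕ} (he : 1 ≤ e) : ∃ t₀ : ℕ, ∀ (l : List ℕ) (w : ℕ),
    (∀ i ∈ idxB, i < 2 ^ w) → (∀ i ∈ idxD, i < 2 ^ w) → (initMem idxB idxD e l).D < 2 ^ w →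
    ∃ st, Exec w (setup idxB idxD e) (State.start l) st
        (t₀ + expo e ((State.start l).arr 0 1) * 10) ∧
      st.Rep (initMem idxB idxD e l) := by
  refine ⟨(inputSumArith idxB 5).cost + 1 + ((Arith.mul (.const e)
      (.mul (.add (.mul (.const 4) (.read 0 (.const 1))) (.const 2))
        (.add (.mul (.const 4) (.read 0 (.const 1))) (.const 2)))).cost + 1 + (2 + (2 +
      ((Arith.add (.reg 0) (inputSumArith idxD 1)).cost + 1)))), fun l w hiB hiD hD => ?_⟩
  set st₀ := State.start l with hst₀
  set b := st₀.arr 0 1 with hb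
  set B := inputSum idxB 5 (st₀.arr 0) with hB
  set S := inputSum idxD 1 (st₀.arr 0) with hS
  change B ^ expo e b + S < 2 ^ w at hD
  have hB5 : 5 ≤ B := by rw [hB, inputSum]; omega
  have hS1 : 1 ≤ S := by rw [hS, inputSum]; omega
  have hQC : expo e b < B ^ expo e b := Nat.lt_pow_self (by omega)
  have hQ : (4 * b + 2) * (4 * b + 2) ≤ expo e b := by
    rw [expo, ← pow_two]; exact Nat.le_mul_of_pos_left _ he
  have hQe : e ≤ expo e b := by rw [expo]; exact Nat.le_mul_of_pos_right _ (by positivity)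
  have hq : 4 * b + 2 ≤ (4 * b + 2) * (4 * b + 2) := Nat.le_mul_self _
  have hq4 : 4 ≤ (4 * b + 2) * (4 * b + 2) := by nlinarith
  have hQ0 : expo e b ≠ 0 := by omega
  have hBC : B ≤ B ^ expo e b := Nat.le_self_pow hQ0 B
  have h1 := Exec.assign (w := w) st₀ 2 (inputSumArith idxB 5)
  rw [inputSumArith_eval hiB (by rw [← hB]; omega), ← hB] at h1
  have h2 := Exec.assign (w := w) (st₀.setReg 2 B) 3 (.mul (.const e)
      (.mul (.add (.mul (.const 4) (.read 0 (.const 1))) (.const 2))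
        (.add (.mul (.const 4) (.read 0 (.const 1))) (.const 2))))
  have e2 : (Arith.mul (.const e)
      (.mul (.add (.mul (.const 4) (.read 0 (.const 1))) (.const 2))
        (.add (.mul (.const 4) (.read 0 (.const 1))) (.const 2)))).eval w (st₀.setReg 2 B)
      = expo e b := by
    have ha : (st₀.setReg 2 B).arr 0 1 = b := rfl
    simp only [Arith.eval]
    rw [Nat.mod_eq_of_lt (a := 1) (by omega), ha, Nat.mod_eq_of_lt (a := 4) (by omega),
      Nat.mod_eq_of_lt (a := 2) (by omega), Nat.mod_eq_of_lt (a := 4 * b) (by omega),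
      Nat.mod_eq_of_lt (a := 4 * b + 2) (by omega),
      Nat.mod_eq_of_lt (a := (4 * b + 2) * (4 * b + 2)) (by omega),
      Nat.mod_eq_of_lt (a := e) (by omega), ← pow_two]
    exact Nat.mod_eq_of_lt (by rw [← expo]; omega)
  rw [e2] at h2
  have h3 := Exec.assign (w := w) ((st₀.setReg 2 B).setReg 3 (expo e b)) 0 (.const 1)
  have e3 : (Arith.const 1).eval w ((st₀.setReg 2 B).setReg 3 (expo e b)) = 1 := by
    simp only [Arith.eval]
    exact Nat.mod_eq_of_lt (by omega)
  rw [e3] at h3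
  obtain ⟨st₄, h4, r4, a4⟩ := exec_power_loop (w := w) (B := B) (expo e b)
    (((st₀.setReg 2 B).setReg 3 (expo e b)).setReg 0 1) (by simp [State.setReg])
    (by simp [State.setReg]) (by omega) (by omega) (by simp [State.setReg]; omega)
  have r4' : st₄.reg 0 = B ^ expo e b := by simpa [State.setReg] using r4
  have a4' : st₄.arr = st₀.arr := a4
  have h5 := Exec.assign (w := w) st₄ 1 (.add (.reg 0) (inputSumArith idxD 1))
  have e5 : (Arith.add (.reg 0) (inputSumArith idxD 1)).eval w st₄ = B ^ expo e b + S := by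
    simp only [Arith.eval]
    rw [inputSumArith_eval hiD (by rw [a4', ← hS]; omega), r4', a4', ← hS, Nat.mod_eq_of_lt hD]
  rw [e5] at h5
  refine ⟨st₄.setReg 1 (B ^ expo e b + S), ?_, ?_, ?_, ?_⟩
  · refine (Exec.seq h1 (Exec.seq h2 (Exec.seq h3 (Exec.seq h4 h5)))).of_time_eq ?_
    simp only [show (Arith.const 1).cost = 1 from rfl]
    ring
  · change Function.update st₄.reg 1 (B ^ expo e b + S) 0 = B ^ expo e b
    rw [Function.update_of_ne (by decide), r4']
  · simp [State.setReg, initMem, hB, hS, hb, hst₀]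
  · exact a4'

theorem eval_mono (p : Polynomial ℕ) {x y : ℕ} (h : x ≤ y) : p.eval x ≤ p.eval y := by
  rw [Polynomial.eval_eq_sum_range, Polynomial.eval_eq_sum_range]
  exact sum_le_sum fun i _ => Nat.mul_le_mul_left _ (Nat.pow_le_pow_left h i)

theorem getD_le_foldr_max (l : List ℕ) (i : ℕ) : l.getD i 0 ≤ l.foldr max 0 := by
  induction l generalizing i with
  | nil => simp
  | cons a l ih =>
    cases i with
    | zero => simp
    | succ i => simpa using Or.inr (by simpa using ih i)

/-- On words with logarithmically many bits, no power of `D` of fixed degree overflows. -/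
theorem initMem_D_pow_lt (idxB idxD : List ℕ) (e g a b : ℕ) : ∃ c : ℕ, ∀ (l : List ℕ) (S w : ℕ),
    c * (Nat.log 2 (S + l.foldr max 0) + 1) ≤ w →
    ((initMem idxB idxD e (a :: b :: l)).D + 2) ^ g < 2 ^ w ∧ ∀ i ∈ idxB ++ idxD, i < 2 ^ w := by
  obtain ⟨A, hA⟩ : ∃ A, A = (idxB.length + idxD.length) * (a + b + 1) + 6 := ⟨_, rfl⟩
  refine ⟨(A + 1) * (expo e b + 3) * g + 1 + (idxB ++ idxD).sum, fun l S w hw => ?_⟩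
  set N := S + l.foldr max 0 with hN
  set y := Nat.log 2 N + 1 with hy
  have hNZ : N < 2 ^ y := Nat.lt_pow_succ_log_self (by omega) N
  have hcell : ∀ i, (State.start (a :: b :: l)).arr 0 i ≤ (a + b + 1) * 2 ^ y := by
    intro i
    have h1 : (State.start (a :: b :: l)).arr 0 i ≤ a + b + N := by
      change (a :: b :: l).getD i 0 ≤ _
      match i with
      | 0 => simp; omega
      | 1 => simp; omega
      | i + 2 =>
        have := getD_le_foldr_max l i
        simp only [List.getD_cons_succ]
        omega
    have h2 : 1 ≤ 2 ^ y := Nat.one_le_two_pow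
    nlinarith [Nat.zero_le a, Nat.zero_le b]
  have h1Z : 2 ≤ 2 ^ y := Nat.le_self_pow (by omega) 2
  have hsumB : inputSum idxB 5 ((State.start (a :: b :: l)).arr 0) ≤ A * 2 ^ y := by
    refine (inputSum_le hcell).trans ?_
    rw [hA]
    nlinarith [Nat.zero_le (idxD.length * (a + b + 1) * 2 ^ y)]
  have hsumD : inputSum idxD 1 ((State.start (a :: b :: l)).arr 0) ≤ A * 2 ^ y := by
    refine (inputSum_le hcell).trans ?_
    rw [hA]
    nlinarith [Nat.zero_le (idxB.length * (a + b + 1) * 2 ^ y)]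
  have hAZ : 2 ≤ A * 2 ^ y := by nlinarith
  have hAZ' : A * 2 ^ y ≤ 2 ^ ((A + 1) * y) := by
    rw [Nat.add_one_mul, pow_add 2 (A * y) y]
    refine Nat.mul_le_mul_right _ (Nat.lt_two_pow_self.le.trans ?_)
    exact Nat.pow_le_pow_right (by omega) (Nat.le_mul_of_pos_right _ (by omega))
  have hD : (initMem idxB idxD e (a :: b :: l)).D + 2 ≤ (A * 2 ^ y) ^ (expo e b + 3) := by
    have hb : (State.start (a :: b :: l)).arr 0 1 = b := rfl
    change inputSum idxB 5 ((State.start (a :: b :: l)).arr 0) ^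
      expo e ((State.start (a :: b :: l)).arr 0 1)
      + inputSum idxD 1 ((State.start (a :: b :: l)).arr 0) + 2 ≤ _
    rw [hb, pow_add]
    have h1 := Nat.pow_le_pow_left hsumB (expo e b)
    have h2 : 1 ≤ (A * 2 ^ y) ^ expo e b := Nat.one_le_pow _ _ (by omega)
    generalize A * 2 ^ y = u at *
    generalize u ^ expo e b = v at *
    have h3 : u * u * u ≤ v * (u * u * u) := Nat.le_mul_of_pos_left _ h2
    have h4 : v * 4 ≤ v * (u * u) := Nat.mul_le_mul_left _ (by nlinarith)
    have h5 : v * (u * u) * 2 ≤ v * (u * u) * u := Nat.mul_le_mul_left _ hAZ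
    have h6 : u * 4 ≤ u * (u * u) := Nat.mul_le_mul_left _ (by nlinarith)
    have e1 : v * (u * u * u) = v * (u * u) * u := by ring
    have e2 : u * (u * u) = u * u * u := by ring
    have e3 : v * u ^ 3 = v * (u * u) * u := by ring
    omega
  have hexp : ∀ n, n ≤ (A + 1) * (expo e b + 3) * g + (idxB ++ idxD).sum → 2 ^ (n * y) < 2 ^ w := by
    intro n hn
    refine Nat.pow_lt_pow_right (by omega) (lt_of_lt_of_le ?_ hw)
    exact Nat.mul_lt_mul_of_pos_right (by omega) (by omega)
  constructor
  · refine lt_of_le_of_lt ?_ (hexp ((A + 1) * (expo e b + 3) * g) (by omega))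
    refine (Nat.pow_le_pow_left (hD.trans (Nat.pow_le_pow_left hAZ' _)) g).trans_eq ?_
    rw [← pow_mul, ← pow_mul]
    congr 1
    ring
  · intro i hi
    have h1 : i ≤ (idxB ++ idxD).sum := List.le_sum_of_mem hi
    refine lt_of_le_of_lt ?_ (hexp i (by omega))
    exact Nat.lt_two_pow_self.le.trans
      (Nat.pow_le_pow_right (by omega) (Nat.le_mul_of_pos_right _ (by omega)))

/-- A bounded program that solves a problem up to the factor `1 - ε` is an approximation scheme,
since its running time is polynomial in `C`, and `C` is a power, with exponent depending on `ε`, of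
a number linear in the size. -/
theorem admitsPTAS_of {P : MaxProblem} {F : Mem → Mem} (hF : IsProg F) {idxB idxD : List ℕ}
    {e A : ℕ} (he : 1 ≤ e)
    (hsize : ∀ x a b, inputSum idxB 5 ((State.start (a :: b :: P.input x)).arr 0)
      ≤ A * P.size x + A)
    (hbounded : ∀ x a b, (initMem idxB idxD e (a :: b :: P.input x)).Bounded)
    (hspec : ∀ x a b, 1 ≤ a → 1 ≤ b → ∀ m, m = F (initMem idxB idxD e (a :: b :: P.input x)) →
      (∃ X, P.Feasible x X ∧ (∀ Y, P.Feasible x Y →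
        b * P.value x Y ≤ b * P.value x X + a * P.value x Y) ∧
        State.Outputs ⟨fun _ => 0, m.arr⟩ (1 :: P.output x X)) ∨
      (m.arr 1 0 = 0 ∧ ¬ ∃ Y, P.Feasible x Y)) :
    AdmitsPTAS P := by
  obtain ⟨s, hs⟩ := hF
  obtain ⟨t₀, ht₀⟩ := exec_setup idxB idxD he
  refine ⟨.seq (setup idxB idxD e) (s.comp 0), fun ε hε => ?_⟩
  set a := ε.num.natAbs with ha
  set b := ε.den with hb
  have hnum : 0 < ε.num := Rat.num_pos.2 hε
  have ha1 : 1 ≤ a := by omega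
  have hb1 : 1 ≤ b := ε.den_pos
  obtain ⟨c, hc⟩ := initMem_D_pow_lt idxB idxD e (s.deg + 1) a b
  refine ⟨Polynomial.C (t₀ + expo e b * 10)
    + s.time.comp ((Polynomial.C A * Polynomial.X + Polynomial.C A) ^ expo e b), c,
    fun x w hw => ?_⟩
  obtain ⟨hw1, hw2⟩ := hc (P.input x) (P.size x) w hw
  set m := initMem idxB idxD e (a :: b :: P.input x) with hm
  have hwD : m.D + 2 < 2 ^ w := (Nat.le_self_pow (by omega) _).trans_lt hw1
  have hws : (m.D + 2) ^ s.deg < 2 ^ w :=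
    (Nat.pow_le_pow_right (by omega) (by omega)).trans_lt hw1
  obtain ⟨st₁, h₁, r₁⟩ := ht₀ (a :: b :: P.input x) w
    (fun i hi => hw2 i (List.mem_append_left _ hi))
    (fun i hi => hw2 i (List.mem_append_right _ hi)) (by rw [← hm]; omega)
  obtain ⟨st₂, h₂, r₂, -⟩ := s.exec_comp (w := w) 0 (hbounded x a b) hws st₁ r₁
  refine ⟨st₂, _, Exec.seq h₁ h₂, ?_, ?_⟩
  · have hCle : m.C ≤ (A * P.size x + A) ^ expo e b := Nat.pow_le_pow_left (hsize x a b) _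
    have := eval_mono s.time hCle
    have hb' : (State.start (a :: b :: P.input x)).arr 0 1 = b := rfl
    simp only [Polynomial.eval_add, Polynomial.eval_C, Polynomial.eval_comp, Polynomial.eval_pow,
      Polynomial.eval_mul, Polynomial.eval_X, hb']
    exact Nat.add_le_add_left this _
  · have harr : st₂.arr = (F m).arr := by rw [r₂.arr, hs]
    have hout : ∀ l, State.Outputs ⟨fun _ => 0, (F m).arr⟩ l → st₂.Outputs l := by
      intro l hl i hi
      rw [harr]
      exact hl i hi
    rcases hspec x a b ha1 hb1 _ rfl with ⟨X, hX, hopt, hO⟩ | ⟨h0, hno⟩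
    · refine ⟨fun _ => ⟨X, hX, fun Y hY => ?_, hout _ hO⟩, fun h => absurd ⟨X, hX⟩ h⟩
      have h := hopt Y hY
      have hεab : ε * (b : ℚ) = a := by
        have h1 : (a : ℚ) = (ε.num : ℚ) := by
          rw [ha, Nat.cast_natAbs, abs_of_pos hnum]
        rw [h1]
        exact Rat.mul_den_eq_num ε
      have hbq : (0 : ℚ) < b := by exact_mod_cast hb1
      have hq : (b : ℚ) * P.value x Y ≤ b * P.value x X + a * P.value x Y := by exact_mod_cast h
      refine le_of_mul_le_mul_left (a := (b : ℚ)) ?_ hbq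
      calc (b : ℚ) * ((1 - ε) * P.value x Y)
          = b * P.value x Y - (ε * b) * P.value x Y := by ring
        _ ≤ b * P.value x X := by rw [hεab]; linarith
    · refine ⟨fun h => absurd h hno, fun _ => hout _ fun i hi => ?_⟩
      obtain rfl : i = 0 := by simpa using hi
      simpa using h0

/-! ### Strings over a finite alphabet -/

/-- A string, with numbers as positions and symbols. -/
def natString {r σ : ℕ} (y : Fin r → Fin σ) (x : ℕ) : ℕ := if h : x < r then y ⟨x, h⟩ else 0

theorem natString_fin {r σ : ℕ} (y : Fin r → Fin σ) (x : Fin r) : natString y x = y x := by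
  simp [natString]

theorem two_mul_sumDiversity {K r : ℕ} {A : Type} [DecidableEq A] (X : Fin K → Fin r → A) :
    2 * sumDiversity X = ∑ i, ∑ j, hammingDist (X i) (X j) := by
  have h := Finset.sum_sum_Ioi_add_eq_sum_sum_off_diag fun i j => hammingDist (X i) (X j)
  have h1 : ∀ i j, hammingDist (X j) (X i) + hammingDist (X i) (X j)
      = 2 * hammingDist (X i) (X j) := fun i j => by rw [hammingDist_comm]; ring
  simp only [h1, ← mul_sum] at h
  rw [sumDiversity, h, sum_comm' (t' := univ) (s' := fun i => {i}ᶜ) (by simp [eq_comm])]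
  refine sum_congr rfl fun i _ => ?_
  rw [← sum_compl_add_sum {i}, sum_singleton, hammingDist_self, add_zero]

theorem concatStrings_eq {K r σ : ℕ} (X : Fin K → Fin r → Fin σ) :
    concatStrings X = List.ofFn fun q : Fin (K * r) => ((X q.divNat q.modNat : Fin σ) : ℕ) := by
  rw [List.ofFn_mul, concatStrings]
  congr 2
  funext i
  congr 1
  funext j
  have h1 : (i * r + j) / r = i := by
    rw [add_comm, Nat.add_mul_div_right _ _ (Nat.zero_lt_of_lt j.2), Nat.div_eq_of_lt j.2, zero_add]
  have h2 : (i * r + j) % r = j := by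
    rw [add_comm, Nat.add_mul_mod_self_right, Nat.mod_eq_of_lt j.2]
  congr 2
  · exact Fin.ext h1.symm
  · exact Fin.ext h2.symm

/-- If the automaton accepts the strings of `L`, then the result of the search is a correct answer
for `L`. -/
theorem search_answer {E : Core} {K r σ a b : ℕ} {L : Set (List (Fin σ))} {out : ℕ → ℕ → ℕ}
    (hK : E.K = K) (hr : E.r = r)
    (hL : ∀ y : Fin r → Fin σ, List.ofFn y ∈ L ↔ E.InLang (natString y))
    (hσ : ∀ y, E.InLang y → ∀ x < r, y x < σ)
    (h : (out 1 0 = 1 ∧ ∃ X, E.Valid E.K X ∧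
        (∀ j < E.K, ∀ x < E.r, out 1 (1 + (j * E.r + x)) = X j x) ∧
        ∀ Y, E.Valid E.K Y → b * E.div₂ E.K Y ≤ b * E.div₂ E.K X + a * E.div₂ E.K Y) ∨
      (out 1 0 = 0 ∧ ¬ ∃ Y, E.Valid E.K Y)) :
    (∃ X : Fin K → Fin r → Fin σ, IsSubsetOfCard L X ∧
      (∀ Y : Fin K → Fin r → Fin σ, IsSubsetOfCard L Y →
        b * sumDiversity Y ≤ b * sumDiversity X + a * sumDiversity Y) ∧
      State.Outputs ⟨fun _ => 0, out⟩ (1 :: concatStrings X)) ∨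
    (out 1 0 = 0 ∧ ¬ ∃ Y : Fin K → Fin r → Fin σ, IsSubsetOfCard L Y) := by
  subst hK hr
  -- The strings as functions on numbers, extended arbitrarily beyond the last string.
  let ext (Y : Fin E.K → Fin E.r → Fin σ) (j : ℕ) : ℕ → ℕ :=
    if h : j < E.K then natString (Y ⟨j, h⟩) else fun _ => 0
  have hext : ∀ Y (j : Fin E.K), ext Y j = natString (Y j) := fun Y j => by simp [ext]
  have hdiv : ∀ (Y : Fin E.K → Fin E.r → Fin σ) (Z : ℕ → ℕ → ℕ),
      (∀ (j : Fin E.K) (x : Fin E.r), Z j x = (Y j x : ℕ)) →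
      E.div₂ E.K Z = 2 * sumDiversity Y := by
    intro Y Z hYZ
    rw [two_mul_sumDiversity, ← Core.sum_fin_eq_div₂]
    refine sum_congr rfl fun i _ => sum_congr rfl fun j _ => ?_
    simp only [hYZ]
    exact hammingDist_comp (fun _ (c : Fin σ) => (c : ℕ)) fun _ => Fin.val_injective
  have hvalid : ∀ Y, IsSubsetOfCard L Y → E.Valid E.K (ext Y) := by
    intro Y hY
    refine ⟨fun j hj => ?_, fun j hj j' hj' hlt => ?_⟩
    · rw [hext Y ⟨j, hj⟩]
      exact (hL _).1 (hY.2 _)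
    · by_contra hno
      push Not at hno
      have : Y ⟨j, hj⟩ = Y ⟨j', hj'⟩ := by
        funext x
        have := hno x x.2
        rw [hext Y ⟨j, hj⟩, hext Y ⟨j', hj'⟩, natString_fin, natString_fin] at this
        exact Fin.ext this
      have := Fin.mk.inj (hY.1 this)
      omega
  have hextfin : ∀ Y (j : Fin E.K) (x : Fin E.r), ext Y j x = (Y j x : ℕ) :=
    fun Y j x => by rw [hext, natString_fin]
  rcases h with ⟨h1, X, hX, hout, hopt⟩ | ⟨h0, hno⟩
  · left
    let X' : Fin E.K → Fin E.r → Fin σ :=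
      fun j x => ⟨X j x, hσ _ (hX.1 j j.2) x x.2⟩
    refine ⟨X', ⟨fun j j' hjj => ?_, fun j => ?_⟩, fun Y hY => ?_, fun i hi => ?_⟩
    · by_contra hne
      obtain ⟨x, hx, hx'⟩ := hX.ne j.2 j'.2 fun h => hne (Fin.ext h)
      exact hx' (Fin.mk.inj (congrFun hjj ⟨x, hx⟩))
    · refine (hL _).2 ((hX.1 j j.2).congr fun x hx => ?_)
      simp [natString, hx, X']
    · have := hopt _ (hvalid Y hY)
      rw [hdiv Y _ (hextfin Y), hdiv X' X fun _ _ => rfl] at this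
      nlinarith
    · rcases i with _ | i
      · exact h1
      · simp only [concatStrings_eq, List.length_cons, List.length_ofFn] at hi
        simp only [concatStrings_eq, List.getElem_cons_succ, List.getElem_ofFn]
        have hr : 0 < E.r := by
          by_contra h
          have : E.r = 0 := by omega
          rw [this] at hi
          omega
        have := hout (i / E.r) (Nat.div_lt_of_lt_mul (by rw [mul_comm]; omega)) (i % E.r)
          (Nat.mod_lt _ hr)
        rw [Nat.div_add_mod' i E.r, add_comm 1] at this
        exact this
  · right
    exact ⟨h0, fun ⟨Y, hY⟩ => hno ⟨_, hvalid Y hY⟩⟩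

/-- The automaton accepts from each state `v` satisfying `Good` the strings of the language `Λ v`. -/
structure Core.Recognizes (E : Core) {σ : ℕ} (Good : ℕ → Prop)
    (Λ : ℕ → Set (List (_root_.Fin σ))) : Prop where
  good_s : Good E.s
  nil_mem : ∀ v, Good v → ([] ∈ Λ v ↔ E.acc v ≠ 0)
  cons_mem : ∀ v, Good v → ∀ c z,
    c :: z ∈ Λ v ↔ ∃ i < E.M, E.src i = v ∧ E.lab i = c ∧ z ∈ Λ (E.tgt i)
  edge : ∀ i < E.M, Good (E.src i) → E.lab i < σ ∧ Good (E.tgt i)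

theorem Core.Recognizes.reads_iff {E : Core} {σ : ℕ} {Good : ℕ → Prop}
    {Λ : ℕ → Set (List (_root_.Fin σ))} (hE : E.Recognizes Good Λ) {Y : ℕ → ℕ} {R : ℕ} :
    ∀ {v : ℕ}, Good v → R ≤ E.r → (E.Reads v R Y ↔
      ∃ z ∈ Λ v, z.length = R ∧ ∀ (i : ℕ) (h : i < z.length), Y (E.r - R + i) = z[i]) := by
  induction R with
  | zero =>
    intro v hv _
    refine (hE.nil_mem v hv).symm.trans ⟨fun h => ⟨[], h, rfl, fun i hi => by simp at hi⟩, ?_⟩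
    rintro ⟨z, hz, hl, -⟩
    rwa [List.length_eq_zero_iff.1 hl] at hz
  | succ R ih =>
    intro v hv hR
    constructor
    · rintro ⟨i, hi, hs, hl, ht⟩
      obtain ⟨hlt, hgood⟩ := hE.edge i hi (by rwa [hs])
      obtain ⟨z, hz, hzl, hzY⟩ := (ih hgood (by omega)).1 ht
      refine ⟨⟨E.lab i, hlt⟩ :: z, (hE.cons_mem v hv _ _).2 ⟨i, hi, hs, rfl, hz⟩, by simp [hzl],
        fun k hk => ?_⟩
      rcases k with _ | k
      · exact hl.symm
      · rw [List.getElem_cons_succ, ← hzY k (by simpa using hk)]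
        congr 1
        omega
    · rintro ⟨z, hz, hzl, hzY⟩
      rcases z with _ | ⟨c, z⟩
      · simp at hzl
      obtain ⟨i, hi, hs, hl, ht⟩ := (hE.cons_mem v hv c z).1 hz
      simp only [List.length_cons] at hzl hzY
      refine ⟨i, hi, hs, ?_, (ih (hE.edge i hi (by rwa [hs])).2 (by omega)).2
        ⟨z, ht, by omega, fun k hk => ?_⟩⟩
      · have := hzY 0 (by omega)
        rw [List.getElem_cons_zero, Nat.add_zero] at this
        rw [hl, this]
      · have := hzY (k + 1) (by omega)
        rw [List.getElem_cons_succ] at this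
        rw [← this]
        congr 1
        omega

theorem Core.Recognizes.lt_of_inLang {E : Core} {σ : ℕ} {Good : ℕ → Prop}
    {Λ : ℕ → Set (List (_root_.Fin σ))} (hE : E.Recognizes Good Λ) {Y : ℕ → ℕ} (h : E.InLang Y)
    {i : ℕ} (hi : i < E.r) : Y i < σ := by
  obtain ⟨z, -, hl, hY⟩ := (hE.reads_iff hE.good_s le_rfl).1 h
  have := hY i (by omega)
  rw [Nat.sub_self, Nat.zero_add] at this
  rw [this]
  exact z[i].2

theorem Core.Recognizes.ofFn_mem_iff {E : Core} {σ r : ℕ} {Good : ℕ → Prop}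
    {Λ : ℕ → Set (List (_root_.Fin σ))} (hE : E.Recognizes Good Λ) (hr : E.r = r)
    (y : _root_.Fin r → _root_.Fin σ) : List.ofFn y ∈ Λ E.s ↔ E.InLang (natString y) := by
  subst hr
  rw [InLang, hE.reads_iff hE.good_s le_rfl]
  constructor
  · intro h
    refine ⟨_, h, by simp, fun i hi => ?_⟩
    simp only [List.length_ofFn] at hi
    simp [natString, hi]
  · rintro ⟨z, hz, hl, hY⟩
    have : List.ofFn y = z := by
      refine List.ext_getElem (by simp [hl]) fun i h1 h2 => ?_
      have := hY i h2
      rw [Nat.sub_self, Nat.zero_add, natString, dif_pos (by omega)] at this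
      rw [List.getElem_ofFn]
      exact Fin.ext this
    rwa [this]

/-! ### Diverse strings of a labelled acyclic graph -/

namespace SigmaDAG

variable {V A : Type} (G : SigmaDAG V A)

/-- There is a path from `u` to `v`. -/
def Reach (u v : V) : Prop := Relation.ReflTransGen (fun u u' => ∃ a, (u, a, u') ∈ G.E) u v

theorem card_le [Fintype V] : Fintype.card V ≤ G.E.card + 1 := by
  classical
  have hsub : (univ : Finset V).erase G.s ⊆ G.E.image fun e => e.2.2 := by
    intro v hv
    rcases Relation.ReflTransGen.cases_tail (G.from_source v) with h | ⟨u, -, a, hu⟩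
    · exact absurd h (Finset.ne_of_mem_erase hv)
    · exact mem_image.2 ⟨(u, a, v), hu, rfl⟩
  have h1 := (card_le_card hsub).trans card_image_le
  rw [card_erase_of_mem (mem_univ _), card_univ] at h1
  omega

variable {G}

theorem spells_nil_iff {u v : V} : G.Spells u [] v ↔ u = v :=
  ⟨fun h => by cases h; rfl, fun h => h ▸ .nil u⟩

theorem spells_cons_iff {u w : V} {a : A} {y : List A} :
    G.Spells u (a :: y) w ↔ ∃ v, (u, a, v) ∈ G.E ∧ G.Spells v y w :=
  ⟨fun h => by cases h with | cons he hy => exact ⟨_, he, hy⟩, fun ⟨_, he, hy⟩ => .cons he hy⟩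

theorem exists_spells {u v : V} (h : G.Reach u v) : ∃ y, G.Spells u y v := by
  induction h using Relation.ReflTransGen.head_induction_on with
  | refl => exact ⟨[], .nil v⟩
  | head h _ ih =>
    obtain ⟨a, ha⟩ := h
    obtain ⟨y, hy⟩ := ih
    exact ⟨a :: y, .cons ha hy⟩

open Classical in
/-- Along each edge of an acyclic graph the set of reachable vertices shrinks. -/
theorem Spells.length_add_le [Fintype V] {u v : V} {y : List A} (h : G.Spells u y v) :
    y.length + (univ.filter (G.Reach v)).card ≤ (univ.filter (G.Reach u)).card := by
  induction h with
  | nil v => simp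
  | @cons u v v' a y he _ ih =>
    have hlt : (univ.filter (G.Reach v)).card < (univ.filter (G.Reach u)).card := by
      refine card_lt_card ((ssubset_iff_of_subset fun w hw => ?_).2 ⟨u, ?_, fun hu => ?_⟩)
      · simp only [mem_filter, mem_univ, true_and] at hw ⊢
        exact Relation.ReflTransGen.head ⟨a, he⟩ hw
      · simp only [mem_filter, mem_univ, true_and]
        exact Relation.ReflTransGen.refl
      · simp only [mem_filter, mem_univ, true_and] at hu
        exact G.acyclic u (Relation.TransGen.head' ⟨a, he⟩ hu)
    rw [List.length_cons]
    omega

end SigmaDAG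

theorem DagInstance.card_E (x : DagInstance) : x.G.E.card = x.edges.length := by
  rw [← List.toFinset_card_of_nodup x.edges_nodup]
  congr 1
  ext e
  rw [List.mem_toFinset, x.mem_edges]

theorem DagInstance.n_le (x : DagInstance) : x.n ≤ x.edges.length + 1 := by
  have h := x.G.card_le
  rwa [Fintype.card_fin, x.card_E] at h

theorem DagInstance.r_le (x : DagInstance) : x.r ≤ x.n := by
  classical
  obtain ⟨y, hy⟩ := SigmaDAG.exists_spells (x.G.from_source x.G.t)
  have h := hy.length_add_le
  rw [x.equiLength y hy] at h
  have h1 := card_filter_le (univ : Finset (Fin x.n)) (x.G.Reach x.G.s)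
  rw [card_univ, Fintype.card_fin] at h1
  omega

/-- The automaton whose states and edges are those of the graph. -/
structure Core.IsDag (E : Core) (x : DagInstance) : Prop where
  s_eq : E.s = x.G.s
  r_eq : E.r = x.r
  length_le : x.edges.length ≤ E.M
  edge : ∀ (i : ℕ) (h : i < x.edges.length), E.src i = x.edges[i].1 ∧
    E.lab i = x.edges[i].2.1 ∧ E.tgt i = x.edges[i].2.2
  src_ge : ∀ i < E.M, x.edges.length ≤ i → x.n ≤ E.src i
  acc_iff : ∀ v : _root_.Fin x.n, E.acc v ≠ 0 ↔ v = x.G.t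

theorem Core.IsDag.recognizes {E : Core} {x : DagInstance} (hE : E.IsDag x) :
    E.Recognizes (fun v => v < x.n) fun v =>
      {z : List (_root_.Fin x.σ) | ∃ h : v < x.n, x.G.Spells ⟨v, h⟩ z x.G.t} where
  good_s := by rw [hE.s_eq]; exact x.G.s.2
  nil_mem v hv := by
    rw [hE.acc_iff ⟨v, hv⟩, ← SigmaDAG.spells_nil_iff]
    exact ⟨fun ⟨_, h⟩ => h, fun h => ⟨hv, h⟩⟩
  cons_mem v hv c z := by
    constructor
    · rintro ⟨_, h⟩
      obtain ⟨u, he, hz⟩ := SigmaDAG.spells_cons_iff.1 h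
      obtain ⟨i, hi, hie⟩ := List.getElem_of_mem ((x.mem_edges _).2 he)
      obtain ⟨e1, e2, e3⟩ := hE.edge i hi
      rw [hie] at e1 e2 e3
      refine ⟨i, lt_of_lt_of_le hi hE.length_le, e1, e2, ?_⟩
      rw [e3]
      exact ⟨_, hz⟩
    · rintro ⟨i, hi, hs, hl, ht, hz⟩
      have hlen : i < x.edges.length := by
        by_contra h
        have := hE.src_ge i hi (by omega)
        omega
      obtain ⟨e1, e2, e3⟩ := hE.edge i hlen
      refine ⟨hv, .cons ?_ hz⟩
      rw [← x.mem_edges]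
      have h1 : x.edges[i].1 = ⟨v, hv⟩ := Fin.ext (e1.symm.trans hs)
      have h2 : x.edges[i].2.1 = c := Fin.ext (e2.symm.trans hl)
      have h3 : x.edges[i].2.2 = ⟨E.tgt i, ht⟩ := Fin.ext e3.symm
      rw [← h1, ← h2, ← h3]
      exact List.getElem_mem hlen
  edge i hi hv := by
    have hlen : i < x.edges.length := by
      by_contra h
      have := hE.src_ge i hi (by omega)
      omega
    obtain ⟨e1, e2, e3⟩ := hE.edge i hlen
    rw [e2, e3]
    exact ⟨x.edges[i].2.1.2, x.edges[i].2.2.2⟩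

theorem Core.IsDag.mem_language_iff {E : Core} {x : DagInstance} (hE : E.IsDag x)
    (y : _root_.Fin x.r → _root_.Fin x.σ) :
    List.ofFn y ∈ x.G.language ↔ E.InLang (natString y) := by
  rw [← hE.recognizes.ofFn_mem_iff hE.r_eq]
  simp only [hE.s_eq]
  exact ⟨fun h => ⟨x.G.s.2, h⟩, fun ⟨_, h⟩ => h⟩

/-! ### The search on a labelled acyclic graph -/

/-- The tables of the automaton of a graph; a row behind the last edge starts in the vertex `n`,
which does not exist. -/
noncomputable def Mem.tabDag (m : Mem) : Mem :=
  (((m.tab 3 fun m i => if i < m.arr 0 8 then m.arr 0 (3 * i + 9) else m.arr 0 4).tab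
    4 fun m i => if i < m.arr 0 8 then m.arr 0 (3 * i + 10) else 0).tab
    5 fun m i => if i < m.arr 0 8 then m.arr 0 (3 * i + 11) else 0).tab
    6 fun m v => if v = m.arr 0 7 then 1 else 0

theorem isProg_tabDag : IsProg Mem.tabDag := by
  unfold Mem.tabDag
  exact IsProg.comp (IsProg.comp (IsProg.comp (IsProg.tab 3 _) (IsProg.tab 4 _)) (IsProg.tab 5 _))
    (IsProg.tab 6 _)

theorem Mem.tab_arr_of_input {m : Mem} {a : ℕ} (ha : a ≠ 0) {f : (ℕ → ℕ) → ℕ → ℕ} {i : ℕ}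
    (hi : i < m.C) (hD : f (m.arr 0) i < m.D) :
    (m.tab a fun m => f (m.arr 0)).arr a i = f (m.arr 0) i := by
  have h : ∀ k, (m.tabUpTo a (fun m => f (m.arr 0)) k).arr 0 = m.arr 0 := fun k =>
    m.tabUpTo_arr_ne _ _ (Ne.symm ha)
  rw [m.tab_arr a _ hi, h, cap_of_lt hD]

theorem Mem.tabDag_spec {m : Mem} (hCD : m.C < m.D) (hm : ∀ i, m.arr 0 i < m.D) :
    m.tabDag.C = m.C ∧ m.tabDag.D = m.D ∧
    (∀ a, a ≠ 3 → a ≠ 4 → a ≠ 5 → a ≠ 6 → m.tabDag.arr a = m.arr a) ∧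
    ∀ i < m.C,
      m.tabDag.arr 3 i = (if i < m.arr 0 8 then m.arr 0 (3 * i + 9) else m.arr 0 4) ∧
      m.tabDag.arr 4 i = (if i < m.arr 0 8 then m.arr 0 (3 * i + 10) else 0) ∧
      m.tabDag.arr 5 i = (if i < m.arr 0 8 then m.arr 0 (3 * i + 11) else 0) ∧
      m.tabDag.arr 6 i = if i = m.arr 0 7 then 1 else 0 := by
  let f₃ : (ℕ → ℕ) → ℕ → ℕ := fun a i => if i < a 8 then a (3 * i + 9) else a 4
  let f₄ : (ℕ → ℕ) → ℕ → ℕ := fun a i => if i < a 8 then a (3 * i + 10) else 0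
  let f₅ : (ℕ → ℕ) → ℕ → ℕ := fun a i => if i < a 8 then a (3 * i + 11) else 0
  let f₆ : (ℕ → ℕ) → ℕ → ℕ := fun a v => if v = a 7 then 1 else 0
  set m₃ := m.tab 3 fun m => f₃ (m.arr 0) with h₃
  set m₄ := m₃.tab 4 fun m => f₄ (m.arr 0) with h₄
  set m₅ := m₄.tab 5 fun m => f₅ (m.arr 0) with h₅
  have h₆ : m.tabDag = m₅.tab 6 fun m => f₆ (m.arr 0) := rfl
  have C₃ : m₃.C = m.C := Mem.tab_C _ _ _
  have C₄ : m₄.C = m.C := (Mem.tab_C _ _ _).trans C₃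
  have C₅ : m₅.C = m.C := (Mem.tab_C _ _ _).trans C₄
  have D₃ : m₃.D = m.D := Mem.tab_D _ _ _
  have D₄ : m₄.D = m.D := (Mem.tab_D _ _ _).trans D₃
  have D₅ : m₅.D = m.D := (Mem.tab_D _ _ _).trans D₄
  have n₃ : ∀ a, a ≠ 3 → m₃.arr a = m.arr a := fun a h => m.tab_arr_ne _ h
  have n₄ : ∀ a, a ≠ 4 → m₄.arr a = m₃.arr a := fun a h => m₃.tab_arr_ne _ h
  have n₅ : ∀ a, a ≠ 5 → m₅.arr a = m₄.arr a := fun a h => m₄.tab_arr_ne _ h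
  have n₆ : ∀ a, a ≠ 6 → m.tabDag.arr a = m₅.arr a := fun a h => m₅.tab_arr_ne _ h
  have z₃ : m₃.arr 0 = m.arr 0 := n₃ 0 (by omega)
  have z₄ : m₄.arr 0 = m.arr 0 := (n₄ 0 (by omega)).trans z₃
  have z₅ : m₅.arr 0 = m.arr 0 := (n₅ 0 (by omega)).trans z₄
  have hb₃ : ∀ i, f₃ (m.arr 0) i < m.D := fun i => by simp only [f₃]; split <;> exact hm _
  have hb₄ : ∀ i, f₄ (m.arr 0) i < m.D := fun i => by
    simp only [f₄]; split
    · exact hm _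
    · omega
  have hb₅ : ∀ i, f₅ (m.arr 0) i < m.D := fun i => by
    simp only [f₅]; split
    · exact hm _
    · omega
  refine ⟨(Mem.tab_C _ _ _).trans C₅, (Mem.tab_D _ _ _).trans D₅, fun a a3 a4 a5 a6 => by
    rw [n₆ a a6, n₅ a a5, n₄ a a4, n₃ a a3], fun i hi => ⟨?_, ?_, ?_, ?_⟩⟩
  · rw [n₆ 3 (by omega), n₅ 3 (by omega), n₄ 3 (by omega), h₃,
      Mem.tab_arr_of_input (by omega) hi (hb₃ i)]
  · rw [n₆ 4 (by omega), n₅ 4 (by omega), h₄,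
      Mem.tab_arr_of_input (by omega) (by omega) (by rw [z₃, D₃]; exact hb₄ i), z₃]
  · rw [n₆ 5 (by omega), h₅,
      Mem.tab_arr_of_input (by omega) (by omega) (by rw [z₄, D₄]; exact hb₅ i), z₄]
  · rw [h₆, Mem.tab_arr_of_input (by omega) (by omega), z₅]
    rw [z₅, D₅]
    simp only [f₆]
    split <;> omega

theorem getD_flatMap_triple {α : Type} (f g h : α → ℕ) (l : List α) : ∀ (i : ℕ) (hi : i < l.length),
    (l.flatMap fun e => [f e, g e, h e]).getD (3 * i) 0 = f l[i] ∧
    (l.flatMap fun e => [f e, g e, h e]).getD (3 * i + 1) 0 = g l[i] ∧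
    (l.flatMap fun e => [f e, g e, h e]).getD (3 * i + 2) 0 = h l[i] := by
  induction l with
  | nil => intro i hi; simp at hi
  | cons e l ih =>
    intro i hi
    rcases i with _ | i
    · simp
    · exact ih i (by simpa using hi)

theorem getD_le_of_forall_mem {l : List ℕ} {N : ℕ} (h : ∀ y ∈ l, y ≤ N) (i : ℕ) :
    l.getD i 0 ≤ N := by
  rcases Nat.lt_or_ge i l.length with hi | hi
  · rw [List.getD_eq_getElem _ _ hi]
    exact h _ (List.getElem_mem hi)
  · rw [List.getD_eq_default _ _ hi]
    exact Nat.zero_le _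

/-- The memory in which the search on a graph starts, when `ε = a / b`. -/
def DagInstance.mem (x : DagInstance) (a b : ℕ) : Mem :=
  initMem [2, 8] (List.range 9) 3 (a :: b :: maxSumDiverseStringSet.input x)

section

variable (x : DagInstance) (a b : ℕ)

theorem DagInstance.mem_cells :
    (x.mem a b).arr 0 0 = a ∧ (x.mem a b).arr 0 1 = b ∧ (x.mem a b).arr 0 2 = x.K ∧
    (x.mem a b).arr 0 3 = x.r ∧ (x.mem a b).arr 0 4 = x.n ∧ (x.mem a b).arr 0 5 = x.σ ∧
    (x.mem a b).arr 0 6 = x.G.s ∧ (x.mem a b).arr 0 7 = x.G.t ∧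
    (x.mem a b).arr 0 8 = x.edges.length :=
  ⟨rfl, rfl, rfl, rfl, rfl, rfl, rfl, rfl, rfl⟩

theorem DagInstance.mem_edge (i : ℕ) (hi : i < x.edges.length) :
    (x.mem a b).arr 0 (3 * i + 9) = x.edges[i].1 ∧
    (x.mem a b).arr 0 (3 * i + 10) = x.edges[i].2.1 ∧
    (x.mem a b).arr 0 (3 * i + 11) = x.edges[i].2.2 :=
  getD_flatMap_triple (fun e : Fin x.n × Fin x.σ × Fin x.n => (e.1 : ℕ)) (fun e => (e.2.1 : ℕ))
    (fun e => (e.2.2 : ℕ)) x.edges i hi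

theorem DagInstance.mem_C : (x.mem a b).C = (x.K + x.edges.length + 5) ^ (3 * (4 * b + 2) ^ 2) :=
  rfl

theorem DagInstance.mem_D : (x.mem a b).D = (x.mem a b).C
    + (a + b + x.K + x.r + x.n + x.σ + x.G.s + x.G.t + x.edges.length + 1) := by
  have h : (x.mem a b).D = (x.mem a b).C + (a + (b + (x.K + (x.r + (x.n + (x.σ + (x.G.s + (x.G.t
    + (x.edges.length + 0)))))))) + 1) := rfl
  omega

theorem DagInstance.mem_lt (i : ℕ) : (x.mem a b).arr 0 i < (x.mem a b).D := by
  have h : (x.mem a b).arr 0 i ≤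
      a + b + x.K + x.r + x.n + x.σ + x.G.s + x.G.t + x.edges.length := by
    refine getD_le_of_forall_mem (fun y hy => ?_) i
    simp only [maxSumDiverseStringSet, List.mem_cons, List.mem_flatMap, List.not_mem_nil,
      or_false] at hy
    rcases hy with h | h | h | h | h | h | h | h | h | ⟨e, -, h | h | h⟩ <;> omega
  rw [x.mem_D]
  omega

theorem DagInstance.mem_bounded : (x.mem a b).Bounded := by
  refine ⟨by rw [x.mem_D]; omega, fun i j => ?_⟩
  rcases eq_or_ne i 0 with rfl | hi
  · exact (x.mem_lt a b j).le
  · change (if i = 0 then _ else 0) ≤ _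
    rw [if_neg hi]
    exact Nat.zero_le _

end

theorem DagInstance.search_spec (x : DagInstance) {a b : ℕ} (ha : 1 ≤ a) (hb : 1 ≤ b) {m : Mem}
    (hm : m = (x.mem a b).tabDag.solve 3 (fun m => inputSum [2, 8] 5 (m.arr 0))
      (fun m => m.arr 0 6) fun m => m.arr 0 3) :
    (∃ X : Fin x.K → Fin x.r → Fin x.σ, IsSubsetOfCard x.G.language X ∧
      (∀ Y : Fin x.K → Fin x.r → Fin x.σ, IsSubsetOfCard x.G.language Y →
        b * sumDiversity Y ≤ b * sumDiversity X + a * sumDiversity Y) ∧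
      State.Outputs ⟨fun _ => 0, m.arr⟩ (1 :: concatStrings X)) ∨
    (m.arr 1 0 = 0 ∧ ¬ ∃ Y : Fin x.K → Fin x.r → Fin x.σ, IsSubsetOfCard x.G.language Y) := by
  set m₀ := x.mem a b with hm₀
  obtain ⟨c0, c1, c2, c3, c4, c5, c6, c7, c8⟩ := x.mem_cells a b
  rw [← hm₀] at c0 c1 c2 c3 c4 c5 c6 c7 c8
  have hC := x.mem_C a b
  have hD := x.mem_D a b
  have hlt := x.mem_lt a b
  rw [← hm₀] at hC hD hlt
  obtain ⟨t1, t2, t3, t4⟩ := Mem.tabDag_spec (m := m₀) (by omega) hlt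
  set m₁ := m₀.tabDag with hm₁
  have z : m₁.arr 0 = m₀.arr 0 := t3 0 (by omega) (by omega) (by omega) (by omega)
  set B := x.K + x.edges.length + 5 with hB
  have hBm : inputSum [2, 8] 5 (m₀.arr 0) = B := by
    simp only [inputSum, List.map_cons, List.map_nil, List.sum_cons, List.sum_nil, c2, c8]
    omega
  have hBB : B * B ≤ B ^ 3 := by
    rw [← pow_two]; exact Nat.pow_le_pow_right (by omega) (by omega)
  have hB3 : B ≤ B * B := Nat.le_mul_self B
  have hn := x.n_le
  have hr := x.r_le
  have hMC : B ^ 3 ≤ m₀.C := by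
    rw [hC]
    exact Nat.pow_le_pow_right (by omega) (Nat.le_mul_of_pos_right _ (by positivity))
  have hs := x.G.s.2
  have ht := x.G.t.2
  have hsol := Mem.solve_spec (m := m₁) (e := 3) (B := fun m => inputSum [2, 8] 5 (m.arr 0))
    (s := fun m => m.arr 0 6) (r := fun m => m.arr 0 3)
    (fun m' _ _ h => by simp only [h 0 (by omega) (by omega) (by omega)])
    (fun m' _ _ h => by simp only [h 0 (by omega) (by omega) (by omega)])
    (fun m' _ _ h => by simp only [h 0 (by omega) (by omega) (by omega)])
    (by omega)
  simp only [z, hBm, c0, c1, c2, c3, c6, t1, t2] at hsol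
  obtain ⟨E, ⟨e1, e2, e3, e4, e5, e6, e7, e8⟩, hE⟩ := hsol ha hb hC (by omega) (by omega)
    (by omega) (by omega) (by omega) x.one_le_K
    ((Nat.mul_lt_mul_of_lt_of_le (by omega) (by omega : x.r ≤ B) (by omega)).trans_le hBB)
    (fun i hi => by
      rw [(t4 i (by omega)).2.2.1, c8]
      split
      · rw [(x.mem_edge a b i ‹_›).2.2]
        have := x.edges[i].2.2.2
        omega
      · omega)
    (fun i hi => by
      rw [(t4 i (by omega)).2.1]
      split
      · exact hlt _
      · omega)
    (fun q => by rw [t3 8 (by omega) (by omega) (by omega) (by omega)]; rfl)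
    (by rw [t3 13 (by omega) (by omega) (by omega) (by omega)]; rfl)
  have hdag : E.IsDag x :=
    { s_eq := e3
      r_eq := e4
      length_le := by omega
      edge := fun i hi => by
        obtain ⟨u1, u2, u3, -⟩ := t4 i (by omega)
        obtain ⟨v1, v2, v3⟩ := x.mem_edge a b i hi
        rw [c8, if_pos hi] at u1 u2 u3
        rw [e5, e6, e7]
        exact ⟨u1.trans v1, u2.trans v2, u3.trans v3⟩
      src_ge := fun i hi hge => by
        obtain ⟨u1, -⟩ := t4 i (by omega)
        rw [c8, if_neg (by omega), c4] at u1
        rw [e5, u1]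
      acc_iff := fun v => by
        have hv := v.2
        obtain ⟨-, -, -, u4⟩ := t4 v (by omega)
        rw [e8, u4, c7, Fin.ext_iff]
        simp }
  rw [hm]
  exact search_answer e2 e4 hdag.mem_language_iff
    (fun y hy i hi => hdag.recognizes.lt_of_inLang hy (by rwa [e4])) hE

theorem DagInstance.inputSum_le (x : DagInstance) (a b : ℕ) :
    inputSum [2, 8] 5 ((x.mem a b).arr 0) ≤ 5 * (x.G.E.card + x.K) + 5 := by
  have h : inputSum [2, 8] 5 ((x.mem a b).arr 0) = x.K + (x.edges.length + 0) + 5 := rfl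
  rw [h, x.card_E]
  omega

theorem admitsPTAS_maxSumDiverseStringSet : AdmitsPTAS maxSumDiverseStringSet := by
  refine admitsPTAS_of (idxB := [2, 8]) (idxD := List.range 9) (e := 3) (A := 5)
    (IsProg.comp isProg_tabDag (isProg_solve 3 (fun m => inputSum [2, 8] 5 (m.arr 0))
      (fun m => m.arr 0 6) fun m => m.arr 0 3)) (by omega)
    (fun x a b => DagInstance.inputSum_le x a b)
    (fun x a b => DagInstance.mem_bounded x a b)
    (fun x a b ha hb m hm => DagInstance.search_spec x ha hb hm)

/-! ### Longest common subsequences as the strings of an automaton -/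

/-- A string that begins with `c` is a subsequence of the suffix of length `P` if and only if its rest
is a subsequence of a suffix of length `q < P` that `c` precedes. -/
theorem cons_sublist_drop_iff {A : Type} (l : List A) (c : A) (z : List A) : ∀ {P : ℕ},
    P ≤ l.length → ((c :: z).Sublist (l.drop (l.length - P)) ↔
      ∃ q < P, l[l.length - 1 - q]? = some c ∧ z.Sublist (l.drop (l.length - q))) := by
  intro P
  induction P with
  | zero => simp
  | succ P ih =>
    intro hP
    have hlt : l.length - (P + 1) < l.length := by omega
    rw [List.drop_eq_getElem_cons hlt, List.cons_sublist_cons',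
      show l.length - (P + 1) + 1 = l.length - P by omega, ih (by omega)]
    have hget : l[l.length - 1 - P]? = some l[l.length - (P + 1)] := by
      rw [List.getElem?_eq_some_iff]
      exact ⟨by omega, by congr 1; omega⟩
    constructor
    · rintro (⟨q, hq, h⟩ | ⟨rfl, h⟩)
      · exact ⟨q, by omega, h⟩
      · exact ⟨P, by omega, hget, h⟩
    · rintro ⟨q, hq, h1, h2⟩
      rcases Nat.lt_succ_iff_lt_or_eq.1 hq with hq | rfl
      · exact Or.inl ⟨q, hq, h1, h2⟩
      · rw [hget] at h1
        exact Or.inr ⟨(Option.some.inj h1).symm, h2⟩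

theorem sum_digits (B c : ℕ) (n : ℕ) : ∑ k ∈ range n, c / B ^ k % B * B ^ k = c % B ^ n := by
  induction n with
  | zero => simp [Nat.mod_one]
  | succ n ih => rw [sum_range_succ, ih, Nat.mod_pow_succ, mul_comm]

theorem least_le_of {N : ℕ} {q : ℕ → Prop} {x : ℕ} (hx : x < N) (hq : q x) : least N q ≤ x := by
  classical
  unfold least
  calc ∑ y ∈ range N, (if ∃ z, z < N ∧ z ≤ y ∧ q z then 0 else 1)
      ≤ ∑ y ∈ range N, if y < x then 1 else 0 := by
        refine sum_le_sum fun y _ => ?_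
        by_cases h : y < x
        · rw [if_pos h]; split <;> omega
        · rw [if_neg h, if_pos ⟨x, hx, by omega, hq⟩]
    _ = x := by
        rw [sum_boole, Nat.cast_id]
        have : filter (fun y => y < x) (range N) = range x := by
          ext y
          simp only [mem_filter, mem_range]
          omega
        rw [this, card_range]

namespace LcsInstance

variable {m : ℕ} (x : LcsInstance m)

/-- The codes, by their digits in base `B`, of tuples of lengths of suffixes of the strings. -/
def Good (B v : ℕ) : Prop := v < B ^ m ∧ ∀ k : Fin m, v / B ^ (k : ℕ) % B ≤ (x.S k).length

/-- The common subsequences of the suffixes with the lengths coded by `v`. -/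
def suffixCS (B v : ℕ) : Set (List (Fin x.σ)) :=
  {z | ∀ k : Fin m, z.Sublist ((x.S k).drop ((x.S k).length - v / B ^ (k : ℕ) % B))}

/-- The edge `i` codes a pair of tuples such that each suffix in the first one has a longer suffix
than the one in the second, and the symbol before the shorter suffix is the same for all strings. -/
def IsEdge (m B i : ℕ) : Prop :=
  i < B ^ m * B ^ m ∧ ∀ k : Fin m,
    i % B ^ m / B ^ (k : ℕ) % B < i / B ^ m / B ^ (k : ℕ) % B

/-- The code of the tuple of the whole strings. -/
def full (B : ℕ) : ℕ := ∑ k : Fin m, (x.S k).length * B ^ (k : ℕ)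

/-- The symbol of string `k` before the suffix whose length is digit `k` of `Q`. -/
def symbol (B Q : ℕ) (k : Fin m) : Option (Fin x.σ) :=
  (x.S k)[(x.S k).length - 1 - Q / B ^ (k : ℕ) % B]?

variable {x}

theorem good_full {B : ℕ} (hB : ∀ k, (x.S k).length < B) : x.Good B (x.full B) ∧
    ∀ k : Fin m, x.full B / B ^ (k : ℕ) % B = (x.S k).length := by
  let f : ℕ → ℕ := fun k => if h : k < m then (x.S ⟨k, h⟩).length else 0
  have hf : ∀ k : Fin m, f k = (x.S k).length := fun k => by simp [f]
  have hfB : ∀ k < m, f k < B := fun k hk => by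
    have := hf ⟨k, hk⟩
    simp only at this
    rw [this]
    exact hB _
  have hfull : x.full B = ∑ k ∈ range m, f k * B ^ k := by
    rw [full, sum_range]
    exact sum_congr rfl fun k _ => by rw [hf]
  have hdig : ∀ k : Fin m, x.full B / B ^ (k : ℕ) % B = (x.S k).length := fun k => by
    have := digit_of_sum hfB 0 k.2
    rw [zero_mul, zero_add, ← hfull, hf] at this
    exact this
  refine ⟨⟨?_, fun k => (hdig k).le⟩, hdig⟩
  rw [hfull]
  exact sum_mul_pow_lt hfB

theorem suffixCS_full {B : ℕ} (hB : ∀ k, (x.S k).length < B) :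
    x.suffixCS B (x.full B) = {z | IsCS x.S z} := by
  ext z
  simp only [suffixCS, (good_full hB).2, Nat.sub_self, List.drop_zero]
  rfl

theorem length_le_of_mem_suffixCS {B v : ℕ} {z : List (Fin x.σ)} (h : z ∈ x.suffixCS B v)
    (k : Fin m) : z.length ≤ (x.S k).length :=
  (h k).length_le.trans (by simp)

theorem cons_mem_suffixCS_iff {B v : ℕ} (hB : ∀ k, (x.S k).length < B) (hv : x.Good B v)
    {c : Fin x.σ} {z : List (Fin x.σ)} : c :: z ∈ x.suffixCS B v ↔
      ∃ Q, IsEdge m B (v * B ^ m + Q) ∧ Q < B ^ m ∧ (∀ k, x.symbol B Q k = some c) ∧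
        z ∈ x.suffixCS B Q := by
  have hdm : ∀ Q < B ^ m, (v * B ^ m + Q) % B ^ m = Q ∧ (v * B ^ m + Q) / B ^ m = v := by
    intro Q hQ
    rw [mul_comm, Nat.mul_add_mod, Nat.mod_eq_of_lt hQ, Nat.mul_add_div (by omega),
      Nat.div_eq_of_lt hQ]
    exact ⟨rfl, rfl⟩
  constructor
  · intro h
    have h1 : ∀ k : Fin m, ∃ q < v / B ^ (k : ℕ) % B,
        (x.S k)[(x.S k).length - 1 - q]? = some c ∧
          z.Sublist ((x.S k).drop ((x.S k).length - q)) :=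
      fun k => (cons_sublist_drop_iff _ _ _ (hv.2 k)).1 (h k)
    choose q hq1 hq2 hq3 using h1
    let f : ℕ → ℕ := fun k => if h : k < m then q ⟨k, h⟩ else 0
    have hf : ∀ k : Fin m, f k = q k := fun k => by simp [f]
    have hfB : ∀ k < m, f k < B := fun k hk => by
      have := hf ⟨k, hk⟩
      simp only at this
      rw [this]
      exact (hq1 _).trans_le ((hv.2 _).trans (hB _).le)
    have hdig : ∀ k : Fin m, (∑ j ∈ range m, f j * B ^ j) / B ^ (k : ℕ) % B = q k := fun k => by
      have := digit_of_sum hfB 0 k.2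
      rw [zero_mul, zero_add, hf] at this
      exact this
    have hQ := sum_mul_pow_lt hfB
    refine ⟨∑ j ∈ range m, f j * B ^ j, ⟨?_, fun k => ?_⟩, hQ, fun k => ?_, fun k => ?_⟩
    · have : (v + 1) * B ^ m ≤ B ^ m * B ^ m := Nat.mul_le_mul_right _ hv.1
      rw [Nat.add_one_mul] at this
      omega
    · rw [(hdm _ hQ).1, (hdm _ hQ).2, hdig]
      exact hq1 k
    · rw [symbol, hdig]
      exact hq2 k
    · rw [hdig]
      exact hq3 k
  · rintro ⟨Q, ⟨-, he⟩, hQ, hs, hz⟩ k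
    refine (cons_sublist_drop_iff _ _ _ (hv.2 k)).2 ⟨Q / B ^ (k : ℕ) % B, ?_, hs k, hz k⟩
    have := he k
    rwa [(hdm Q hQ).1, (hdm Q hQ).2] at this

/-- Along an edge the code decreases. -/
theorem IsEdge.lt (hm : 1 ≤ m) {B i : ℕ} (h : IsEdge m B i) : i % B ^ m < i / B ^ m := by
  have hBm : 0 < B ^ m := by
    by_contra h0
    have : B ^ m = 0 := by omega
    have := h.1
    simp_all
  have hB : 0 < B := by
    by_contra h0
    have : B = 0 := by omega
    rw [this, zero_pow (by omega)] at hBm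
    omega
  have e1 : i % B ^ m = ∑ k ∈ range m, i % B ^ m / B ^ k % B * B ^ k := by
    rw [sum_digits, Nat.mod_mod]
  have e2 : i / B ^ m = ∑ k ∈ range m, i / B ^ m / B ^ k % B * B ^ k := by
    rw [sum_digits, Nat.mod_eq_of_lt (Nat.div_lt_of_lt_mul h.1)]
  rw [e1, e2]
  refine sum_lt_sum_of_nonempty ⟨0, mem_range.2 hm⟩ fun k hk => ?_
  exact Nat.mul_lt_mul_of_pos_right (h.2 ⟨k, mem_range.1 hk⟩) (by positivity)

/-- The automaton of the common subsequences: the states are the tuples of lengths of suffixes, an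
edge jumps behind an occurrence of its label in each suffix. Codes that are no edges start in a
state that is not reached. -/
structure IsTable (x : LcsInstance m) (B N : ℕ) (src lab tgt : ℕ → ℕ) : Prop where
  length_lt : ∀ k, (x.S k).length < B
  le_N : B ^ m * B ^ m ≤ N
  tgt_eq : ∀ i < N, tgt i = i % B ^ m
  src_lab : ∀ i < N, (src i = B ^ m ∧ ¬ (x.Good B (i / B ^ m) ∧ IsEdge m B i ∧
      ∃ c, ∀ k, x.symbol B (i % B ^ m) k = some c)) ∨
    (src i = i / B ^ m ∧ IsEdge m B i ∧ (x.Good B (i / B ^ m) →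
      ∃ c, lab i = (c : Fin x.σ) ∧ ∀ k, x.symbol B (i % B ^ m) k = some c))

theorem IsTable.of_src {B N : ℕ} {src lab tgt : ℕ → ℕ} (h : x.IsTable B N src lab tgt)
    {i : ℕ} (hi : i < N) (hg : x.Good B (src i)) : src i = i / B ^ m ∧ IsEdge m B i ∧
      ∃ c, lab i = (c : Fin x.σ) ∧ ∀ k, x.symbol B (i % B ^ m) k = some c := by
  rcases h.src_lab i hi with ⟨h1, -⟩ | ⟨h1, h2, h3⟩
  · have := hg.1
    omega
  · exact ⟨h1, h2, h3 (h1 ▸ hg)⟩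

theorem IsTable.good_tgt {B N : ℕ} {src lab tgt : ℕ → ℕ} (h : x.IsTable B N src lab tgt)
    {i : ℕ} (hi : i < N) (hg : x.Good B (src i)) : x.Good B (tgt i) := by
  obtain ⟨h1, h2, -⟩ := h.of_src hi hg
  rw [h.tgt_eq i hi]
  refine ⟨Nat.mod_lt _ ?_, fun k => (h2.2 k).le.trans ?_⟩
  · have := hg.1; omega
  · rw [← h1]
    exact hg.2 k

theorem IsTable.cons_mem_iff {B N : ℕ} {src lab tgt : ℕ → ℕ} (hm : 1 ≤ m)
    (h : x.IsTable B N src lab tgt) {v : ℕ} (hv : x.Good B v) (c : Fin x.σ)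
    (z : List (Fin x.σ)) : c :: z ∈ x.suffixCS B v ↔
      ∃ i < N, src i = v ∧ lab i = c ∧ z ∈ x.suffixCS B (tgt i) := by
  rw [cons_mem_suffixCS_iff h.length_lt hv]
  constructor
  · rintro ⟨Q, he, hQ, hs, hz⟩
    have e1 : (v * B ^ m + Q) % B ^ m = Q := by
      rw [mul_comm, Nat.mul_add_mod, Nat.mod_eq_of_lt hQ]
    have e2 : (v * B ^ m + Q) / B ^ m = v := by
      rw [mul_comm, Nat.mul_add_div (by omega), Nat.div_eq_of_lt hQ, add_zero]
    have hN : v * B ^ m + Q < N := he.1.trans_le h.le_N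
    have hsrc : src (v * B ^ m + Q) = v := by
      rcases h.src_lab _ hN with ⟨-, h2⟩ | ⟨h1, -⟩
      · rw [e1, e2] at h2
        exact absurd ⟨hv, he, c, hs⟩ h2
      · rw [h1, e2]
    obtain ⟨-, -, c', hl, hc'⟩ := h.of_src hN (by rwa [hsrc])
    refine ⟨_, hN, hsrc, ?_, ?_⟩
    · have h1 := hc' ⟨0, hm⟩
      rw [e1, hs] at h1
      rw [hl, Option.some.inj h1]
    · rw [h.tgt_eq _ hN, e1]
      exact hz
  · rintro ⟨i, hi, hs, hl, hz⟩
    obtain ⟨h1, h2, c', h3, h4⟩ := h.of_src hi (by rwa [hs])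
    have hc : c' = c := Fin.ext (h3.symm.trans hl)
    have hBm : 0 < B ^ m := by have := hv.1; omega
    rw [h.tgt_eq i hi] at hz
    refine ⟨i % B ^ m, ?_, Nat.mod_lt _ hBm, fun k => by rw [h4, hc], hz⟩
    rw [← hs, h1, mul_comm, Nat.div_add_mod]
    exact h2

/-- The longest path table holds the lengths of the longest common subsequences of suffixes. -/
theorem IsTable.isGreatest {B N C : ℕ} {src lab tgt lp : ℕ → ℕ} (hm : 1 ≤ m)
    (h : x.IsTable B N src lab tgt) (hC : B ≤ C)
    (hlp : ∀ v, x.Good B v → lp v = least C fun y => ∀ i < N, src i = v → lp (tgt i) + 1 ≤ y) :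
    ∀ v, x.Good B v → IsGreatest (List.length '' x.suffixCS B v) (lp v) := by
  intro v
  induction v using Nat.strong_induction_on with
  | _ v ih =>
  intro hv
  have hedge : ∀ i < N, src i = v → ∃ c, lab i = (c : Fin x.σ) ∧
      IsGreatest (List.length '' x.suffixCS B (tgt i)) (lp (tgt i)) := by
    intro i hi hs
    obtain ⟨h1, h2, c, h3, -⟩ := h.of_src hi (by rwa [hs])
    refine ⟨c, h3, ih _ ?_ (h.good_tgt hi (by rwa [hs]))⟩
    rw [h.tgt_eq i hi, ← hs, h1]
    exact h2.lt hm
  have hbd : ∀ i < N, src i = v → lp (tgt i) + 1 ≤ (x.S ⟨0, hm⟩).length := by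
    intro i hi hs
    obtain ⟨c, hc, ⟨z, hz, hzl⟩, -⟩ := hedge i hi hs
    have := length_le_of_mem_suffixCS ((h.cons_mem_iff hm hv c z).2 ⟨i, hi, hs, hc, hz⟩) ⟨0, hm⟩
    rw [List.length_cons] at this
    omega
  have hex := least_spec (N := C) (q := fun y => ∀ i < N, src i = v → lp (tgt i) + 1 ≤ y)
    ⟨_, (h.length_lt ⟨0, hm⟩).trans_le hC, hbd⟩
  rw [← hlp v hv] at hex
  constructor
  · by_cases h0 : lp v = 0
    · exact ⟨[], fun k => List.nil_sublist _, by rw [h0]; rfl⟩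
    · obtain ⟨i, hi, hs, hlt⟩ : ∃ i < N, src i = v ∧ lp v - 1 < lp (tgt i) + 1 := by
        by_contra hno
        push Not at hno
        have := least_le_of (N := C) (q := fun y => ∀ i < N, src i = v → lp (tgt i) + 1 ≤ y)
          (x := lp v - 1) (by omega) hno
        rw [← hlp v hv] at this
        omega
      have := hex.2 i hi hs
      obtain ⟨c, hc, ⟨z, hz, hzl⟩, -⟩ := hedge i hi hs
      refine ⟨c :: z, (h.cons_mem_iff hm hv c z).2 ⟨i, hi, hs, hc, hz⟩, ?_⟩
      rw [List.length_cons]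
      omega
  · rintro _ ⟨z, hz, rfl⟩
    rcases z with _ | ⟨c, z⟩
    · exact Nat.zero_le _
    · obtain ⟨i, hi, hs, hl, hz'⟩ := (h.cons_mem_iff hm hv c z).1 hz
      obtain ⟨c', -, -, hup⟩ := hedge i hi hs
      exact (Nat.succ_le_succ (hup ⟨z, hz', rfl⟩)).trans (hex.2 i hi hs)

theorem isGreatest_lcsLength {B R : ℕ} (hB : ∀ k, (x.S k).length < B)
    (h : IsGreatest (List.length '' x.suffixCS B (x.full B)) R) : R = lcsLength x.S := by
  rw [suffixCS_full hB] at h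
  exact h.csSup_eq.symm

theorem mem_LCS_iff {B : ℕ} (hB : ∀ k, (x.S k).length < B)
    (h : IsGreatest (List.length '' x.suffixCS B (x.full B)) (lcsLength x.S))
    (y : Fin (lcsLength x.S) → Fin x.σ) :
    List.ofFn y ∈ LCS x.S ↔ List.ofFn y ∈ x.suffixCS B (x.full B) := by
  rw [suffixCS_full hB] at h ⊢
  refine ⟨fun hy => hy.1, fun hy => ⟨hy, fun z hz => ?_⟩⟩
  rw [List.length_ofFn]
  exact h.2 ⟨z, hz, rfl⟩

theorem IsTable.recognizes {B : ℕ} {E : Core} (hm : 1 ≤ m)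
    (h : x.IsTable B E.M E.src E.lab E.tgt) (hacc : ∀ v, x.Good B v → E.acc v ≠ 0)
    (hs : E.s = x.full B) : E.Recognizes (x.Good B) (x.suffixCS B) where
  good_s := by rw [hs]; exact (good_full h.length_lt).1
  nil_mem v hv := ⟨fun _ => hacc v hv, fun _ k => List.nil_sublist _⟩
  cons_mem v hv c z := h.cons_mem_iff hm hv c z
  edge i hi hg := by
    obtain ⟨-, -, c, hc, -⟩ := h.of_src hi hg
    exact ⟨by rw [hc]; exact c.2, h.good_tgt hi hg⟩

end LcsInstance

/-! ### Diverse longest common subsequences -/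

section Instances

variable {α : Type} [Ctx α]

instance Ev.pow {f : α → ℕ} [Ev f] (n : ℕ) : Ev (fun p => f p ^ n) := by
  induction n with
  | zero => simp only [pow_zero]; infer_instance
  | succ n ih => simp only [pow_succ]; infer_instance

instance Ev.sum_const {f : ℕ → α → ℕ} [∀ k, Ev (f k)] (n : ℕ) :
    Ev (fun p => ∑ k ∈ range n, f k p) := by
  induction n with
  | zero => simp only [sum_range_zero]; infer_instance
  | succ n ih => simp only [sum_range_succ]; infer_instance

instance EvP.forall_const {q : ℕ → α → Prop} [∀ k, EvP (q k)] (n : ℕ) :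
    EvP (fun p => ∀ k, k < n → q k p) := by
  induction n with
  | zero => exact EvP.of_iff (EvP.eq (f := fun _ => 0) (g := fun _ => 0)) fun p => by simp
  | succ n ih =>
    refine EvP.of_iff (EvP.and (q := fun p => ∀ k, k < n → q k p) (q' := q n)) fun p => ?_
    simp only [Nat.forall_lt_succ_right]

end Instances

section Input

variable (n : ℕ) (a : ℕ → ℕ)

/-- The base in which tuples of lengths are coded; the input array `a` holds the number of strings
wanted in cell `2` and the lengths of the `n` strings from cell `4` on. -/
def lcsBase : ℕ := inputSum (2 :: (List.range n).map (4 + ·)) 5 a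

/-- The code of the tuple of the lengths of the strings. -/
def lcsFull : ℕ := ∑ k ∈ range n, a (4 + k) * lcsBase n a ^ k

/-- Symbol `j` of string `k`. -/
def lcsSymbol (k j : ℕ) : ℕ := a (4 + n + ∑ k' ∈ range k, a (4 + k') + j)

/-- The symbol of string `k` before the suffix whose length is digit `k` of `Q`. -/
def lcsChar (k Q : ℕ) : ℕ := lcsSymbol n a k (a (4 + k) - 1 - Q / lcsBase n a ^ k % lcsBase n a)

/-- The code `i` is an edge of the automaton of the common subsequences. -/
def LcsEdge (i : ℕ) : Prop :=
  i < lcsBase n a ^ n * lcsBase n a ^ n ∧ ∀ k, k < n →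
    i % lcsBase n a ^ n / lcsBase n a ^ k % lcsBase n a
      < i / lcsBase n a ^ n / lcsBase n a ^ k % lcsBase n a ∧
    lcsChar n a k (i % lcsBase n a ^ n) = lcsChar n a 0 (i % lcsBase n a ^ n)

open Classical in
/-- The start of edge `i`. -/
noncomputable def lcsSrc (i : ℕ) : ℕ :=
  if LcsEdge n a i then i / lcsBase n a ^ n else lcsBase n a ^ n

end Input

section Instances

variable {α : Type} [Ctx α] {g : α → Mem} [IsMem g] {f : α → ℕ} [Ev f] (n k : ℕ)

instance : Ev (fun p => lcsBase n ((g p).arr 0)) := by unfold lcsBase; infer_instance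
instance : Ev (fun p => lcsFull n ((g p).arr 0)) := by unfold lcsFull; infer_instance
instance : Ev (fun p => lcsSymbol n ((g p).arr 0) k (f p)) := by unfold lcsSymbol; infer_instance
instance : Ev (fun p => lcsChar n ((g p).arr 0) k (f p)) := by unfold lcsChar; infer_instance
instance : EvP (fun p => LcsEdge n ((g p).arr 0) (f p)) := by unfold LcsEdge; infer_instance
instance : Ev (fun p => lcsSrc n ((g p).arr 0) (f p)) := by unfold lcsSrc; infer_instance

end Instances

/-- The tables of the automaton of the common subsequences of `n` strings. -/
noncomputable def Mem.tabLcs (n : ℕ) (m : Mem) : Mem :=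
  (((m.tab 3 fun m i => lcsSrc n (m.arr 0) i).tab
    4 fun m i => lcsChar n (m.arr 0) 0 (i % lcsBase n (m.arr 0) ^ n)).tab
    5 fun m i => i % lcsBase n (m.arr 0) ^ n).tab
    6 fun _ _ => 1

/-- The table of the lengths of the longest paths. -/
noncomputable def Mem.tabLongest (m : Mem) : Mem :=
  m.tab 15 fun m v => least m.C fun y =>
    ∀ i, i < m.C → m.arr 3 i = v → m.arr 15 (m.arr 5 i) + 1 ≤ y

theorem isProg_tabLcs (n : ℕ) : IsProg (Mem.tabLcs n) := by
  unfold Mem.tabLcs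
  exact IsProg.comp (IsProg.comp (IsProg.comp (IsProg.tab 3 _) (IsProg.tab 4 _)) (IsProg.tab 5 _))
    (IsProg.tab 6 _)

theorem isProg_tabLongest : IsProg Mem.tabLongest := IsProg.tab 15 _

theorem Mem.tabLcs_spec {n : ℕ} {m : Mem} (hCD : m.C < m.D) (hm : ∀ i, m.arr 0 i < m.D)
    (hB : lcsBase n (m.arr 0) ^ n < m.D) (hC0 : 1 ≤ m.C) :
    (m.tabLcs n).C = m.C ∧ (m.tabLcs n).D = m.D ∧
    (∀ a, a ≠ 3 → a ≠ 4 → a ≠ 5 → a ≠ 6 → (m.tabLcs n).arr a = m.arr a) ∧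
    ∀ i < m.C, (m.tabLcs n).arr 3 i = lcsSrc n (m.arr 0) i ∧
      (m.tabLcs n).arr 4 i = lcsChar n (m.arr 0) 0 (i % lcsBase n (m.arr 0) ^ n) ∧
      (m.tabLcs n).arr 5 i = i % lcsBase n (m.arr 0) ^ n ∧ (m.tabLcs n).arr 6 i = 1 := by
  set m₃ := m.tab 3 fun m i => lcsSrc n (m.arr 0) i with h₃
  set m₄ := m₃.tab 4 fun m i => lcsChar n (m.arr 0) 0 (i % lcsBase n (m.arr 0) ^ n) with h₄
  set m₅ := m₄.tab 5 fun m i => i % lcsBase n (m.arr 0) ^ n with h₅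
  have h₆ : m.tabLcs n = m₅.tab 6 fun _ _ => 1 := rfl
  have C₃ : m₃.C = m.C := Mem.tab_C _ _ _
  have C₄ : m₄.C = m.C := (Mem.tab_C _ _ _).trans C₃
  have C₅ : m₅.C = m.C := (Mem.tab_C _ _ _).trans C₄
  have D₃ : m₃.D = m.D := Mem.tab_D _ _ _
  have D₄ : m₄.D = m.D := (Mem.tab_D _ _ _).trans D₃
  have D₅ : m₅.D = m.D := (Mem.tab_D _ _ _).trans D₄
  have n₃ : ∀ a, a ≠ 3 → m₃.arr a = m.arr a := fun a h => m.tab_arr_ne _ h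
  have n₄ : ∀ a, a ≠ 4 → m₄.arr a = m₃.arr a := fun a h => m₃.tab_arr_ne _ h
  have n₅ : ∀ a, a ≠ 5 → m₅.arr a = m₄.arr a := fun a h => m₄.tab_arr_ne _ h
  have n₆ : ∀ a, a ≠ 6 → (m.tabLcs n).arr a = m₅.arr a := fun a h => m₅.tab_arr_ne _ h
  have z₃ : m₃.arr 0 = m.arr 0 := n₃ 0 (by omega)
  have z₄ : m₄.arr 0 = m.arr 0 := (n₄ 0 (by omega)).trans z₃
  have hb₃ : ∀ i < m.C, lcsSrc n (m.arr 0) i < m.D := fun i hi => by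
    unfold lcsSrc
    split
    · exact (Nat.div_le_self _ _).trans_lt (by omega)
    · exact hB
  refine ⟨(Mem.tab_C _ _ _).trans C₅, (Mem.tab_D _ _ _).trans D₅, fun a a3 a4 a5 a6 => by
    rw [n₆ a a6, n₅ a a5, n₄ a a4, n₃ a a3], fun i hi => ⟨?_, ?_, ?_, ?_⟩⟩
  · rw [n₆ 3 (by omega), n₅ 3 (by omega), n₄ 3 (by omega), h₃]
    exact Mem.tab_arr_of_input (f := lcsSrc n) (by omega) hi (hb₃ i hi)
  · rw [n₆ 4 (by omega), n₅ 4 (by omega), h₄, Mem.tab_arr_of_input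
      (f := fun a i => lcsChar n a 0 (i % lcsBase n a ^ n)) (by omega) (by omega), z₃]
    rw [z₃, D₃]
    exact hm _
  · rw [n₆ 5 (by omega), h₅, Mem.tab_arr_of_input (f := fun a i => i % lcsBase n a ^ n)
      (by omega) (by omega), z₄]
    rw [z₄, D₄]
    exact (Nat.mod_le _ _).trans_lt (by omega)
  · rw [h₆, Mem.tab_arr_of_input (f := fun _ _ => 1) (by omega) (by omega)]
    omega

theorem Mem.tabLongest_spec {m : Mem} (hCD : m.C < m.D) {v : ℕ} (hv : v < m.C)
    (hlt : ∀ i < m.C, m.arr 3 i = v → m.arr 5 i < v) :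
    m.tabLongest.arr 15 v = least m.C fun y =>
      ∀ i < m.C, m.arr 3 i = v → m.tabLongest.arr 15 (m.arr 5 i) + 1 ≤ y := by
  set f : Mem → ℕ → ℕ := fun m v => least m.C fun y =>
    ∀ i, i < m.C → m.arr 3 i = v → m.arr 15 (m.arr 5 i) + 1 ≤ y with hf
  have hval : f (m.tabUpTo 15 f v) v = least m.C fun y =>
      ∀ i < m.C, m.arr 3 i = v → m.tabLongest.arr 15 (m.arr 5 i) + 1 ≤ y := by
    simp only [hf]
    rw [← hf, (m.tabUpTo_C 15 f v).1, m.tabUpTo_arr_ne f v (by omega : 3 ≠ 15),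
      m.tabUpTo_arr_ne f v (by omega : 5 ≠ 15)]
    congr 1
    funext y
    refine propext (forall₃_congr fun i hi hs => ?_)
    rw [m.tabUpTo_arr_of_lt 15 f (hlt i hi hs) hv.le]
    rfl
  rw [← hval]
  refine m.tab_arr_of_lt 15 f hv ?_
  rw [hval]
  exact (least_le _ _).trans_lt hCD

theorem sum_map_range (f : ℕ → ℕ) (n : ℕ) : ((List.range n).map f).sum = ∑ k ∈ range n, f k := by
  induction n with
  | zero => rfl
  | succ n ih => simp [List.range_succ, sum_range_succ, ih]

namespace LcsInstance

variable {n : ℕ} (x : LcsInstance n)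

/-- The array holds the lengths of the strings and, behind them, the strings. -/
structure Presents (a : ℕ → ℕ) : Prop where
  K_eq : a 2 = x.K
  length_eq : ∀ k : Fin n, a (4 + k) = (x.S k).length
  symbol_eq : ∀ (k : Fin n) (j : ℕ) (h : j < (x.S k).length), lcsSymbol n a k j = (x.S k)[j]

variable {x}

theorem Presents.base_eq {a : ℕ → ℕ} (h : x.Presents a) :
    lcsBase n a = x.K + ∑ k, (x.S k).length + 5 := by
  rw [lcsBase, inputSum, List.map_cons, List.sum_cons, h.K_eq, List.map_map]
  have h2 : a ∘ (4 + ·) = fun k => a (4 + k) := rfl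
  rw [h2, sum_map_range, sum_range]
  simp only [h.length_eq]

theorem Presents.length_lt {a : ℕ → ℕ} (h : x.Presents a) (k : Fin n) :
    (x.S k).length < lcsBase n a := by
  rw [h.base_eq]
  have := single_le_sum (f := fun k => (x.S k).length) (fun _ _ => Nat.zero_le _) (mem_univ k)
  omega

theorem Presents.full_eq {a : ℕ → ℕ} (h : x.Presents a) : lcsFull n a = x.full (lcsBase n a) := by
  rw [lcsFull, full, sum_range]
  exact sum_congr rfl fun k _ => by rw [h.length_eq]

theorem Presents.symbol_eq_some_iff {a : ℕ → ℕ} (h : x.Presents a) {Q : ℕ} {k : Fin n}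
    (hQ : Q / lcsBase n a ^ (k : ℕ) % lcsBase n a < (x.S k).length) :
    ∃ c : Fin x.σ, lcsChar n a k Q = c ∧
      ∀ c', x.symbol (lcsBase n a) Q k = some c' ↔ c = c' := by
  have hlt : (x.S k).length - 1 - Q / lcsBase n a ^ (k : ℕ) % lcsBase n a < (x.S k).length := by
    omega
  refine ⟨(x.S k)[(x.S k).length - 1 - Q / lcsBase n a ^ (k : ℕ) % lcsBase n a], ?_,
    fun c' => ?_⟩
  · rw [lcsChar, h.length_eq, h.symbol_eq k _ hlt]
  · rw [symbol, List.getElem?_eq_getElem hlt, Option.some.injEq]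

theorem Presents.isTable {a src lab tgt : ℕ → ℕ} {N : ℕ} (hn : 1 ≤ n) (h : x.Presents a)
    (hN : lcsBase n a ^ n * lcsBase n a ^ n ≤ N)
    (hsrc : ∀ i < N, src i = lcsSrc n a i)
    (hlab : ∀ i < N, lab i = lcsChar n a 0 (i % lcsBase n a ^ n))
    (htgt : ∀ i < N, tgt i = i % lcsBase n a ^ n) : x.IsTable (lcsBase n a) N src lab tgt where
  length_lt := h.length_lt
  le_N := hN
  tgt_eq := htgt
  src_lab i hi := by
    rw [hsrc i hi, lcsSrc, hlab i hi]
    have key : x.Good (lcsBase n a) (i / lcsBase n a ^ n) → IsEdge n (lcsBase n a) i →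
        ∀ k : Fin n, ∃ c : Fin x.σ, lcsChar n a k (i % lcsBase n a ^ n) = c ∧
          ∀ c', x.symbol (lcsBase n a) (i % lcsBase n a ^ n) k = some c' ↔ c = c' :=
      fun hg he k => h.symbol_eq_some_iff ((he.2 k).trans_le (hg.2 k))
    split
    · rename_i he
      have he' : IsEdge n (lcsBase n a) i := ⟨he.1, fun k => (he.2 k k.2).1⟩
      refine Or.inr ⟨rfl, he', fun hg => ?_⟩
      obtain ⟨c, hc, -⟩ := key hg he' ⟨0, hn⟩
      refine ⟨c, hc, fun k => ?_⟩
      obtain ⟨c₁, hc₁, hs⟩ := key hg he' k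
      rw [hs]
      exact Fin.ext (hc₁.symm.trans ((he.2 k k.2).2.trans hc))
    · rename_i hne
      refine Or.inl ⟨rfl, fun ⟨hg, he, c, hc⟩ => hne ⟨he.1, fun k hk => ⟨he.2 ⟨k, hk⟩, ?_⟩⟩⟩
      obtain ⟨c₁, hc₁, hs₁⟩ := key hg he ⟨k, hk⟩
      obtain ⟨c₀, hc₀, hs₀⟩ := key hg he ⟨0, hn⟩
      rw [(hs₁ c).1 (hc _)] at hc₁
      rw [(hs₀ c).1 (hc _)] at hc₀
      exact hc₁.trans hc₀.symm

end LcsInstance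

/-! ### The search for longest common subsequences -/

theorem getD_flatten (l : List (List ℕ)) : ∀ {k : ℕ} (hk : k < l.length) {j : ℕ},
    j < l[k].length →
    l.flatten.getD (∑ k' ∈ range k, (l.getD k' []).length + j) 0 = l[k].getD j 0 := by
  induction l with
  | nil => intro k hk; simp at hk
  | cons y l ih =>
    intro k hk j hj
    rcases k with _ | k
    · rw [sum_range_zero, zero_add, List.flatten_cons]
      exact List.getD_append _ _ _ _ hj
    · rw [sum_range_succ', List.flatten_cons, List.getD_append_right]
      · simp only [List.getD_cons_zero, List.getD_cons_succ, List.getElem_cons_succ] at hj ⊢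
        rw [← ih (by simpa using hk) hj]
        congr 1
        omega
      · simp only [List.getD_cons_zero]
        omega

/-- The presentation of an instance: the number of strings wanted, the size of the alphabet, the
lengths of the strings, and the strings. -/
def LcsInstance.presentation {n : ℕ} (x : LcsInstance n) : List ℕ :=
  x.K :: x.σ :: ((List.ofFn fun i => (x.S i).length) ++
    (List.ofFn fun i => (x.S i).map Fin.val).flatten)

theorem LcsInstance.input_eq {n : ℕ} (x : LcsInstance n) :
    (maxSumDiverseLCS n).input x = x.presentation := by
  have h : ∀ l : List (Fin x.σ), (l.flatMap fun a : Fin x.σ => [a.val]) = l.map Fin.val := fun l =>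
    List.map_eq_flatMap.symm
  simp [maxSumDiverseLCS, presentation, h, Function.comp_def]

/-- The memory in which the search for longest common subsequences starts, when `ε = a / b`. -/
noncomputable def LcsInstance.mem {n : ℕ} (x : LcsInstance n) (a b : ℕ) : Mem :=
  initMem (2 :: (List.range n).map (4 + ·)) (List.range (4 + n)) (2 * n + 3)
    (a :: b :: x.presentation)

namespace LcsInstance

variable {n : ℕ} (x : LcsInstance n) (a b : ℕ)

theorem mem_cells : (x.mem a b).arr 0 0 = a ∧ (x.mem a b).arr 0 1 = b ∧
    (x.mem a b).arr 0 2 = x.K ∧ (x.mem a b).arr 0 3 = x.σ :=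
  ⟨rfl, rfl, rfl, rfl⟩

theorem mem_length (k : Fin n) : (x.mem a b).arr 0 (4 + k) = (x.S k).length := by
  have h : (x.mem a b).arr 0 (k + 4) = ((List.ofFn fun i => (x.S i).length) ++
    (List.ofFn fun i => (x.S i).map Fin.val).flatten).getD k 0 := rfl
  rw [add_comm, h, List.getD_append _ _ _ _ (by simp), List.getD_eq_getElem _ _ (by simp),
    List.getElem_ofFn]

theorem mem_strings (q : ℕ) : (x.mem a b).arr 0 (4 + n + q)
    = (List.ofFn fun i => (x.S i).map Fin.val).flatten.getD q 0 := by
  have h : (x.mem a b).arr 0 (n + q + 4) = ((List.ofFn fun i => (x.S i).length) ++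
    (List.ofFn fun i => (x.S i).map Fin.val).flatten).getD (n + q) 0 := rfl
  rw [show 4 + n + q = n + q + 4 by omega, h, List.getD_append_right _ _ _ _ (by simp)]
  simp

theorem mem_presents : x.Presents ((x.mem a b).arr 0) where
  K_eq := rfl
  length_eq := x.mem_length a b
  symbol_eq k j hj := by
    have hlen : ∀ k : Fin n, ((List.ofFn fun i => (x.S i).map Fin.val).getD k []).length
        = (x.S k).length := fun k => by
      rw [List.getD_eq_getElem _ _ (by simp), List.getElem_ofFn, List.length_map]
    have hsum : ∑ k' ∈ range k, (x.mem a b).arr 0 (4 + k') = ∑ k' ∈ range k,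
        ((List.ofFn fun i => (x.S i).map Fin.val).getD k' []).length := by
      refine sum_congr rfl fun k' hk' => ?_
      have hk : k' < n := (mem_range.1 hk').trans k.2
      rw [hlen ⟨k', hk⟩, x.mem_length a b ⟨k', hk⟩]
    rw [lcsSymbol, hsum, add_assoc (4 + n), x.mem_strings, getD_flatten _ (by simp)]
    · rw [List.getElem_ofFn, List.getD_eq_getElem _ _ (by simpa using hj), List.getElem_map]
    · simpa using hj

theorem mem_C : (x.mem a b).C
    = lcsBase n ((x.mem a b).arr 0) ^ ((2 * n + 3) * (4 * b + 2) ^ 2) := rfl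

theorem mem_lt (i : ℕ) : (x.mem a b).arr 0 i + (x.mem a b).C < (x.mem a b).D := by
  have hD : (x.mem a b).D = (x.mem a b).C
      + (((List.range (4 + n)).map ((x.mem a b).arr 0)).sum + 1) := rfl
  have hcell : ∀ i < 4 + n, (x.mem a b).arr 0 i ≤
      ((List.range (4 + n)).map ((x.mem a b).arr 0)).sum := fun i hi =>
    List.le_sum_of_mem (List.mem_map.2 ⟨i, List.mem_range.2 hi, rfl⟩)
  have h : (x.mem a b).arr 0 i ≤ ((List.range (4 + n)).map ((x.mem a b).arr 0)).sum := by
    rcases Nat.lt_or_ge i (4 + n) with hi | hi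
    · exact hcell i hi
    · obtain ⟨q, rfl⟩ := Nat.exists_eq_add_of_le hi
      refine le_trans ?_ (hcell 3 (by omega))
      rw [x.mem_strings, (x.mem_cells a b).2.2.2]
      refine getD_le_of_forall_mem (fun y hy => ?_) q
      simp only [List.mem_flatten, List.mem_ofFn, exists_exists_eq_and, List.mem_map] at hy
      obtain ⟨k, c, -, rfl⟩ := hy
      exact c.2.le
  omega

theorem mem_bounded : (x.mem a b).Bounded := by
  refine ⟨by have := x.mem_lt a b 0; omega, fun i j => ?_⟩
  rcases eq_or_ne i 0 with rfl | hi
  · have := x.mem_lt a b j; omega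
  · change (if i = 0 then _ else 0) ≤ _
    rw [if_neg hi]
    exact Nat.zero_le _

theorem search_spec (hn : 1 ≤ n) {a b : ℕ} (ha : 1 ≤ a) (hb : 1 ≤ b) {m : Mem}
    (hm : m = ((x.mem a b).tabLcs n).tabLongest.solve (2 * n + 3) (fun m => lcsBase n (m.arr 0))
      (fun m => lcsFull n (m.arr 0)) fun m => m.arr 15 (lcsFull n (m.arr 0))) :
    (∃ X : Fin x.K → Fin (lcsLength x.S) → Fin x.σ, IsSubsetOfCard (LCS x.S) X ∧
      (∀ Y : Fin x.K → Fin (lcsLength x.S) → Fin x.σ, IsSubsetOfCard (LCS x.S) Y →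
        b * sumDiversity Y ≤ b * sumDiversity X + a * sumDiversity Y) ∧
      State.Outputs ⟨fun _ => 0, m.arr⟩ (1 :: concatStrings X)) ∨
    (m.arr 1 0 = 0 ∧
      ¬ ∃ Y : Fin x.K → Fin (lcsLength x.S) → Fin x.σ, IsSubsetOfCard (LCS x.S) Y) := by
  set m₀ := x.mem a b with hm₀
  obtain ⟨c0, c1, c2, c3⟩ := x.mem_cells a b
  have hP := x.mem_presents a b
  have hC := x.mem_C a b
  have hlt := x.mem_lt a b
  rw [← hm₀] at c0 c1 c2 c3 hP hC hlt
  have hBeq := hP.base_eq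
  have hlen := hP.length_lt
  have hfull := hP.full_eq
  obtain ⟨B, hB⟩ : ∃ B, B = lcsBase n (m₀.arr 0) := ⟨_, rfl⟩
  rw [← hB] at hC hBeq hlen hfull
  have hB5 : 5 ≤ B := by omega
  have hMC : B ^ (2 * n + 3) ≤ m₀.C := by
    rw [hC]
    exact Nat.pow_le_pow_right (by omega) (Nat.le_mul_of_pos_right _ (by positivity))
  have hBn : B ^ n * B ^ n ≤ B ^ (2 * n + 3) := by
    rw [← pow_add]; exact Nat.pow_le_pow_right (by omega) (by omega)
  have hBB : B * B ≤ B ^ (2 * n + 3) := by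
    rw [← pow_two]; exact Nat.pow_le_pow_right (by omega) (by omega)
  have hBn1 : B ^ n ≤ B ^ n * B ^ n := Nat.le_mul_self _
  have hBle : B ≤ B * B := Nat.le_mul_self _
  have hlt0 := hlt 0
  obtain ⟨t1, t2, t3, t4⟩ := Mem.tabLcs_spec (n := n) (m := m₀) (by omega)
    (fun i => by have := hlt i; omega) (by rw [← hB]; omega) (by omega)
  rw [← hB] at t4
  set m₁ := m₀.tabLcs n with hm₁
  have z : m₁.arr 0 = m₀.arr 0 := t3 0 (by omega) (by omega) (by omega) (by omega)
  have hT : x.IsTable B m₁.C (m₁.arr 3) (m₁.arr 4) (m₁.arr 5) := by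
    have := hP.isTable (src := m₁.arr 3) (lab := m₁.arr 4) (tgt := m₁.arr 5) (N := m₁.C) hn
    rw [← hB] at this
    exact this (by omega) (fun i hi => (t4 i (by omega)).1) (fun i hi => (t4 i (by omega)).2.1)
      fun i hi => (t4 i (by omega)).2.2.1
  have hdec : ∀ v, x.Good B v → ∀ i < m₁.C, m₁.arr 3 i = v → m₁.arr 5 i < v := by
    intro v hv i hi hs
    obtain ⟨h1, h2, -⟩ := hT.of_src hi (by rwa [hs])
    rw [hT.tgt_eq i hi, ← hs, h1]
    exact h2.lt hn
  set m₂ := m₁.tabLongest with hm₂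
  have hgr := hT.isGreatest (lp := m₂.arr 15) (C := m₁.C) hn (by omega) fun v hv =>
    Mem.tabLongest_spec (by omega) (by have := hv.1; omega) (hdec v hv)
  have hfg := good_full hlen
  have hr := hgr _ hfg.1
  have hrl := isGreatest_lcsLength hlen hr
  have hrB : lcsLength x.S < B := by
    obtain ⟨y, hy, hyl⟩ := hr.1
    have := length_le_of_mem_suffixCS hy ⟨0, hn⟩
    have := hlen ⟨0, hn⟩
    omega
  have n₂ : ∀ i, i ≠ 15 → m₂.arr i = m₁.arr i := fun i hi => m₁.tab_arr_ne _ hi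
  have C₂ : m₂.C = m₀.C := (m₁.tab_C _ _).trans t1
  have D₂ : m₂.D = m₀.D := (m₁.tab_D _ _).trans t2
  have z₂ : m₂.arr 0 = m₀.arr 0 := (n₂ 0 (by omega)).trans z
  have hsol := Mem.solve_spec (m := m₂) (e := 2 * n + 3) (B := fun m => lcsBase n (m.arr 0))
    (s := fun m => lcsFull n (m.arr 0)) (r := fun m => m.arr 15 (lcsFull n (m.arr 0)))
    (fun m' _ _ h => by simp only [h 0 (by omega) (by omega) (by omega)])
    (fun m' _ _ h => by simp only [h 0 (by omega) (by omega) (by omega)])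
    (fun m' _ _ h => by
      simp only [h 0 (by omega) (by omega) (by omega), h 15 (by omega) (by omega) (by omega)])
    (by omega)
  simp only [z₂, ← hB, hfull, hrl, c0, c1, c2, C₂, D₂] at hsol
  have hKB : x.K < B := by omega
  obtain ⟨E, ⟨e1, e2, e3, e4, e5, e6, e7, e8⟩, hE⟩ := hsol ha hb hC (by omega) (by omega)
    (by omega) (by omega) (hfg.1.1.trans_le (by omega)) x.one_le_K
    ((Nat.mul_lt_mul_of_lt_of_le hKB hrB.le (by omega)).trans_le hBB)
    (fun i hi => by
      rw [n₂ 5 (by omega), (t4 i (by omega)).2.2.1]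
      exact (Nat.mod_lt _ (Nat.pow_pos (by omega))).trans_le (by omega))
    (fun i hi => by
      rw [n₂ 4 (by omega), (t4 i (by omega)).2.1, lcsChar, lcsSymbol]
      exact (Nat.le_add_right _ _).trans_lt (hlt _))
    (fun q => by rw [n₂ 8 (by omega), t3 8 (by omega) (by omega) (by omega) (by omega)]; rfl)
    (by rw [n₂ 13 (by omega), t3 13 (by omega) (by omega) (by omega) (by omega)]; rfl)
  have hrec : E.Recognizes (x.Good B) (x.suffixCS B) := by
    refine IsTable.recognizes hn ?_ (fun v hv => ?_) e3
    · rw [e1, e5, e6, e7, n₂ 3 (by omega), n₂ 4 (by omega), n₂ 5 (by omega)]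
      exact ⟨hT.length_lt, hBn, fun i hi => hT.tgt_eq i (by omega),
        fun i hi => hT.src_lab i (by omega)⟩
    · have := hv.1
      rw [e8, n₂ 6 (by omega), (t4 v (by omega)).2.2.2]
      exact one_ne_zero
  rw [hrl] at hr
  rw [hm]
  refine search_answer e2 e4 (fun y => ?_) (fun y hy i hi => hrec.lt_of_inLang hy (by rwa [e4])) hE
  rw [mem_LCS_iff hlen hr, ← hrec.ofFn_mem_iff e4, e3]

end LcsInstance

theorem admitsPTAS_maxSumDiverseLCS {n : ℕ} (hn : 1 ≤ n) : AdmitsPTAS (maxSumDiverseLCS n) := by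
  refine admitsPTAS_of (idxB := 2 :: (List.range n).map (4 + ·)) (idxD := List.range (4 + n))
    (e := 2 * n + 3) (A := 5)
    (IsProg.comp (IsProg.comp (isProg_tabLcs n) isProg_tabLongest)
      (isProg_solve (2 * n + 3) (fun m => lcsBase n (m.arr 0))
      (fun m => lcsFull n (m.arr 0)) fun m => m.arr 15 (lcsFull n (m.arr 0)))) (by omega)
    (fun x a b => ?_)
    (fun x a b => by
      rw [LcsInstance.input_eq x]
      exact LcsInstance.mem_bounded x a b)
    (fun x a b ha hb m hm => by
      rw [LcsInstance.input_eq x] at hm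
      exact LcsInstance.search_spec x hn ha hb hm)
  rw [LcsInstance.input_eq x]
  have h := (LcsInstance.mem_presents x a b).base_eq
  have h1 : (maxSumDiverseLCS n).size x = (∑ i, (LcsInstance.S x i).length) + LcsInstance.K x := rfl
  rw [h1]
  refine h.le.trans ?_
  omega

end DiverseStrings

theorem mainTheorem3 :
    DiverseStrings.AdmitsPTAS DiverseStrings.maxSumDiverseStringSet ∧
    ∀ m : ℕ, 1 ≤ m → DiverseStrings.AdmitsPTAS (DiverseStrings.maxSumDiverseLCS m) :=
  ⟨DiverseStrings.admitsPTAS_maxSumDiverseStringSet,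
    fun _ hm => DiverseStrings.admitsPTAS_maxSumDiverseLCS hm⟩
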